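/- Let $M$ be a complex-valued function on $(0,\pi)$ with $(\pi-x)M(x)\in L_2(0,\pi)$ and let $h,H\in\mathbb{C}$. Let $L=L(M,h,H)$ be the operator in $L_2(0,\pi)$ given by $$(Ly)(x)=-y''(x)+\int_0^x M(x-t)\,y'(t)\,dt,\qquad 0<x<\pi,$$ on the domain of all $y\in W_2^2[0,\pi]$ satisfying the Robin boundary conditions $$y'(0)-h\,y(0)=0,\qquad y'(\pi)+H\,y(\pi)=0.$$ Then the spectrum of $L$ consists of eigenvalues only, and the eigenvalues, each repeated according to its algebraic multiplicity (the dimension of $\bigcup_{n\ge 1}\ker(L-\lambda)^n$), can be numbered as an infinite sequence $\{\lambda_k\}_{k\ge0}$ of complex numbers of the form $$\lambda_k=(k+\kappa_k)^2,\qquad k\ge 0,\qquad \{\kappa_k\}\in l_2,\ \text{ i.e. } \sum_{k\ge0}|\kappa_k|^2<\infty .$$ -/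

import Mathlib

open MeasureTheory Set
open scoped Real

noncomputable section

/-- The Hilbert space `L₂(0, π)` of complex-valued functions. -/
abbrev L2Pi : Type := Lp ℂ 2 (volume.restrict (Ioo (0 : ℝ) π))

/-- `y` belongs to the Sobolev space `W₂²[0, π]`, with first derivative `dy` and second derivative
`ddy`: `y` and `dy` are absolutely continuous on `[0, π]`, being the integrals of `dy` and `ddy`,
and `ddy ∈ L₂(0, π)`. -/
structure IsW22 (y dy ddy : ℝ → ℂ) : Prop where
  memLp : MemLp ddy 2 (volume.restrict (Ioo (0 : ℝ) π))
  dy_eq : ∀ x ∈ Icc (0 : ℝ) π, dy x = dy 0 + ∫ t in (0 : ℝ)..x, ddy t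
  y_eq : ∀ x ∈ Icc (0 : ℝ) π, y x = y 0 + ∫ t in (0 : ℝ)..x, dy t

/-- `ℓ y (x) = -y''(x) + ∫₀ˣ M(x - t) y'(t) dt`, in terms of `dy = y'` and `ddy = y''`. -/
def ell (M dy ddy : ℝ → ℂ) (x : ℝ) : ℂ :=
  -ddy x + ∫ t in (0 : ℝ)..x, M (x - t) * dy t

/-- The assumption on the kernel: `(π - x) M(x) ∈ L₂(0, π)`. -/
def IsKernel (M : ℝ → ℂ) : Prop :=
  MemLp (fun x : ℝ => ((π - x : ℝ) : ℂ) * M x) 2 (volume.restrict (Ioo (0 : ℝ) π))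

theorem IsW22.intervalIntegrable_ddy {y dy ddy : ℝ → ℂ} (hy : IsW22 y dy ddy) :
    IntervalIntegrable ddy volume 0 π := by
  rw [intervalIntegrable_iff_integrableOn_Ioo_of_le Real.pi_pos.le]
  exact hy.memLp.integrable (by norm_num)

theorem IsW22.continuousOn_dy {y dy ddy : ℝ → ℂ} (hy : IsW22 y dy ddy) :
    ContinuousOn dy (Icc 0 π) := by
  have h := intervalIntegral.continuousOn_primitive_interval' hy.intervalIntegrable_ddy
    (left_mem_uIcc)
  rw [uIcc_of_le Real.pi_pos.le] at h
  exact (continuousOn_const.add h).congr hy.dy_eq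

theorem IsW22.intervalIntegrable_dy {y dy ddy : ℝ → ℂ} (hy : IsW22 y dy ddy) :
    IntervalIntegrable dy volume 0 π := by
  apply ContinuousOn.intervalIntegrable
  rw [uIcc_of_le Real.pi_pos.le]
  exact hy.continuousOn_dy

theorem IsW22.continuousOn_y {y dy ddy : ℝ → ℂ} (hy : IsW22 y dy ddy) :
    ContinuousOn y (Icc 0 π) := by
  have h := intervalIntegral.continuousOn_primitive_interval' hy.intervalIntegrable_dy
    (left_mem_uIcc)
  rw [uIcc_of_le Real.pi_pos.le] at h
  exact (continuousOn_const.add h).congr hy.y_eq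

theorem IsW22.zero : IsW22 0 0 0 where
  memLp := MemLp.zero
  dy_eq := by simp
  y_eq := by simp

theorem intervalIntegrable_mono_pi {f : ℝ → ℂ} (hf : IntervalIntegrable f volume 0 π) {x : ℝ}
    (hx : x ∈ Icc (0 : ℝ) π) : IntervalIntegrable f volume 0 x :=
  hf.mono_set (by
    rw [uIcc_of_le hx.1, uIcc_of_le Real.pi_pos.le]
    exact Icc_subset_Icc_right hx.2)

theorem IsW22.add {y dy ddy z dz ddz : ℝ → ℂ} (hy : IsW22 y dy ddy) (hz : IsW22 z dz ddz) :
    IsW22 (y + z) (dy + dz) (ddy + ddz) where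
  memLp := hy.memLp.add hz.memLp
  dy_eq x hx := by
    simp only [Pi.add_apply]
    rw [intervalIntegral.integral_add (intervalIntegrable_mono_pi hy.intervalIntegrable_ddy hx)
      (intervalIntegrable_mono_pi hz.intervalIntegrable_ddy hx), hy.dy_eq x hx, hz.dy_eq x hx]
    ring
  y_eq x hx := by
    simp only [Pi.add_apply]
    rw [intervalIntegral.integral_add (intervalIntegrable_mono_pi hy.intervalIntegrable_dy hx)
      (intervalIntegrable_mono_pi hz.intervalIntegrable_dy hx), hy.y_eq x hx, hz.y_eq x hx]
    ring

theorem IsW22.smul {y dy ddy : ℝ → ℂ} (c : ℂ) (hy : IsW22 y dy ddy) :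
    IsW22 (c • y) (c • dy) (c • ddy) where
  memLp := hy.memLp.const_smul c
  dy_eq x hx := by
    simp only [Pi.smul_apply, smul_eq_mul]
    rw [intervalIntegral.integral_const_mul, hy.dy_eq x hx]
    ring
  y_eq x hx := by
    simp only [Pi.smul_apply, smul_eq_mul]
    rw [intervalIntegral.integral_const_mul, hy.y_eq x hx]
    ring

theorem IsKernel.intervalIntegrable {M : ℝ → ℂ} (hM : IsKernel M) {x : ℝ}
    (hx : x ∈ Ioo (0 : ℝ) π) : IntervalIntegrable M volume 0 x := by
  rw [intervalIntegrable_iff_integrableOn_Ioo_of_le hx.1.le]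
  have h1 : IntegrableOn (fun s : ℝ => ((π - s : ℝ) : ℂ) * M s) (Ioo 0 x) := by
    have h : IntegrableOn (fun s : ℝ => ((π - s : ℝ) : ℂ) * M s) (Ioo 0 π) :=
      MemLp.integrable (by norm_num) hM
    exact h.mono_set (Ioo_subset_Ioo_right hx.2.le)
  have h2 : ContinuousOn (fun s : ℝ => (((π - s : ℝ) : ℂ))⁻¹) (Icc 0 x) := by
    apply ContinuousOn.inv₀ (by fun_prop)
    intro s hs
    have : π - s ≠ 0 := by
      have := hs.2
      have := hx.2
      intro h
      linarith
    exact_mod_cast this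
  have h3 : IntegrableOn (fun s : ℝ => (((π - s : ℝ) : ℂ))⁻¹ * (((π - s : ℝ) : ℂ) * M s))
      (Ioo 0 x) := by
    rw [← integrableOn_Icc_iff_integrableOn_Ioo] at h1 ⊢
    exact h1.continuousOn_mul h2 isCompact_Icc
  refine h3.congr_fun (fun s hs => ?_) measurableSet_Ioo
  have : ((π - s : ℝ) : ℂ) ≠ 0 := by
    have h4 : π - s ≠ 0 := by
      have := hs.2
      have := hx.2
      intro h
      linarith
    exact_mod_cast h4
  simp only
  rw [inv_mul_cancel_left₀ this]

theorem IsKernel.intervalIntegrable_conv {M : ℝ → ℂ} (hM : IsKernel M) {y dy ddy : ℝ → ℂ}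
    (hy : IsW22 y dy ddy) {x : ℝ} (hx : x ∈ Ioo (0 : ℝ) π) :
    IntervalIntegrable (fun t => M (x - t) * dy t) volume 0 x := by
  have h1 := ((hM.intervalIntegrable hx).comp_sub_left x).symm
  simp only [sub_self, sub_zero] at h1
  refine h1.mul_continuousOn (hy.continuousOn_dy.mono ?_)
  rw [uIcc_of_le hx.1.le]
  exact Icc_subset_Icc_right hx.2.le

/-- The graph in `L₂(0, π) × L₂(0, π)` of the operator generated by `ℓ` on the functions
`y ∈ W₂²[0, π]` with `y'(0) - h y(0) = 0` and `y'(π) + H y(π) = 0`. -/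
def robinGraph (M : ℝ → ℂ) (hM : IsKernel M) (h H : ℂ) : Submodule ℂ (L2Pi × L2Pi) where
  carrier := {p | ∃ y dy ddy : ℝ → ℂ, IsW22 y dy ddy ∧
    dy 0 - h * y 0 = 0 ∧ dy π + H * y π = 0 ∧
    p.1 =ᵐ[volume.restrict (Ioo (0 : ℝ) π)] y ∧
    p.2 =ᵐ[volume.restrict (Ioo (0 : ℝ) π)] ell M dy ddy}
  zero_mem' := by
    refine ⟨0, 0, 0, IsW22.zero, by simp, by simp, Lp.coeFn_zero _ _ _, ?_⟩
    filter_upwards [Lp.coeFn_zero ℂ 2 (volume.restrict (Ioo (0 : ℝ) π))] with x hx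
    simpa [ell] using hx
  add_mem' := by
    rintro ⟨u, f⟩ ⟨v, g⟩ ⟨y, dy, ddy, hy, hy0, hyπ, hu, hf⟩ ⟨z, dz, ddz, hz, hz0, hzπ, hv, hg⟩
    refine ⟨y + z, dy + dz, ddy + ddz, hy.add hz, ?_, ?_, ?_, ?_⟩
    · simp only [Pi.add_apply]
      linear_combination hy0 + hz0
    · simp only [Pi.add_apply]
      linear_combination hyπ + hzπ
    · exact (Lp.coeFn_add u v).trans (hu.add hv)
    · filter_upwards [Lp.coeFn_add f g, hf, hg, ae_restrict_mem measurableSet_Ioo]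
        with x h1 h2 h3 hx
      change (f + g : L2Pi) x = _
      simp only [Pi.add_apply] at h1
      rw [h1, h2, h3]
      simp only [ell, Pi.add_apply, mul_add]
      rw [intervalIntegral.integral_add (hM.intervalIntegrable_conv hy hx)
        (hM.intervalIntegrable_conv hz hx)]
      ring
  smul_mem' := by
    rintro c ⟨u, f⟩ ⟨y, dy, ddy, hy, hy0, hyπ, hu, hf⟩
    refine ⟨c • y, c • dy, c • ddy, hy.smul c, ?_, ?_, ?_, ?_⟩
    · simp only [Pi.smul_apply, smul_eq_mul]
      linear_combination c * hy0
    · simp only [Pi.smul_apply, smul_eq_mul]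
      linear_combination c * hyπ
    · exact (Lp.coeFn_smul c u).trans (hu.const_smul c)
    · filter_upwards [Lp.coeFn_smul c f, hf] with x h1 h2
      change (c • f : L2Pi) x = _
      simp only [Pi.smul_apply, smul_eq_mul] at h1
      rw [h1, h2]
      simp only [ell, Pi.smul_apply, smul_eq_mul, mul_left_comm _ c]
      rw [intervalIntegral.integral_const_mul]
      ring

theorem eq_zero_of_primitive_eq_zero {f : ℝ → ℂ} (hf : IntervalIntegrable f volume 0 π)
    (h : ∀ x ∈ Icc (0 : ℝ) π, ∫ t in (0 : ℝ)..x, f t = 0) :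
    f =ᵐ[volume.restrict (Ioo (0 : ℝ) π)] 0 := by
  have h1 := hf.ae_hasDerivAt_integral
  rw [Filter.EventuallyEq, ae_restrict_iff' measurableSet_Ioo]
  filter_upwards [h1] with x hx hxI
  have h2 := hx (by rw [uIcc_of_le Real.pi_pos.le]; exact Ioo_subset_Icc_self hxI) 0
    (by rw [uIcc_of_le Real.pi_pos.le]; exact left_mem_Icc.2 Real.pi_pos.le)
  have h3 : (fun x => ∫ t in (0 : ℝ)..x, f t) =ᶠ[nhds x] fun _ => 0 := by
    filter_upwards [Ioo_mem_nhds hxI.1 hxI.2] with z hz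
    exact h z (Ioo_subset_Icc_self hz)
  exact h2.unique ((hasDerivAt_const x (0 : ℂ)).congr_of_eventuallyEq h3)

/-- `ℓ y` depends only on the class of `y` in `L₂(0, π)`. -/
theorem robinGraph_snd_eq_zero (M : ℝ → ℂ) (hM : IsKernel M) (h H : ℂ) :
    ∀ p ∈ robinGraph M hM h H, p.1 = 0 → p.2 = 0 := by
  rintro ⟨u, f⟩ ⟨y, dy, ddy, hy, -, -, hu, hf⟩ hu0
  simp only at hu0 hu hf ⊢
  subst hu0
  have hpi := Real.pi_pos
  have y0 : EqOn y 0 (Icc 0 π) :=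
    Measure.eqOn_Icc_of_ae_eq volume hpi.ne
      ((hu.symm.trans (Lp.coeFn_zero _ _ _)).filter_mono
        (by rw [restrict_Ioo_eq_restrict_Icc])) hy.continuousOn_y continuousOn_const
  have dy0 : EqOn dy 0 (Icc 0 π) := by
    refine Measure.eqOn_Icc_of_ae_eq volume hpi.ne ?_ hy.continuousOn_dy continuousOn_const
    rw [← restrict_Ioo_eq_restrict_Icc]
    refine eq_zero_of_primitive_eq_zero hy.intervalIntegrable_dy fun x hx => ?_
    have := hy.y_eq x hx
    rw [y0 hx, y0 (left_mem_Icc.2 hpi.le)] at this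
    simpa using this.symm
  have ddy0 := eq_zero_of_primitive_eq_zero hy.intervalIntegrable_ddy fun x hx => by
    have := hy.dy_eq x hx
    rw [dy0 hx, dy0 (left_mem_Icc.2 hpi.le)] at this
    simpa using this.symm
  refine Lp.ext ?_
  filter_upwards [hf, ddy0, ae_restrict_mem measurableSet_Ioo,
    Lp.coeFn_zero ℂ 2 (volume.restrict (Ioo (0 : ℝ) π))] with x h1 h2 hx h4
  rw [h1, h4, ell, h2]
  have : ∫ t in (0 : ℝ)..x, M (x - t) * dy t = ∫ t in (0 : ℝ)..x, (0 : ℂ) := by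
    refine intervalIntegral.integral_congr fun t ht => ?_
    rw [uIcc_of_le hx.1.le] at ht
    have : dy t = 0 := dy0 ⟨ht.1, ht.2.trans hx.2.le⟩
    simp [this]
  rw [this]
  simp

/-- The operator `L(M, h, H)` in `L₂(0, π)`: `L y = ℓ y` with domain
`{y ∈ W₂²[0, π] : y'(0) - h y(0) = 0, y'(π) + H y(π) = 0}`. -/
def robinOperator (M : ℝ → ℂ) (hM : IsKernel M) (h H : ℂ) : L2Pi →ₗ.[ℂ] L2Pi :=
  (robinGraph M hM h H).toLinearPMap

theorem robinOperator_graph (M : ℝ → ℂ) (hM : IsKernel M) (h H : ℂ) :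
    (robinOperator M hM h H).graph = robinGraph M hM h H :=
  Submodule.toLinearPMap_graph_eq _ (robinGraph_snd_eq_zero M hM h H)

section Spectral

variable {E : Type*} [NormedAddCommGroup E] [NormedSpace ℂ E]

/-- The spectrum of an unbounded operator `A`: the complement of the set of those `z` for which
`A - z` is a bijection of the domain of `A` onto `E` with a bounded inverse `R`. -/
def opSpectrum (A : E →ₗ.[ℂ] E) : Set ℂ :=
  {z | ∃ R : E →L[ℂ] E,
    (∀ f : E, ∃ hf : R f ∈ A.domain, A ⟨R f, hf⟩ - z • R f = f) ∧
    (∀ u : A.domain, R (A u - z • (u : E)) = u)}ᶜ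

/-- `z` is an eigenvalue of the unbounded operator `A`. -/
def IsOpEigenvalue (A : E →ₗ.[ℂ] E) (z : ℂ) : Prop :=
  ∃ u : A.domain, (u : E) ≠ 0 ∧ A u = z • (u : E)

/-- The kernel of `(A - z) ^ n`: `u ∈ ker (A - z) ^ (n + 1)` if and only if `u ∈ dom A` and
`A u - z u ∈ ker (A - z) ^ n`. -/
def opKerPow (A : E →ₗ.[ℂ] E) (z : ℂ) : ℕ → Submodule ℂ E
  | 0 => ⊥
  | n + 1 => ((opKerPow A z n).comap (A.toFun - z • A.domain.subtype)).map A.domain.subtype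

/-- The root space of `A` at `z`, spanned by the eigenvectors and associated vectors. Its dimension
is the algebraic multiplicity of `z`. -/
def opRootSpace (A : E →ₗ.[ℂ] E) (z : ℂ) : Submodule ℂ E :=
  ⨆ n : ℕ, opKerPow A z n

end Spectral

end

/-! Write `S₀` for the solution of `ℓ y = 0` with `y(0) = 0`, `y'(0) = 1`. The solutions of `ℓ y =
f` with `y'(0) = h y(0)` are `V f + a φ`, where `V f = -S₀ * f`, `φ = 1 + h S₀` and `a = y(0)`. So
the operator is cut out by one scalar condition at `π`, of the form `ν f + a d = 0`
(`mem_robinGraph_iff`). The operator `V` is Volterra, hence `1 - z V` is invertible for every `z`.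
This reduces all spectral questions to the entire function `Δ(z) = d + z ν((1 - z V)⁻¹ φ)`: its
zeros are the spectrum and consist of eigenvalues (`opSpectrum_eq`, `isOpEigenvalue_iff`), and the
order of a zero is the dimension of the root space (`rank_opRootSpace`).

It remains to locate the zeros of `Δ(ρ²) = -ρ (sin πρ + G(ρ))`. By `exists_enumeration_zeros` two
properties of `G` suffice: `G(ρ) = o(exp(π|Im ρ|))` as `|ρ| → ∞`, and `∑ |G(k + ζ k)|² < ∞` for all
bounded `ζ`. Rouché's theorem on `|ρ| = N + 1/2` counts the zeros against those of `-ρ sin πρ`. The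
equation `sin πρ = -G(ρ)` then puts the `k`-th root `ρ k` near `k`, with `|ρ k - k| ≤ |G(ρ k)|`, and
the square sums with `ζ k = ρ k - k` give the `l₂` remainder.

The difficulty in estimating `G` is that `M` need not be integrable near `π`. Hardy's inequality
makes `∫₀ˣ |M|` square integrable (`inL2_kerInt`), so that convolutions with `M` are defined and
associative. With `z = ρ²` the solution `S` with the same Cauchy data satisfies Duhamel's formulas
`ρ S = sin + sin * B` and `S' = cos + cos * B`, where `B = M * S'`. Inserting the second into the
first gives `sin * B = D + D * B` with `D = M * cos * sin` (`sinRem_eq`). Since `(cos * sin)(x) =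
(x/2) sin ρx`, `D(x)` is a sine transform of `(x - r) M(r) / 2` on `(0, x)`, and the factor `x - r ≤
π - r` tames the singularity. Cauchy–Schwarz gives the decay of `D` off the real axis and Bessel's
inequality its square sums; both pass to `D * B` because `B` is dominated by the square integrable
`∫₀ˣ |M|` (`exists_norm_memTerm_le`, `exists_sum_sq_sinRem_le`). -/

noncomputable section

/-! ### Abstract rank-one boundary conditions for Volterra operators -/

section BoundaryModel

variable {E : Type*} [NormedAddCommGroup E] [NormedSpace ℂ E]

/-- The graph of `A` consists of the pairs `(V f + a φ, f)` with `ν f + a d = 0`: the operator `V`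
is a quasi-nilpotent right inverse of an extension of `A` whose kernel is spanned by `φ`, and
`ν f + a d` is the value of the boundary condition which singles out `A`. -/
structure IsVolterraModel (A : E →ₗ.[ℂ] E) (V : E →L[ℂ] E) (φ : E) (ν : E →L[ℂ] ℂ) (d : ℂ) :
    Prop where
  mem_graph : ∀ u f : E, (u, f) ∈ A.graph ↔ ∃ a : ℂ, u = V f + a • φ ∧ ν f + a * d = 0
  isUnit : ∀ z : ℂ, IsUnit (1 - z • V)
  eq_zero : ∀ (f : E) (a : ℂ), V f + a • φ = 0 → f = 0 ∧ a = 0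

/-- The Fredholm resolvent `(1 - z V)⁻¹`. -/
def volterraInv (V : E →L[ℂ] E) (z : ℂ) : E →L[ℂ] E := Ring.inverse (1 - z • V)

/-- The characteristic function of the operator described by `IsVolterraModel`. -/
def charDet (V : E →L[ℂ] E) (φ : E) (ν : E →L[ℂ] ℂ) (d : ℂ) (z : ℂ) : ℂ :=
  d + z * ν (volterraInv V z φ)

/-- The chain of eigenvectors and associated vectors at `z`. -/
def rootChain (V : E →L[ℂ] E) (φ : E) (z : ℂ) (j : ℕ) : E :=
  ((V * volterraInv V z) ^ j) (volterraInv V z φ)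

/-- The Taylor coefficients of the characteristic function at `z`. -/
def charCoeff (V : E →L[ℂ] E) (φ : E) (ν : E →L[ℂ] ℂ) (d : ℂ) (z : ℂ) : ℕ → ℂ
  | 0 => charDet V φ ν d z
  | j + 1 => ν (volterraInv V z (rootChain V φ z j))

/-- The Taylor remainders of the characteristic function at `z`. -/
def charRem (V : E →L[ℂ] E) (φ : E) (ν : E →L[ℂ] ℂ) (d : ℂ) (z : ℂ) : ℕ → ℂ → ℂ
  | 0, w => charDet V φ ν d w
  | j + 1, w => ν (volterraInv V z (((V * volterraInv V z) ^ j) (volterraInv V w φ)))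

namespace IsVolterraModel

variable {A : E →ₗ.[ℂ] E} {V : E →L[ℂ] E} {φ : E} {ν : E →L[ℂ] ℂ} {d : ℂ}

theorem inv_mul (hA : IsVolterraModel A V φ ν d) (z : ℂ) :
    volterraInv V z * (1 - z • V) = 1 := Ring.inverse_mul_cancel _ (hA.isUnit z)

theorem mul_inv (hA : IsVolterraModel A V φ ν d) (z : ℂ) :
    (1 - z • V) * volterraInv V z = 1 := Ring.mul_inverse_cancel _ (hA.isUnit z)

theorem inv_eq (hA : IsVolterraModel A V φ ν d) (z : ℂ) :
    volterraInv V z = 1 + z • (V * volterraInv V z) := by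
  have h := hA.mul_inv z
  rw [sub_mul, one_mul, smul_mul_assoc] at h
  rw [← h]; abel

theorem inv_comm (hA : IsVolterraModel A V φ ν d) (z : ℂ) :
    volterraInv V z * V = V * volterraInv V z := by
  have h1 : (1 - z • V) * V = V * (1 - z • V) := by
    simp [sub_mul, mul_sub]
  calc volterraInv V z * V
      = volterraInv V z * V * ((1 - z • V) * volterraInv V z) := by rw [hA.mul_inv, mul_one]
    _ = volterraInv V z * (V * (1 - z • V)) * volterraInv V z := by simp only [mul_assoc]
    _ = (volterraInv V z * (1 - z • V)) * (V * volterraInv V z) := by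
        rw [← h1]; simp only [mul_assoc]
    _ = V * volterraInv V z := by rw [hA.inv_mul, one_mul]

theorem inv_injective (hA : IsVolterraModel A V φ ν d) (z : ℂ) (x : E)
    (hx : volterraInv V z x = 0) : x = 0 := by
  have h := congrArg (fun T : E →L[ℂ] E => T x) (hA.mul_inv z)
  simpa [hx] using h.symm

/-- The resolvent identity. -/
theorem inv_sub (hA : IsVolterraModel A V φ ν d) (z w : ℂ) :
    volterraInv V w = volterraInv V z + (w - z) • (V * volterraInv V z * volterraInv V w) := by
  have h : volterraInv V z * ((1 - z • V) - (1 - w • V)) * volterraInv V w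
      = volterraInv V w - volterraInv V z := by
    rw [mul_sub, sub_mul, hA.inv_mul, one_mul, mul_assoc, hA.mul_inv, mul_one]
  have h2 : (1 - z • V) - (1 - w • V) = (w - z) • V := by
    rw [sub_smul]; abel
  rw [h2, mul_smul_comm, smul_mul_assoc, hA.inv_comm] at h
  rw [h]; abel

/-- Solves `(A - z) u = g`. Multiplying `u = V (z u + g) + a φ` by `(1 - z V)⁻¹` isolates `u`;
substituted into the boundary condition, it makes the characteristic function the coefficient of
`a`. -/
theorem graph_iff (hA : IsVolterraModel A V φ ν d) (z : ℂ) (u g : E) :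
    (u, z • u + g) ∈ A.graph ↔ ∃ a : ℂ, u = V (volterraInv V z g) + a • volterraInv V z φ ∧
      ν (volterraInv V z g) + a * charDet V φ ν d z = 0 := by
  rw [hA.mem_graph]
  refine exists_congr fun a => ?_
  have key : u = V (z • u + g) + a • φ ↔
      u = V (volterraInv V z g) + a • volterraInv V z φ := by
    have h1 : V (volterraInv V z g) + a • volterraInv V z φ
        = volterraInv V z (V g + a • φ) := by
      have := congrArg (fun T : E →L[ℂ] E => T g) (hA.inv_comm z)
      simp only [mul_apply_eq_comp] at this
      simp [this]
    rw [h1]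
    constructor
    · intro h
      have h2 : (1 - z • V) u = V g + a • φ := by
        have : u - z • V u = V g + a • φ := by
          nth_rw 1 [h]
          simp only [map_add, map_smul]; abel
        simpa using this
      rw [← h2]
      have := congrArg (fun T : E →L[ℂ] E => T u) (hA.inv_mul z)
      simpa using this.symm
    · intro h
      have h2 : (1 - z • V) u = V g + a • φ := by
        rw [h]
        have := congrArg (fun T : E →L[ℂ] E => T (V g + a • φ)) (hA.mul_inv z)
        simpa only [mul_apply_eq_comp, one_apply_eq_self] using this
      have h3 : u - z • V u = V g + a • φ := by simpa using h2
      simp only [map_add, map_smul]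
      rw [add_assoc, ← h3]; abel
  rw [key]
  refine and_congr_right fun hu => ?_
  have h1 : volterraInv V z g = g + z • V (volterraInv V z g) := by
    have := congrArg (fun T : E →L[ℂ] E => T g) (hA.inv_eq z)
    simpa using this
  have h2 : ν (z • u + g) + a * d = ν (volterraInv V z g) + a * charDet V φ ν d z := by
    have h3 := congrArg ν h1
    rw [hu]
    simp only [charDet, map_add, map_smul, smul_eq_mul] at h3 ⊢
    linear_combination -h3
  rw [h2]

theorem apply_eq_of_graph {u g : E} {z : ℂ} (hu : (u, z • u + g) ∈ A.graph) :
    ∃ hu : u ∈ A.domain, A ⟨u, hu⟩ - z • u = g := by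
  obtain ⟨y, h1, h2⟩ := (LinearPMap.mem_graph_iff A).1 hu
  simp only at h1 h2
  subst h1
  exact ⟨y.2, by simp [h2]⟩

theorem isOpEigenvalue_iff (hA : IsVolterraModel A V φ ν d) (z : ℂ) :
    IsOpEigenvalue A z ↔ charDet V φ ν d z = 0 := by
  constructor
  · rintro ⟨u, hu0, hu⟩
    have h : ((u : E), z • (u : E) + 0) ∈ A.graph := by
      rw [add_zero, ← hu]; exact LinearPMap.mem_graph A u
    obtain ⟨a, h1, h2⟩ := (hA.graph_iff z _ _).1 h
    simp only [map_zero, zero_add, mul_eq_zero] at h1 h2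
    rcases h2 with h2 | h2
    · exact absurd (by rw [h1, h2, zero_smul]) hu0
    · exact h2
  · intro h
    have h1 : (volterraInv V z φ, z • volterraInv V z φ + 0) ∈ A.graph :=
      (hA.graph_iff z _ _).2 ⟨1, by simp, by simp [h]⟩
    obtain ⟨hu, h2⟩ := apply_eq_of_graph h1
    refine ⟨⟨_, hu⟩, ?_, by simpa [sub_eq_zero] using h2⟩
    intro h3
    have h4 := hA.inv_injective z _ h3
    have := hA.eq_zero 0 1 (by simp [h4])
    exact one_ne_zero this.2

/-- Off the zeros the scalar equation of `graph_iff` determines `a`, so the resolvent is the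
Volterra resolvent minus a rank-one operator. At a zero there is an eigenvector, which no left
inverse tolerates. -/
theorem opSpectrum_eq (hA : IsVolterraModel A V φ ν d) :
    opSpectrum A = {z | charDet V φ ν d z = 0} := by
  ext z
  rw [opSpectrum, mem_compl_iff, mem_ofPred_eq, mem_ofPred_eq, not_iff_comm]
  constructor
  · intro h
    refine ⟨V * volterraInv V z -
      (charDet V φ ν d z)⁻¹ • (ν ∘L volterraInv V z).smulRight (volterraInv V z φ), ?_, ?_⟩
    · intro f
      apply apply_eq_of_graph
      refine (hA.graph_iff z _ _).2 ⟨-((charDet V φ ν d z)⁻¹ * ν (volterraInv V z f)), ?_, ?_⟩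
      · simp [mul_smul, sub_eq_add_neg]
      · field_simp; ring
    · intro u
      have hu : ((u : E), z • (u : E) + (A u - z • (u : E))) ∈ A.graph := by
        rw [add_sub_cancel]; exact LinearPMap.mem_graph A u
      obtain ⟨a, h1, h2⟩ := (hA.graph_iff z _ _).1 hu
      set g := A u - z • (u : E)
      have h3 : a = -((charDet V φ ν d z)⁻¹ * ν (volterraInv V z g)) := by
        field_simp
        linear_combination h2
      conv_rhs => rw [h1, h3]
      simp [mul_smul, sub_eq_add_neg]
  · rintro ⟨R, -, hR⟩ h
    obtain ⟨u, hu0, hu⟩ := (hA.isOpEigenvalue_iff z).2 h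
    have := hR u
    rw [hu, sub_self, map_zero] at this
    exact hu0 this.symm

theorem rootChain_succ (V : E →L[ℂ] E) (φ : E) (z : ℂ) (j : ℕ) :
    rootChain V φ z (j + 1) = V (volterraInv V z (rootChain V φ z j)) := by
  simp [rootChain, pow_succ']

/-- One step of division by `w - z`, supplied by the resolvent identity. Iterated, it gives the
Taylor expansion of the characteristic function with an explicit remainder. -/
theorem charRem_eq (hA : IsVolterraModel A V φ ν d) (z w : ℂ) (n : ℕ) :
    charRem V φ ν d z n w = charCoeff V φ ν d z n + (w - z) * charRem V φ ν d z (n + 1) w := by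
  have h1 := congrArg (fun T : E →L[ℂ] E => T φ) (hA.inv_sub z w)
  simp only [add_apply, smul_apply,
    mul_apply_eq_comp] at h1
  cases n with
  | zero =>
    have h2 := congrArg (fun T : E →L[ℂ] E => T (volterraInv V w φ)) (hA.inv_eq z)
    simp only [add_apply, smul_apply,
      mul_apply_eq_comp, one_apply_eq_self] at h2
    simp only [charRem, charCoeff, charDet, pow_zero, one_apply_eq_self]
    rw [h2]
    have h3 := congrArg ν h1
    simp only [map_add, map_smul, smul_eq_mul] at h3 ⊢
    linear_combination z * h3
  | succ n =>
    simp only [charRem, charCoeff, rootChain]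
    nth_rw 1 [h1]
    simp only [map_add, map_smul, smul_eq_mul, pow_succ, mul_apply_eq_comp]

theorem charRem_self (hA : IsVolterraModel A V φ ν d) (z : ℂ) (n : ℕ) :
    charRem V φ ν d z n z = charCoeff V φ ν d z n := by
  simp [hA.charRem_eq z z n]

theorem charDet_eq_pow_mul (hA : IsVolterraModel A V φ ν d) (z : ℂ) (n : ℕ)
    (hn : ∀ j < n, charCoeff V φ ν d z j = 0) (w : ℂ) :
    charDet V φ ν d w = (w - z) ^ n * charRem V φ ν d z n w := by
  induction n with
  | zero => simp [charRem]
  | succ n ih =>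
    rw [ih fun j hj => hn j (by omega), hA.charRem_eq, hn n (by omega)]
    ring

theorem mem_opKerPow_succ (A : E →ₗ.[ℂ] E) (z : ℂ) (n : ℕ) (u : E) :
    u ∈ opKerPow A z (n + 1) ↔ ∃ g ∈ opKerPow A z n, (u, z • u + g) ∈ A.graph := by
  simp only [opKerPow, Submodule.mem_map, Submodule.mem_comap]
  constructor
  · rintro ⟨y, hy, rfl⟩
    refine ⟨_, hy, ?_⟩
    simp
  · rintro ⟨g, hg, hu⟩
    obtain ⟨h1, h2⟩ := apply_eq_of_graph hu
    refine ⟨⟨u, h1⟩, ?_, rfl⟩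
    rw [← h2] at hg
    exact hg

theorem mem_span_rootChain {ψ : ℕ → E} {k : ℕ} {u : E} :
    u ∈ Submodule.span ℂ (range fun i : Fin k => ψ i) ↔
      ∃ c : ℕ → ℂ, u = ∑ j ∈ Finset.range k, c j • ψ j := by
  rw [Submodule.mem_span_range_iff_exists_fun]
  constructor
  · rintro ⟨c, rfl⟩
    refine ⟨fun j => if h : j < k then c ⟨j, h⟩ else 0, ?_⟩
    rw [← Fin.sum_univ_eq_sum_range (fun j => (if h : j < k then c ⟨j, h⟩ else 0) • ψ j)]
    simp
  · rintro ⟨c, rfl⟩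
    exact ⟨fun i => c i, by rw [← Fin.sum_univ_eq_sum_range (fun j => c j • ψ j)]⟩

/-- The operator `A - z` shifts a combination of chain vectors down by one, subject to the single
condition `∑ c j * charCoeff j = 0`. The condition is void while the Taylor coefficients vanish; the
first nonzero one forces `c m = 0` and the chain stops at length `m`. -/
theorem opKerPow_eq (hA : IsVolterraModel A V φ ν d) (z : ℂ) (m : ℕ)
    (hm : ∀ j < m, charCoeff V φ ν d z j = 0) (hm' : charCoeff V φ ν d z m ≠ 0) (n : ℕ) :
    opKerPow A z n =
      Submodule.span ℂ (range fun i : Fin (min n m) => rootChain V φ z i) := by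
  have hsum : ∀ (k : ℕ) (c : ℕ → ℂ),
      V (volterraInv V z (∑ j ∈ Finset.range k, c (j + 1) • rootChain V φ z j)) +
        c 0 • volterraInv V z φ = ∑ j ∈ Finset.range (k + 1), c j • rootChain V φ z j := by
    intro k c
    rw [Finset.sum_range_succ']
    simp only [map_sum, map_smul, rootChain_succ]
    simp [rootChain]
  have hsum' : ∀ (k : ℕ) (c : ℕ → ℂ),
      ν (volterraInv V z (∑ j ∈ Finset.range k, c (j + 1) • rootChain V φ z j)) +
        c 0 * charDet V φ ν d z = ∑ j ∈ Finset.range (k + 1), c j * charCoeff V φ ν d z j := by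
    intro k c
    rw [Finset.sum_range_succ']
    simp [charCoeff]
  induction n with
  | zero =>
    have : IsEmpty (Fin (min 0 m)) := by rw [Nat.zero_min]; infer_instance
    rw [range_eq_empty, Submodule.span_empty]; rfl
  | succ n ih =>
    ext u
    rw [mem_opKerPow_succ, ih, mem_span_rootChain]
    constructor
    · rintro ⟨g, hg, hu⟩
      obtain ⟨c', rfl⟩ := mem_span_rootChain.1 hg
      obtain ⟨a, h1, h2⟩ := (hA.graph_iff z _ _).1 hu
      -- The coefficients of `g`, moved up by one, with the free constant `a` put in front.
      let c : ℕ → ℂ := fun j => Nat.casesOn j a c'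
      have h3 := (hsum (min n m) c).symm.trans h1.symm
      have h4 := (hsum' (min n m) c).symm.trans h2
      refine ⟨c, ?_⟩
      rw [← h3]
      rcases lt_or_ge n m with hnm | hnm
      · rw [min_eq_left hnm.le, min_eq_left (by omega : n + 1 ≤ m)]
      · rw [min_eq_right hnm, min_eq_right (by omega : m ≤ n + 1)]
        rw [min_eq_right hnm, Finset.sum_range_succ, Finset.sum_eq_zero, zero_add] at h4
        · have h5 : c m = 0 := (mul_eq_zero.1 h4).resolve_right hm'
          rw [Finset.sum_range_succ, h5, zero_smul, add_zero]
        · intro j hj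
          rw [hm j (Finset.mem_range.1 hj), mul_zero]
    · rintro ⟨c, hc⟩
      rcases Nat.eq_zero_or_pos (min (n + 1) m) with h0 | h0
      · rw [h0] at hc
        refine ⟨0, Submodule.zero_mem _, ?_⟩
        rw [hc]
        simp
      · obtain ⟨k, hk⟩ : ∃ k, min (n + 1) m = k + 1 := ⟨_, (Nat.succ_pred_eq_of_pos h0).symm⟩
        refine ⟨∑ j ∈ Finset.range k, c (j + 1) • rootChain V φ z j, ?_, ?_⟩
        · refine Submodule.sum_mem _ fun j hj => Submodule.smul_mem _ _ (Submodule.subset_span ?_)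
          have := Finset.mem_range.1 hj
          exact ⟨⟨j, by omega⟩, rfl⟩
        · refine (hA.graph_iff z _ _).2 ⟨c 0, ?_, ?_⟩
          · rw [hsum, hc, hk]
          · rw [hsum']
            refine Finset.sum_eq_zero fun j hj => ?_
            rw [hm j (by have := Finset.mem_range.1 hj; omega), mul_zero]

/-- A vanishing combination equals `(1 - z V)⁻¹ (V x + c 0 • φ)`, where `x` is the combination with
shifted coefficients. The axiom `eq_zero` kills `c 0` and `x`, and induction handles `x`. -/
theorem linearIndependent_rootChain (hA : IsVolterraModel A V φ ν d) (z : ℂ) (m : ℕ) :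
    LinearIndependent ℂ fun i : Fin m => rootChain V φ z i := by
  have key : ∀ (k : ℕ) (c : ℕ → ℂ), ∑ j ∈ Finset.range k, c j • rootChain V φ z j = 0 →
      ∀ j < k, c j = 0 := by
    intro k
    induction k with
    | zero => intro c _ j hj; omega
    | succ k ih =>
      intro c hc
      rw [Finset.sum_range_succ'] at hc
      simp only [rootChain_succ, ← map_smul, ← map_sum] at hc
      set x := ∑ j ∈ Finset.range k, c (j + 1) • rootChain V φ z j
      have h1 : volterraInv V z (V x + c 0 • φ) = 0 := by
        have := congrArg (fun T : E →L[ℂ] E => T x) (hA.inv_comm z)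
        simp only [mul_apply_eq_comp] at this
        rw [map_add, this, ← hc]
        simp [rootChain]
      obtain ⟨h2, h3⟩ := hA.eq_zero _ _ (hA.inv_injective z _ h1)
      intro j hj
      cases j with
      | zero => exact h3
      | succ j => exact ih _ h2 j (by omega)
  rw [Fintype.linearIndependent_iff]
  intro g hg i
  have := key m (fun j => if h : j < m then g ⟨j, h⟩ else 0) (by
    rw [← Fin.sum_univ_eq_sum_range
      (fun j => (if h : j < m then g ⟨j, h⟩ else 0) • rootChain V φ z j)]
    simpa using hg) i i.2
  simpa using this

variable [CompleteSpace E]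

theorem differentiable_inv (hA : IsVolterraModel A V φ ν d) :
    Differentiable ℂ (volterraInv V) := fun z =>
  DifferentiableAt.inverse (by fun_prop) (hA.isUnit z)

theorem differentiable_charDet (hA : IsVolterraModel A V φ ν d) :
    Differentiable ℂ (charDet V φ ν d) := by
  have := hA.differentiable_inv
  unfold charDet
  fun_prop

theorem differentiable_charRem (hA : IsVolterraModel A V φ ν d) (z : ℂ) (n : ℕ) :
    Differentiable ℂ (charRem V φ ν d z n) := by
  have h := hA.differentiable_inv
  cases n with
  | zero => exact hA.differentiable_charDet
  | succ n =>
    have : charRem V φ ν d z (n + 1) = fun w =>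
      ν (volterraInv V z (((V * volterraInv V z) ^ n) (volterraInv V w φ))) := rfl
    rw [this]
    fun_prop

/-- Both sides equal the index `m` of the first nonzero Taylor coefficient: the order because the
remainder of index `m` is analytic and nonzero at `z`, the rank because the chain has exactly `m`
independent vectors. Finiteness of the order is what makes `m` exist. -/
theorem rank_opRootSpace (hA : IsVolterraModel A V φ ν d) (z : ℂ)
    (hz : analyticOrderAt (charDet V φ ν d) z ≠ ⊤) :
    Module.rank ℂ (opRootSpace A z) = (analyticOrderNatAt (charDet V φ ν d) z : Cardinal) := by
  classical
  have han : AnalyticAt ℂ (charDet V φ ν d) z := hA.differentiable_charDet.analyticAt z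
  have hex : ∃ m, charCoeff V φ ν d z m ≠ 0 := by
    by_contra! hcon
    apply hz
    rw [ENat.eq_top_iff_forall_ge]
    intro n
    rw [natCast_le_analyticOrderAt han]
    exact ⟨charRem V φ ν d z n, (hA.differentiable_charRem z n).analyticAt z,
      Filter.Eventually.of_forall fun w => by
        rw [smul_eq_mul, ← hA.charDet_eq_pow_mul z n fun j _ => hcon j]⟩
  obtain ⟨m, hm', hm⟩ : ∃ m, charCoeff V φ ν d z m ≠ 0 ∧ ∀ j < m, charCoeff V φ ν d z j = 0 :=
    ⟨Nat.find hex, Nat.find_spec hex, fun j hj => not_not.1 (Nat.find_min hex hj)⟩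
  have hord : analyticOrderAt (charDet V φ ν d) z = m := by
    rw [han.analyticOrderAt_eq_natCast]
    refine ⟨charRem V φ ν d z m, (hA.differentiable_charRem z m).analyticAt z, ?_,
      Filter.Eventually.of_forall fun w => by
        rw [smul_eq_mul, ← hA.charDet_eq_pow_mul z m hm]⟩
    rwa [hA.charRem_self]
  have hroot : opRootSpace A z = Submodule.span ℂ (range fun i : Fin m => rootChain V φ z i) := by
    apply le_antisymm
    · refine iSup_le fun n => ?_
      rw [hA.opKerPow_eq z m hm hm' n]
      apply Submodule.span_mono
      rintro _ ⟨i, rfl⟩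
      exact ⟨⟨i, lt_of_lt_of_le i.2 (min_le_right _ _)⟩, rfl⟩
    · have := hA.opKerPow_eq z m hm hm' m
      rw [min_self] at this
      rw [← this]
      exact le_iSup (opKerPow A z) m
  have hli := hA.linearIndependent_rootChain z m
  rw [hroot, rank_span hli, analyticOrderNatAt, hord]
  simpa using Cardinal.mk_range_eq_of_injective hli.injective

end IsVolterraModel

end BoundaryModel

/-! ### The argument principle and Rouché's theorem for entire functions -/

section Rouche

open Filter Topology Metric

/-- Each factor is split off by `dslope`, which keeps the quotient entire, so the factorization is
global and not merely a germ at `a`. -/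
theorem exists_eq_pow_mul_of_analyticOrderAt {a : ℂ} (n : ℕ) : ∀ {f : ℂ → ℂ},
    Differentiable ℂ f → analyticOrderAt f a = n →
    ∃ g : ℂ → ℂ, Differentiable ℂ g ∧ g a ≠ 0 ∧ ∀ w, f w = (w - a) ^ n * g w := by
  induction n with
  | zero =>
    intro f hf hn
    refine ⟨f, hf, ?_, by simp⟩
    exact (hf.analyticAt a).analyticOrderAt_eq_zero.1 (by simpa using hn)
  | succ n ih =>
    intro f hf hn
    have hfa : f a = 0 := by
      by_contra h
      rw [(hf.analyticAt a).analyticOrderAt_eq_zero.2 h] at hn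
      exact absurd hn (by norm_cast)
    have hd : Differentiable ℂ (dslope f a) := by
      rw [← differentiableOn_univ]
      exact (Complex.differentiableOn_dslope univ_mem).2 hf.differentiableOn
    have heq : f = fun w => (w - a) * dslope f a w := by
      funext w
      have := sub_smul_dslope f a w
      rw [hfa, sub_zero, smul_eq_mul] at this
      exact this.symm
    have hord : analyticOrderAt (dslope f a) a = n := by
      have h1 : analyticOrderAt ((fun w : ℂ => w - a) * dslope f a) a = (n + 1 : ℕ) := by
        rw [← hn]; congr 1; exact heq.symm
      rw [analyticOrderAt_mul (by fun_prop) (hd.analyticAt a),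
        analyticOrderAt_id_sub_const_self, add_comm, Nat.cast_add, Nat.cast_one] at h1
      exact (ENat.add_left_injective_of_ne_top (by simp : (1 : ℕ∞) ≠ ⊤)) h1
    obtain ⟨g, hg, hga, hfg⟩ := ih hd hord
    refine ⟨g, hg, hga, fun w => ?_⟩
    rw [heq]
    simp only [hfg w]
    ring

theorem exists_eq_prod_mul {f : ℂ → ℂ} (hf : Differentiable ℂ f)
    (hf0 : ∀ a, analyticOrderAt f a ≠ ⊤) (s : Finset ℂ) :
    ∃ g : ℂ → ℂ, Differentiable ℂ g ∧ (∀ a ∈ s, g a ≠ 0) ∧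
      ∀ w, f w = (∏ a ∈ s, (w - a) ^ analyticOrderNatAt f a) * g w := by
  classical
  induction s using Finset.induction_on with
  | empty => exact ⟨f, hf, by simp, by simp⟩
  | insert a s ha ih =>
    obtain ⟨g, hg, hgs, hfg⟩ := ih
    set P : ℂ → ℂ := fun w => ∏ b ∈ s, (w - b) ^ analyticOrderNatAt f b with hP
    have hPd : Differentiable ℂ P := by fun_prop
    have hPa : P a ≠ 0 := Finset.prod_ne_zero_iff.2 fun b hb =>
      pow_ne_zero _ (sub_ne_zero.2 fun h => ha (h ▸ hb))
    have hord : analyticOrderAt g a = analyticOrderNatAt f a := by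
      have h1 : f = P * g := funext hfg
      rw [Nat.cast_analyticOrderNatAt (hf0 a)]
      conv_rhs => rw [h1, analyticOrderAt_mul (hPd.analyticAt a) (hg.analyticAt a),
        (hPd.analyticAt a).analyticOrderAt_eq_zero.2 hPa, zero_add]
    obtain ⟨g', hg', hga', hgg'⟩ := exists_eq_pow_mul_of_analyticOrderAt _ hg hord
    refine ⟨g', hg', ?_, fun w => ?_⟩
    · intro b hb
      rcases Finset.mem_insert.1 hb with rfl | hb
      · exact hga'
      · intro h0
        apply hgs b hb
        rw [hgg', h0, mul_zero]
    · rw [Finset.prod_insert ha, hfg, hgg']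
      ring

theorem finite_zeros_closedBall {f : ℂ → ℂ} (hf : Differentiable ℂ f)
    (hf0 : ∀ a, analyticOrderAt f a ≠ ⊤) (R : ℝ) :
    {w | f w = 0 ∧ w ∈ closedBall (0 : ℂ) R}.Finite := by
  by_contra hinf
  obtain ⟨a, -, ha⟩ := Set.Infinite.exists_accPt_of_subset_isCompact hinf
    (isCompact_closedBall (0 : ℂ) R) (fun w hw => hw.2)
  apply hf0 a
  rw [analyticOrderAt_eq_top]
  rcases (hf.analyticAt a).eventually_eq_zero_or_eventually_ne_zero with h | h
  · exact h
  · exfalso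
    rw [accPt_iff_frequently_nhdsNE] at ha
    exact ha (h.mono fun w hw hw' => hw hw'.1)

/-- The zeros of an entire function in the disc `|w| < R`. -/
def zeroFinset {f : ℂ → ℂ} (hf : Differentiable ℂ f) (hf0 : ∀ a, analyticOrderAt f a ≠ ⊤)
    (R : ℝ) : Finset ℂ :=
  ((finite_zeros_closedBall hf hf0 R).subset
    (t := {w | f w = 0 ∧ w ∈ ball (0 : ℂ) R})
    (fun _ hw => ⟨hw.1, ball_subset_closedBall hw.2⟩)).toFinset

theorem mem_zeroFinset {f : ℂ → ℂ} (hf : Differentiable ℂ f)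
    (hf0 : ∀ a, analyticOrderAt f a ≠ ⊤) (R : ℝ) (w : ℂ) :
    w ∈ zeroFinset hf hf0 R ↔ f w = 0 ∧ w ∈ ball (0 : ℂ) R := by
  simp [zeroFinset, Set.Finite.mem_toFinset]

/-- The argument principle for entire functions. -/
theorem circleIntegral_logDeriv {f : ℂ → ℂ} (hf : Differentiable ℂ f)
    (hf0 : ∀ a, analyticOrderAt f a ≠ ⊤) {R : ℝ} (hR : 0 ≤ R)
    (hne : ∀ w ∈ sphere (0 : ℂ) R, f w ≠ 0) :
    ∮ w in C(0, R), logDeriv f w =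
      2 * π * Complex.I * ((∑ a ∈ zeroFinset hf hf0 R, analyticOrderNatAt f a : ℕ) : ℂ) := by
  set s := zeroFinset hf hf0 R with hs
  obtain ⟨g, hg, hgs, hfg⟩ := exists_eq_prod_mul hf hf0 s
  have hg0 : ∀ w ∈ closedBall (0 : ℂ) R, g w ≠ 0 := by
    intro w hw h0
    have hfw : f w = 0 := by rw [hfg, h0, mul_zero]
    have hwb : w ∈ ball (0 : ℂ) R := by
      rcases eq_or_lt_of_le (mem_closedBall.1 hw) with h | h
      · exact absurd hfw (hne w h)
      · exact h
    exact hgs w ((mem_zeroFinset hf hf0 R w).2 ⟨hfw, hwb⟩) h0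
  have hsne : ∀ w ∈ sphere (0 : ℂ) R, ∀ a ∈ s, w - a ≠ 0 := by
    intro w hw a ha h
    have := ((mem_zeroFinset hf hf0 R a).1 ha).2
    rw [← sub_eq_zero.1 h, mem_ball, mem_sphere.1 hw] at this
    exact lt_irrefl _ this
  have hlog : ∀ w ∈ sphere (0 : ℂ) R, logDeriv f w =
      (∑ a ∈ s, (analyticOrderNatAt f a : ℂ) • (w - a)⁻¹) + logDeriv g w := by
    intro w hw
    have h1 : f = fun w => (∏ a ∈ s, (w - a) ^ analyticOrderNatAt f a) * g w := funext hfg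
    have h2 := hsne w hw
    conv_lhs => rw [h1]
    rw [logDeriv_mul w (Finset.prod_ne_zero_iff.2 fun a ha => pow_ne_zero _ (h2 a ha))
      (hg0 w (sphere_subset_closedBall hw)) (by fun_prop) (hg w)]
    congr 1
    rw [logDeriv_prod (f := fun a w => (w - a) ^ analyticOrderNatAt f a)
      (fun a ha => pow_ne_zero _ (h2 a ha)) (fun a _ => by fun_prop)]
    refine Finset.sum_congr rfl fun a ha => ?_
    rw [logDeriv_fun_pow (by fun_prop), smul_eq_mul, logDeriv_apply]
    simp [div_eq_mul_inv]
  have hgI : ∮ w in C(0, R), logDeriv g w = 0 := by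
    have hdg : Differentiable ℂ (deriv g) := by
      intro w
      exact ((hg.analyticAt w).deriv).differentiableAt
    have hd : ∀ w ∈ closedBall (0 : ℂ) R, DifferentiableAt ℂ (logDeriv g) w := fun w hw =>
      (hdg w).div (hg w) (hg0 w hw)
    exact Complex.circleIntegral_eq_zero_of_differentiable_on_off_countable hR countable_empty
      (fun w hw => (hd w hw).continuousAt.continuousWithinAt)
      (fun w hw => hd w (ball_subset_closedBall hw.1))
  have hci : ∀ a ∈ s, CircleIntegrable (fun w => (analyticOrderNatAt f a : ℂ) • (w - a)⁻¹) 0 R := by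
    intro a ha
    apply ContinuousOn.circleIntegrable hR
    have h : ContinuousOn (fun w => (w - a)⁻¹) (sphere (0 : ℂ) R) :=
      ContinuousOn.inv₀ (by fun_prop) (fun w hw => hsne w hw a ha)
    fun_prop
  have hcg : CircleIntegrable (logDeriv g) 0 R := by
    apply ContinuousOn.circleIntegrable hR
    have : ContinuousOn (fun w => deriv g w / g w) (sphere (0 : ℂ) R) := by
      apply ContinuousOn.div _ hg.continuous.continuousOn
        (fun w hw => hg0 w (sphere_subset_closedBall hw))
      exact fun w _ => ((hg.analyticAt w).deriv).continuousAt.continuousWithinAt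
    exact this
  rw [circleIntegral.integral_congr hR hlog,
    circleIntegral.integral_add (CircleIntegrable.fun_sum s hci) hcg, hgI, add_zero,
    circleIntegral.integral_fun_sum hci]
  rw [Nat.cast_sum, Finset.mul_sum]
  refine Finset.sum_congr rfl fun a ha => ?_
  rw [circleIntegral.integral_smul, circleIntegral.integral_sub_inv_of_mem_ball
    ((mem_zeroFinset hf hf0 R a).1 ha).2, smul_eq_mul]
  ring

/-- Rouché's theorem for entire functions. -/
theorem sum_analyticOrderNatAt_eq_of_norm_sub_lt {f g : ℂ → ℂ} (hf : Differentiable ℂ f)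
    (hf0 : ∀ a, analyticOrderAt f a ≠ ⊤) (hg : Differentiable ℂ g)
    (hg0 : ∀ a, analyticOrderAt g a ≠ ⊤) {R : ℝ} (hR : 0 ≤ R)
    (hfg : ∀ w ∈ sphere (0 : ℂ) R, ‖g w - f w‖ < ‖f w‖) :
    ∑ a ∈ zeroFinset hf hf0 R, analyticOrderNatAt f a =
      ∑ a ∈ zeroFinset hg hg0 R, analyticOrderNatAt g a := by
  have hfne : ∀ w ∈ sphere (0 : ℂ) R, f w ≠ 0 := fun w hw h => by
    have := hfg w hw
    rw [h, norm_zero] at this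
    exact absurd this (not_lt.2 (norm_nonneg _))
  have hgne : ∀ w ∈ sphere (0 : ℂ) R, g w ≠ 0 := fun w hw h => by
    have := hfg w hw
    rw [h, zero_sub, norm_neg] at this
    exact lt_irrefl _ this
  have hint : ∀ {f : ℂ → ℂ}, Differentiable ℂ f → (∀ w ∈ sphere (0 : ℂ) R, f w ≠ 0) →
      CircleIntegrable (logDeriv f) 0 R := by
    intro f hf hfne
    apply ContinuousOn.circleIntegrable hR
    have : ContinuousOn (fun w => deriv f w / f w) (sphere (0 : ℂ) R) := by
      apply ContinuousOn.div _ hf.continuous.continuousOn hfne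
      exact fun w _ => ((hf.analyticAt w).deriv).continuousAt.continuousWithinAt
    exact this
  -- On the circle `g / f` stays in the disc of radius `1` about `1`, so `log (g / f)` is a
  -- single-valued primitive of the difference.
  have hzero : ∮ w in C(0, R), (logDeriv g w - logDeriv f w) = 0 := by
    apply circleIntegral.integral_eq_zero_of_hasDerivWithinAt
      (f := fun w => Complex.log (g w / f w)) hR
    intro w hw
    have hq : HasDerivAt (fun w => g w / f w)
        ((deriv g w * f w - g w * deriv f w) / f w ^ 2) w :=
      (hg w).hasDerivAt.div (hf w).hasDerivAt (hfne w hw)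
    have hslit : g w / f w ∈ Complex.slitPlane := by
      have h1 : ‖g w / f w - 1‖ < 1 := by
        rw [div_sub_one (hfne w hw), norm_div, div_lt_one (norm_pos_iff.2 (hfne w hw))]
        exact hfg w hw
      left
      have h2 := (Complex.abs_re_le_norm (g w / f w - 1)).trans_lt h1
      rw [Complex.sub_re, Complex.one_re] at h2
      linarith [(abs_lt.1 h2).1]
    have h3 := (hq.clog hslit).hasDerivWithinAt (s := sphere (0 : ℂ) R)
    convert h3 using 1
    rw [logDeriv_apply, logDeriv_apply]
    have := hfne w hw
    have := hgne w hw
    field_simp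
  rw [circleIntegral.integral_sub (hint hg hgne) (hint hf hfne),
    circleIntegral_logDeriv hf hf0 hR hfne, circleIntegral_logDeriv hg hg0 hR hgne,
    ← mul_sub, mul_eq_zero, sub_eq_zero] at hzero
  rcases hzero with h | h
  · exact absurd h Complex.two_pi_I_ne_zero
  · exact_mod_cast h.symm

end Rouche

/-! ### Listing an increasing family of multisets -/

section Enumeration

/-- From `N₀` on each multiset gains exactly one element, so it suffices to list `s N₀` in any order
and then append the gained elements. -/
theorem exists_enumeration_of_card_eq {α : Type*} [DecidableEq α] (s : ℕ → Multiset α)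
    (hs : Monotone s) (N₀ : ℕ) (hc : ∀ N, N₀ ≤ N → Multiset.card (s N) = N + 1) :
    ∃ lam : ℕ → α, ∀ N, N₀ ≤ N → s N = (Multiset.range (N + 1)).map lam := by
  have hstep : ∀ N, ∃ a, N₀ ≤ N → s (N + 1) = a ::ₘ s N := by
    intro N
    by_cases hN : N₀ ≤ N
    · have h1 : Multiset.card (s (N + 1) - s N) = 1 := by
        rw [Multiset.card_sub (hs (Nat.le_succ N)), hc _ hN, hc _ (by omega)]
        omega
      obtain ⟨a, ha⟩ := Multiset.card_eq_one.1 h1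
      refine ⟨a, fun _ => ?_⟩
      have h2 := Multiset.sub_add_cancel (hs (Nat.le_succ N))
      rw [ha, Multiset.singleton_add] at h2
      exact h2.symm
    · obtain ⟨a, -⟩ := Multiset.card_pos_iff_exists_mem.1
        (by rw [hc N₀ le_rfl]; omega : 0 < Multiset.card (s N₀))
      exact ⟨a, fun h => absurd h hN⟩
  choose a ha using hstep
  -- The element `a N` is gained in passing from `N` to `N + 1` and so carries the index `N + 1`,
  -- whence `k - 1`. The default `a 0` is never read: the list has length `N₀ + 1`.
  refine ⟨fun k => if h : k ≤ N₀ then (s N₀).toList.getD k (a 0) else a (k - 1), fun N hN => ?_⟩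
  induction N, hN using Nat.le_induction with
  | base =>
    have hl : (s N₀).toList.length = N₀ + 1 := by rw [Multiset.length_toList, hc _ le_rfl]
    conv_lhs => rw [← Multiset.coe_toList (s N₀)]
    rw [← Multiset.coe_range, Multiset.map_coe]
    congr 1
    apply List.ext_getElem
    · simp [hl]
    · intro i h1 h2
      have h3 : i ≤ N₀ := by omega
      simp [h3, List.getElem?_eq_getElem h1]
  | succ N hN ih =>
    rw [ha N hN, ih]
    conv_rhs => rw [Multiset.range_succ, Multiset.map_cons]
    congr 1
    rw [dif_neg (by omega)]
    rfl

end Enumeration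

/-! ### Lower bounds for the complex sine -/

section Sine

theorem norm_sin_sq (z : ℂ) : ‖Complex.sin z‖ ^ 2 = Real.sin z.re ^ 2 + Real.sinh z.im ^ 2 := by
  rw [← Complex.normSq_eq_norm_sq, Complex.sin_eq z, ← Complex.ofReal_sin, ← Complex.ofReal_cosh,
    ← Complex.ofReal_cos, ← Complex.ofReal_sinh, ← Complex.ofReal_mul, ← Complex.ofReal_mul,
    Complex.normSq_add_mul_I]
  have h1 := Real.sin_sq_add_cos_sq z.re
  have h2 := Real.cosh_sq z.im
  rw [mul_pow, mul_pow, h2]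
  linear_combination Real.sinh z.im ^ 2 * h1

/-- In `|sin (x + iy)|² = sin² x + sinh² y` the first term is bounded by Jordan's inequality and the
second by `sinh t ≥ t`. -/
theorem two_mul_norm_le_norm_sin (w : ℂ) (hw : |w.re| ≤ 1 / 2) :
    2 * ‖w‖ ≤ ‖Complex.sin (π * w)‖ := by
  apply le_of_sq_le_sq _ (norm_nonneg _)
  have hpi := Real.pi_pos
  have hre : ((π : ℂ) * w).re = π * w.re := by simp
  have him : ((π : ℂ) * w).im = π * w.im := by simp
  rw [norm_sin_sq, hre, him, mul_pow, ← Complex.normSq_eq_norm_sq, Complex.normSq_apply]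
  have h1 : (2 * w.re) ^ 2 ≤ Real.sin (π * w.re) ^ 2 := by
    rw [sq_le_sq, Real.abs_sin_eq_sin_abs_of_abs_le_pi]
    · have := Real.mul_le_sin (x := |π * w.re|) (abs_nonneg _) (by
        rw [abs_mul, abs_of_pos hpi]; nlinarith)
      refine le_trans (le_of_eq ?_) this
      rw [abs_mul, abs_mul, abs_of_pos hpi, abs_of_pos (by norm_num : (0 : ℝ) < 2)]
      field_simp
    · rw [abs_mul, abs_of_pos hpi]; nlinarith
  have h2 : (2 * w.im) ^ 2 ≤ Real.sinh (π * w.im) ^ 2 := by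
    rw [sq_le_sq, Real.abs_sinh]
    have : |π * w.im| ≤ Real.sinh |π * w.im| := Real.self_le_sinh_iff.2 (abs_nonneg _)
    refine le_trans ?_ this
    rw [abs_mul, abs_mul, abs_of_pos hpi, abs_of_pos (by norm_num : (0 : ℝ) < 2)]
    have := Real.pi_gt_three
    have := abs_nonneg w.im
    nlinarith
  nlinarith

theorem norm_sin_pi_mul_sub_int (z : ℂ) (n : ℤ) :
    ‖Complex.sin (π * (z - n))‖ = ‖Complex.sin (π * z)‖ := by
  have : (π : ℂ) * (z - n) = π * z - n * π := by ring
  rw [this, Complex.sin_sub, Complex.sin_int_mul_pi, mul_zero, sub_zero, norm_mul]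
  have h : Complex.cos (n * π) = ((Real.cos (n * π) : ℝ) : ℂ) := by push_cast; rfl
  rw [h, Real.cos_int_mul_pi, Complex.norm_real, norm_zpow, norm_neg, norm_one, one_zpow, mul_one]

/-- Lower bound of `|sin πz|` off the integers. -/
theorem min_mul_exp_le_norm_sin (z : ℂ) :
    min (1 / 4) (2 / 3 * ‖z - round z.re‖) * Real.exp (π * |z.im|) ≤ ‖Complex.sin (π * z)‖ := by
  have hpi := Real.pi_pos
  set t := π * |z.im| with ht
  have ht0 : 0 ≤ t := by positivity
  -- For `t ≤ 1` one has `exp t ≤ 3`, which turns the slope `2` of the bound near an integer into `2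
  -- / 3`. For `t > 1` the bound `|sin πz| ≥ sinh t ≥ exp t / 4` is enough.
  rcases le_or_gt t 1 with h | h
  · have h1 : 2 * ‖z - round z.re‖ ≤ ‖Complex.sin (π * z)‖ := by
      rw [← norm_sin_pi_mul_sub_int z (round z.re)]
      apply two_mul_norm_le_norm_sin
      rw [Complex.sub_re, Complex.intCast_re]
      exact abs_sub_round z.re
    have h2 : Real.exp t ≤ 3 := (Real.exp_le_exp.2 h).trans Real.exp_one_lt_three.le
    calc _ ≤ 2 / 3 * ‖z - round z.re‖ * 3 := by
          apply mul_le_mul (min_le_right _ _) h2 (Real.exp_pos _).le (by positivity)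
      _ = 2 * ‖z - round z.re‖ := by ring
      _ ≤ _ := h1
  · have h1 : Real.sinh t ≤ ‖Complex.sin (π * z)‖ := by
      apply le_of_sq_le_sq _ (norm_nonneg _)
      have him : ((π : ℂ) * z).im = π * z.im := by simp
      rw [norm_sin_sq, him]
      have : Real.sinh t ^ 2 = Real.sinh (π * z.im) ^ 2 := by
        rw [ht, ← sq_abs (Real.sinh (π * z.im)), Real.abs_sinh, abs_mul, abs_of_pos hpi]
      rw [this]
      nlinarith [sq_nonneg (Real.sin ((π : ℂ) * z).re)]
    have h2 : Real.exp t / 4 ≤ Real.sinh t := by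
      rw [Real.sinh_eq]
      have h3 : Real.exp (-t) ≤ Real.exp t / 2 := by
        have h4 : Real.exp (-t) ≤ 1 := Real.exp_le_one_iff.2 (by linarith)
        have h5 := Real.add_one_le_exp t
        linarith
      linarith
    calc _ ≤ 1 / 4 * Real.exp t := by
          apply mul_le_mul_of_nonneg_right (min_le_left _ _) (Real.exp_pos _).le
      _ = Real.exp t / 4 := by ring
      _ ≤ _ := h2.trans h1

end Sine

/-! ### Zeros of perturbations of `-ρ sin πρ` in the variable `ρ²` -/

section ZeroAsymptotics

open Filter Topology Metric

theorem analyticOrderAt_ne_top_of_differentiable {f : ℂ → ℂ} (hf : Differentiable ℂ f) {w : ℂ}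
    (hw : f w ≠ 0) (a : ℂ) : analyticOrderAt f a ≠ ⊤ := by
  intro h
  rw [analyticOrderAt_eq_top] at h
  have h1 : f = 0 := AnalyticOnNhd.eq_of_eventuallyEq (z₀ := a)
    (fun z _ => hf.analyticAt z) (fun z _ => analyticAt_const) h
  exact hw (by rw [h1]; rfl)

theorem exists_sq_eq_of_re_nonneg (z : ℂ) : ∃ w : ℂ, w ^ 2 = z ∧ 0 ≤ w.re := by
  obtain ⟨w, hw⟩ := IsAlgClosed.exists_pow_nat_eq z (n := 2) (by norm_num)
  rcases le_total 0 w.re with h | h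
  · exact ⟨w, hw, h⟩
  · exact ⟨-w, by rw [neg_sq, hw], by simpa using h⟩

theorem half_le_norm_sub_int {z : ℂ} {N : ℕ} (hz : ‖z‖ = N + 1 / 2) (n : ℤ) :
    1 / 2 ≤ ‖z - n‖ := by
  have h1 := abs_norm_sub_norm_le z (n : ℂ)
  rw [hz, Complex.norm_intCast, ← Int.cast_abs, Int.abs_eq_natAbs, Int.cast_natCast] at h1
  refine le_trans ?_ h1
  rcases le_or_gt n.natAbs N with h | h
  · have : (n.natAbs : ℝ) ≤ N := by exact_mod_cast h
    rw [abs_of_nonneg (by linarith)]; linarith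
  · have : (N : ℝ) + 1 ≤ n.natAbs := by exact_mod_cast h
    rw [abs_of_nonpos (by linarith)]; linarith

theorem quarter_mul_exp_le_norm_sin {z : ℂ} {N : ℕ} (hz : ‖z‖ = N + 1 / 2) :
    1 / 4 * Real.exp (π * |z.im|) ≤ ‖Complex.sin (π * z)‖ := by
  refine le_trans ?_ (min_mul_exp_le_norm_sin z)
  refine mul_le_mul_of_nonneg_right (le_min le_rfl ?_) (Real.exp_pos _).le
  have := half_le_norm_sub_int hz (round z.re)
  linarith

section Sine

variable {f : ℂ → ℂ} (hf : Differentiable ℂ f)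
  (hfs : ∀ ρ : ℂ, f (ρ ^ 2) = -ρ * Complex.sin (π * ρ))

include hfs in
theorem sineFun_eq_zero_iff (z : ℂ) : f z = 0 ↔ ∃ k : ℕ, z = (k : ℂ) ^ 2 := by
  constructor
  · intro h
    obtain ⟨ρ, rfl, hρ⟩ := exists_sq_eq_of_re_nonneg z
    rw [hfs, mul_eq_zero, neg_eq_zero] at h
    rcases h with h | h
    · exact ⟨0, by simp [h]⟩
    · obtain ⟨n, hn⟩ := Complex.sin_eq_zero_iff.1 h
      have : ρ = n := by
        have hpi : (π : ℂ) ≠ 0 := by exact_mod_cast Real.pi_pos.ne'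
        rw [mul_comm] at hn
        exact mul_right_cancel₀ hpi hn
      refine ⟨n.natAbs, ?_⟩
      rw [this]
      have h2 : ((n.natAbs : ℤ) : ℂ) ^ 2 = (n : ℂ) ^ 2 := by
        rw [← Int.cast_pow, Int.natAbs_sq, Int.cast_pow]
      rw [← h2, Int.cast_natCast]
  · rintro ⟨k, rfl⟩
    rw [hfs, mul_comm (π : ℂ), Complex.sin_nat_mul_pi, mul_zero]

-- For `k > 0` the chain rule in `ρ` gives `2k f'(k²) = -πk cos πk ≠ 0`. At `k = 0` the substitution
-- `ρ²` is degenerate, so difference quotients are compared instead: `f(ρ²) / ρ² = -sin(πρ) / ρ →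
-- -π`.
include hf hfs in
theorem sineFun_order (k : ℕ) : analyticOrderNatAt f ((k : ℂ) ^ 2) = 1 := by
  have hpi : (π : ℂ) ≠ 0 := by exact_mod_cast Real.pi_pos.ne'
  have hd : deriv f ((k : ℂ) ^ 2) ≠ 0 := by
    intro h
    have hfd : HasDerivAt f 0 ((k : ℂ) ^ 2) := by
      have := (hf ((k : ℂ) ^ 2)).hasDerivAt
      rwa [h] at this
    have hsin : ∀ a : ℂ, HasDerivAt (fun ρ : ℂ => Complex.sin (π * ρ))
        (Complex.cos (π * a) * π) a := by
      intro a
      have := ((hasDerivAt_id a).const_mul (π : ℂ)).csin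
      simpa using this
    rcases Nat.eq_zero_or_pos k with rfl | hk
    · have h1 : Tendsto (fun ρ : ℂ => ρ ^ 2) (𝓝[≠] 0) (𝓝[≠] 0) := by
        apply tendsto_nhdsWithin_of_tendsto_nhds_of_eventually_within
        · have : Tendsto (fun ρ : ℂ => ρ ^ 2) (𝓝 0) (𝓝 (0 ^ 2)) :=
            (continuous_pow 2).tendsto 0
          rw [zero_pow two_ne_zero] at this
          exact this.mono_left nhdsWithin_le_nhds
        · filter_upwards [self_mem_nhdsWithin] with ρ hρ
          exact pow_ne_zero 2 hρ
      simp only [Nat.cast_zero, ne_eq, OfNat.ofNat_ne_zero, not_false_eq_true, zero_pow] at hfd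
      have h2 := hfd.tendsto_slope.comp h1
      have h3 := (hsin 0).tendsto_slope.neg
      have h4 : slope f 0 ∘ (fun ρ : ℂ => ρ ^ 2) =ᶠ[𝓝[≠] 0]
          fun ρ => -slope (fun ρ : ℂ => Complex.sin (π * ρ)) 0 ρ := by
        filter_upwards [self_mem_nhdsWithin] with ρ hρ
        have hρ' : ρ ≠ 0 := hρ
        have hf0 : f 0 = 0 := by
          have := hfs 0
          simpa using this
        simp only [Function.comp_apply, slope_def_field, hfs, hf0, mul_zero, Complex.sin_zero,
          sub_zero]
        field_simp
      have h5 := tendsto_nhds_unique (h2.congr' h4) h3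
      simp at h5
    · have h1 : HasDerivAt (fun ρ : ℂ => f (ρ ^ 2)) (0 * (2 * (k : ℂ))) k := by
        have h2 := hasDerivAt_pow 2 (k : ℂ)
        have h3 := HasDerivAt.comp (k : ℂ) hfd h2
        rw [zero_mul] at h3 ⊢
        exact h3
      have h2 : HasDerivAt (fun ρ : ℂ => -ρ * Complex.sin (π * ρ))
          (-1 * Complex.sin (π * k) + -k * (Complex.cos (π * k) * π)) k :=
        (hasDerivAt_id (k : ℂ)).neg.mul (hsin k)
      have h3 : (fun ρ : ℂ => f (ρ ^ 2)) = fun ρ : ℂ => -ρ * Complex.sin (π * ρ) := funext hfs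
      rw [h3] at h1
      have h4 := h1.unique h2
      have h5 : Complex.sin (π * k) = 0 := by rw [mul_comm, Complex.sin_nat_mul_pi]
      have h6 := Complex.sin_sq_add_cos_sq (π * k)
      have h7 : Complex.cos (π * k) ≠ 0 := by
        intro h0
        rw [h5, h0] at h6
        norm_num at h6
      rw [h5] at h4
      have hk' : (k : ℂ) ≠ 0 := by exact_mod_cast hk.ne'
      have : (k : ℂ) * (Complex.cos (π * k) * π) = 0 := by linear_combination h4
      exact mul_ne_zero hk' (mul_ne_zero h7 hpi) this
  have := (hf.analyticAt ((k : ℂ) ^ 2)).analyticOrderAt_eq_one_of_zero_deriv_ne_zero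
    ((sineFun_eq_zero_iff hfs _).2 ⟨k, rfl⟩) hd
  rw [analyticOrderNatAt, this]; rfl

include hfs in
theorem sum_order_sineFun (hf0 : ∀ a, analyticOrderAt f a ≠ ⊤) (N : ℕ) :
    ∑ a ∈ zeroFinset hf hf0 (((N : ℝ) + 1 / 2) ^ 2), analyticOrderNatAt f a = N + 1 := by
  classical
  have h1 : zeroFinset hf hf0 (((N : ℝ) + 1 / 2) ^ 2) =
      (Finset.range (N + 1)).image fun k : ℕ => (k : ℂ) ^ 2 := by
    ext z
    rw [mem_zeroFinset, sineFun_eq_zero_iff hfs, Finset.mem_image]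
    have key : ∀ k : ℕ, ((k : ℂ) ^ 2 ∈ ball (0 : ℂ) (((N : ℝ) + 1 / 2) ^ 2) ↔ k < N + 1) := by
      intro k
      rw [mem_ball_zero_iff, norm_pow, Complex.norm_natCast,
        sq_lt_sq₀ (by positivity) (by positivity)]
      constructor
      · intro h
        by_contra! h'
        have : (N : ℝ) + 1 ≤ k := by exact_mod_cast h'
        linarith
      · intro h
        have : (k : ℝ) ≤ N := by exact_mod_cast Nat.lt_succ_iff.1 h
        linarith
    constructor
    · rintro ⟨⟨k, rfl⟩, hk⟩
      exact ⟨k, Finset.mem_range.2 ((key k).1 hk), rfl⟩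
    · rintro ⟨k, hk, rfl⟩
      exact ⟨⟨k, rfl⟩, (key k).2 (Finset.mem_range.1 hk)⟩
  rw [h1, Finset.sum_image]
  · rw [Finset.sum_congr rfl fun k _ => sineFun_order hf hfs k]
    simp
  · intro a _ b _ hab
    have : ((a ^ 2 : ℕ) : ℂ) = ((b ^ 2 : ℕ) : ℂ) := by push_cast; exact hab
    exact Nat.pow_left_injective two_ne_zero (Nat.cast_injective this)

end Sine

/-- The zeros of an entire function in the disc `|w| < R`, with multiplicity. -/
def zeroMultiset {f : ℂ → ℂ} (hf : Differentiable ℂ f) (hf0 : ∀ a, analyticOrderAt f a ≠ ⊤)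
    (R : ℝ) : Multiset ℂ :=
  ∑ a ∈ zeroFinset hf hf0 R, Multiset.replicate (analyticOrderNatAt f a) a

section ZeroMultiset

variable {f : ℂ → ℂ} (hf : Differentiable ℂ f) (hf0 : ∀ a, analyticOrderAt f a ≠ ⊤)

theorem card_zeroMultiset (R : ℝ) : Multiset.card (zeroMultiset hf hf0 R) =
    ∑ a ∈ zeroFinset hf hf0 R, analyticOrderNatAt f a := by
  simp [zeroMultiset]

include hf hf0 in
theorem analyticOrderNatAt_eq_zero_iff (z : ℂ) : analyticOrderNatAt f z = 0 ↔ f z ≠ 0 := by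
  rw [← (hf.analyticAt z).analyticOrderAt_eq_zero, analyticOrderNatAt, ENat.toNat_eq_zero]
  simp [hf0 z]

theorem count_zeroMultiset [DecidableEq ℂ] (R : ℝ) (z : ℂ) :
    (zeroMultiset hf hf0 R).count z = if ‖z‖ < R then analyticOrderNatAt f z else 0 := by
  rw [zeroMultiset, Multiset.count_sum']
  simp only [Multiset.count_replicate]
  simp only [Finset.sum_ite_eq', mem_zeroFinset, mem_ball_zero_iff]
  have := analyticOrderNatAt_eq_zero_iff hf hf0 z
  by_cases h1 : f z = 0 <;> by_cases h2 : ‖z‖ < R <;> simp_all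

theorem zeroMultiset_mono {R R' : ℝ} (h : R ≤ R') :
    zeroMultiset hf hf0 R ≤ zeroMultiset hf hf0 R' := by
  classical
  rw [Multiset.le_iff_count]
  intro z
  rw [count_zeroMultiset, count_zeroMultiset]
  split_ifs with h1 h2
  · exact le_rfl
  · exact absurd (h1.trans_le h) h2
  · exact Nat.zero_le _
  · exact le_rfl

end ZeroMultiset

/-- An enumeration of all zeros of an entire function which exhausts the discs
`|w| < (N + 1/2)²` for all large `N`. -/
theorem mk_fiber_eq_order {f : ℂ → ℂ} (hf : Differentiable ℂ f)
    (hf0 : ∀ a, analyticOrderAt f a ≠ ⊤) {lam : ℕ → ℂ} {N₀ : ℕ}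
    (hlam : ∀ N, N₀ ≤ N → zeroMultiset hf hf0 (((N : ℝ) + 1 / 2) ^ 2) =
      (Multiset.range (N + 1)).map lam) (z : ℂ) :
    Cardinal.mk {k : ℕ // lam k = z} = (analyticOrderNatAt f z : Cardinal) := by
  classical
  obtain ⟨N₁, hN₁⟩ : ∃ N₁ : ℕ, ‖z‖ < ((N₁ : ℝ) + 1 / 2) ^ 2 := by
    obtain ⟨n, hn⟩ := exists_nat_gt ‖z‖
    refine ⟨n, hn.trans_le ?_⟩
    have : (0 : ℝ) ≤ n := n.cast_nonneg
    nlinarith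
  have hcard : ∀ N, max N₀ N₁ ≤ N →
      ((Finset.range (N + 1)).filter fun k => lam k = z).card = analyticOrderNatAt f z := by
    intro N hN
    have h1 := congrArg (Multiset.count z) (hlam N (le_trans (le_max_left _ _) hN))
    have h2 : ‖z‖ < ((N : ℝ) + 1 / 2) ^ 2 := by
      refine hN₁.trans_le ?_
      have : (N₁ : ℝ) ≤ N := by exact_mod_cast le_trans (le_max_right _ _) hN
      gcongr
    rw [count_zeroMultiset, if_pos h2, Multiset.count_map] at h1
    rw [h1, Finset.card_def, Finset.filter_val, Finset.range_val]
    simp only [eq_comm]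
  set N := max N₀ N₁
  -- Once the disc contains `z`, enlarging it does not change the number of indices with value `z`,
  -- so no index beyond `N` can have that value.
  have hset : ∀ k, lam k = z ↔ k ∈ (Finset.range (N + 1)).filter fun k => lam k = z := by
    intro k
    refine ⟨fun hk => ?_, fun hk => (Finset.mem_filter.1 hk).2⟩
    have hsub : (Finset.range (N + 1)).filter (fun k => lam k = z) ⊆
        (Finset.range (max N k + 1)).filter (fun k => lam k = z) :=
      Finset.filter_subset_filter _ (Finset.range_mono (by have := le_max_left N k; omega))
    have heq := Finset.eq_of_subset_of_card_le hsub
      (by rw [hcard N le_rfl, hcard _ (le_max_left _ _)])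
    rw [heq, Finset.mem_filter, Finset.mem_range]
    exact ⟨by have := le_max_right N k; omega, hk⟩
  rw [← hcard N le_rfl, ← Cardinal.mk_coe_finset]
  exact Cardinal.mk_congr (Equiv.subtypeEquivRight hset)

/-- Rouché's theorem on `|ρ| = N + 1/2` yields `N + 1` zeros for each large `N`, so the root `ρ k`
of the `k`-th zero lies between two consecutive circles. There `sin πρ k = -G(ρ k)` is small
relative to `exp(π|Im ρ k|)`, which forces `ρ k` close to an integer, necessarily `k`. The linear
lower bound for the sine then gives `|ρ k - k| ≤ |G(ρ k)|`, and `hb` finishes. -/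
theorem exists_enumeration_zeros {f f₀ G : ℂ → ℂ} (hf : Differentiable ℂ f)
    (hf₀ : Differentiable ℂ f₀) (hfs : ∀ ρ : ℂ, f₀ (ρ ^ 2) = -ρ * Complex.sin (π * ρ))
    (hG : ∀ ρ : ℂ, ρ ≠ 0 → f (ρ ^ 2) = -ρ * (Complex.sin (π * ρ) + G ρ))
    (ha : ∀ ε : ℝ, 0 < ε → ∃ R : ℝ, ∀ ρ : ℂ, R ≤ ‖ρ‖ → ‖G ρ‖ ≤ ε * Real.exp (π * |ρ.im|))
    (hb : ∀ ζ : ℕ → ℂ, (∀ k, ‖ζ k‖ ≤ 1) → Summable fun k : ℕ => ‖G (k + ζ k)‖ ^ 2) :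
    (∀ a, analyticOrderAt f a ≠ ⊤) ∧ ∃ lam κ : ℕ → ℂ, (∀ k, f (lam k) = 0) ∧
      (∀ z, Cardinal.mk {k : ℕ // lam k = z} = (analyticOrderNatAt f z : Cardinal)) ∧
      (∀ k : ℕ, lam k = ((k : ℂ) + κ k) ^ 2) ∧ Memℓp κ 2 := by
  classical
  -- The value `1 / 16` lies below the bound `1 / 4` for the sine on the circles, and divided by the
  -- slope `2 / 3` it confines a zero to distance `3 / 32` from an integer.
  obtain ⟨R, hR⟩ := ha (1 / 16) (by norm_num)
  obtain ⟨N₀, hN₀⟩ := exists_nat_gt R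
  -- comparison on the circles
  have hcirc : ∀ N, N₀ ≤ N → ∀ w ∈ sphere (0 : ℂ) (((N : ℝ) + 1 / 2) ^ 2),
      ‖f w - f₀ w‖ < ‖f₀ w‖ := by
    intro N hN w hw
    obtain ⟨ρ, rfl, -⟩ := exists_sq_eq_of_re_nonneg w
    rw [mem_sphere_zero_iff_norm, norm_pow,
      sq_eq_sq₀ (norm_nonneg _) (by positivity)] at hw
    have hNN : (N₀ : ℝ) ≤ N := by exact_mod_cast hN
    have hNpos : (0 : ℝ) ≤ N := N.cast_nonneg
    have hρ0 : ρ ≠ 0 := by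
      intro h; rw [h, norm_zero] at hw; linarith
    have hρ : 0 < ‖ρ‖ := norm_pos_iff.2 hρ0
    have h1 : f (ρ ^ 2) - f₀ (ρ ^ 2) = -ρ * G ρ := by rw [hG ρ hρ0, hfs]; ring
    rw [h1, hfs, norm_mul, norm_mul, norm_neg]
    apply mul_lt_mul_of_pos_left _ hρ
    have h2 := hR ρ (by rw [hw]; linarith)
    have h3 := quarter_mul_exp_le_norm_sin hw
    have h4 := Real.exp_pos (π * |ρ.im|)
    linarith
  have hord₀ : ∀ a, analyticOrderAt f₀ a ≠ ⊤ := by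
    apply analyticOrderAt_ne_top_of_differentiable hf₀ (w := (1 / 2) ^ 2)
    rw [hfs]
    have : (π : ℂ) * (1 / 2) = (π : ℂ) / 2 := by ring
    rw [this, Complex.sin_pi_div_two]
    norm_num
  have hord : ∀ a, analyticOrderAt f a ≠ ⊤ := by
    apply analyticOrderAt_ne_top_of_differentiable hf (w := ((((N₀ : ℝ) + 1 / 2) ^ 2 : ℝ) : ℂ))
    intro h
    have := hcirc N₀ le_rfl ((((N₀ : ℝ) + 1 / 2) ^ 2 : ℝ) : ℂ) (by
      rw [mem_sphere_zero_iff_norm, Complex.norm_real, Real.norm_of_nonneg (by positivity)])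
    rw [h, zero_sub, norm_neg] at this
    exact lt_irrefl _ this
  refine ⟨hord, ?_⟩
  have hcard : ∀ N, N₀ ≤ N →
      Multiset.card (zeroMultiset hf hord (((N : ℝ) + 1 / 2) ^ 2)) = N + 1 := by
    intro N hN
    rw [card_zeroMultiset, ← sum_analyticOrderNatAt_eq_of_norm_sub_lt hf₀ hord₀ hf hord
      (by positivity) (hcirc N hN), sum_order_sineFun hf₀ hfs]
  obtain ⟨lam, hlam⟩ := exists_enumeration_of_card_eq
    (fun N : ℕ => zeroMultiset hf hord (((N : ℝ) + 1 / 2) ^ 2))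
    (fun a b hab => zeroMultiset_mono hf hord (by
      have : (a : ℝ) ≤ b := by exact_mod_cast hab
      gcongr)) N₀ hcard
  have hmk := mk_fiber_eq_order hf hord hlam
  have hzero : ∀ k, f (lam k) = 0 := by
    intro k
    by_contra h
    have h1 := hmk (lam k)
    rw [(analyticOrderNatAt_eq_zero_iff hf hord (lam k)).2 h, Nat.cast_zero,
      Cardinal.mk_eq_zero_iff] at h1
    exact h1.false ⟨k, rfl⟩
  choose ρ hρ hρre using fun k => exists_sq_eq_of_re_nonneg (lam k)
  refine ⟨lam, fun k => ρ k - k, hzero, hmk, fun k => by rw [add_sub_cancel, hρ], ?_⟩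
  -- the `k`-th zero lies between consecutive circles
  have hann : ∀ k, N₀ + 1 ≤ k → (k : ℝ) - 1 / 2 ≤ ‖ρ k‖ ∧ ‖ρ k‖ < k + 1 / 2 := by
    intro k hk
    obtain ⟨N, rfl⟩ : ∃ N, k = N + 1 := ⟨k - 1, by omega⟩
    have h1 := hlam N (by omega)
    have h2 := hlam (N + 1) (by omega)
    rw [Multiset.range_succ, Multiset.map_cons, ← h1] at h2
    have h3 := congrArg (Multiset.count (lam (N + 1))) h2
    simp only [count_zeroMultiset, Multiset.count_cons_self] at h3
    have hnorm : ‖lam (N + 1)‖ = ‖ρ (N + 1)‖ ^ 2 := by rw [← hρ, norm_pow]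
    have hN : (0 : ℝ) ≤ N := N.cast_nonneg
    rw [hnorm] at h3
    constructor
    · by_contra! hcon
      push_cast at hcon
      have h4 : ‖ρ (N + 1)‖ ^ 2 < ((N : ℝ) + 1 / 2) ^ 2 := by
        rw [sq_lt_sq₀ (norm_nonneg _) (by positivity)]; linarith
      have h5 : ‖ρ (N + 1)‖ ^ 2 < (((N + 1 : ℕ) : ℝ) + 1 / 2) ^ 2 := by
        rw [sq_lt_sq₀ (norm_nonneg _) (by positivity)]; push_cast; linarith
      rw [if_pos h4, if_pos h5] at h3
      omega
    · by_contra! hcon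
      have h5 : ¬ ‖ρ (N + 1)‖ ^ 2 < (((N + 1 : ℕ) : ℝ) + 1 / 2) ^ 2 := by
        rw [sq_lt_sq₀ (norm_nonneg _) (by positivity)]; push_cast at hcon ⊢; linarith
      rw [if_neg h5] at h3
      omega
  have hkey : ∀ k, N₀ + 1 ≤ k → ‖ρ k - k‖ ≤ 3 / 32 ∧ ‖ρ k - k‖ ≤ ‖G (ρ k)‖ := by
    intro k hk
    obtain ⟨h1, h2⟩ := hann k hk
    have hkR : (N₀ : ℝ) + 1 ≤ k := by exact_mod_cast hk
    have hN₀' : (0 : ℝ) ≤ N₀ := N₀.cast_nonneg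
    have hρ0 : ρ k ≠ 0 := by
      intro h; rw [h, norm_zero] at h1; linarith
    have hsin : Complex.sin (π * ρ k) = -G (ρ k) := by
      have h3 := hzero k
      rw [← hρ, hG _ hρ0, mul_eq_zero, neg_eq_zero] at h3
      exact eq_neg_of_add_eq_zero_left (h3.resolve_left hρ0)
    have h4 := hR (ρ k) (by linarith)
    rw [← norm_neg, ← hsin] at h4
    have h5 : min (1 / 4) (2 / 3 * ‖ρ k - round (ρ k).re‖) ≤ 1 / 16 :=
      le_of_mul_le_mul_right ((min_mul_exp_le_norm_sin (ρ k)).trans h4) (Real.exp_pos _)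
    have h6 : ‖ρ k - round (ρ k).re‖ ≤ 3 / 32 := by
      rcases min_le_iff.1 h5 with h | h
      · norm_num at h
      · linarith
    -- The integer is nonnegative because the square root was chosen with nonnegative real part.
    -- Hence it differs from `|ρ k|` by at most `3 / 32`, while `|ρ k|` lies within `1 / 2` of `k`.
    have hround : round (ρ k).re = k := by
      have h7 := abs_norm_sub_norm_le (ρ k) (round (ρ k).re : ℂ)
      have hnn : 0 ≤ round (ρ k).re := by
        rw [round_eq]
        exact Int.floor_nonneg.2 (by have := hρre k; linarith)
      have hnn' : (0 : ℝ) ≤ (round (ρ k).re : ℤ) := by exact_mod_cast hnn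
      rw [Complex.norm_intCast, abs_of_nonneg hnn'] at h7
      have h8 := abs_le.1 (h7.trans h6)
      have h9 : ((round (ρ k).re : ℤ) : ℝ) < ((k : ℤ) : ℝ) + 1 := by push_cast; linarith
      have h10 : ((k : ℤ) : ℝ) < ((round (ρ k).re : ℤ) : ℝ) + 1 := by push_cast; linarith
      have h11 : round (ρ k).re < (k : ℤ) + 1 := by exact_mod_cast h9
      have h12 : (k : ℤ) < round (ρ k).re + 1 := by exact_mod_cast h10
      omega
    have h13 : ((round (ρ k).re : ℤ) : ℂ) = (k : ℂ) := by rw [hround]; simp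
    rw [h13] at h6
    refine ⟨h6, ?_⟩
    have h14 := two_mul_norm_le_norm_sin (ρ k - round (ρ k).re) (by
      rw [Complex.sub_re, Complex.intCast_re]; exact abs_sub_round _)
    rw [norm_sin_pi_mul_sub_int, hsin, norm_neg, h13] at h14
    linarith [norm_nonneg (ρ k - k)]
  rw [memℓp_gen_iff (by norm_num)]
  -- The finitely many uncontrolled indices are set to `0` so as to respect `‖ζ k‖ ≤ 1`.
  have hsum := hb (fun k => if N₀ + 1 ≤ k then ρ k - k else 0) (by
    intro k
    split_ifs with h
    · exact (hkey k h).1.trans (by norm_num)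
    · simp)
  rw [← summable_nat_add_iff (N₀ + 1)] at hsum ⊢
  refine Summable.of_nonneg_of_le (fun _ => by positivity) (fun k => ?_) hsum
  simp only [le_add_iff_nonneg_left, zero_le, if_true, add_sub_cancel]
  have := (hkey (k + (N₀ + 1)) (by omega)).2
  simp only [ENNReal.toReal_ofNat, Real.rpow_ofNat]
  gcongr

end ZeroAsymptotics

/-! ### Convolution algebra on `(0, π)` -/

section Convolution

/-- Square integrability on `(0, π)`. -/
abbrev InL2 {F : Type*} [NormedAddCommGroup F] (f : ℝ → F) : Prop :=
  MemLp f 2 (volume.restrict (Ioo (0 : ℝ) π))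

/-- The convolution `∫₀ˣ f(x - t) g(t) dt` of functions on the half-line. -/
def cv (f g : ℝ → ℂ) (x : ℝ) : ℂ := ∫ t in (0 : ℝ)..x, f (x - t) * g t

theorem cv_comm (f g : ℝ → ℂ) (x : ℝ) : cv f g x = cv g f x := by
  have h := intervalIntegral.integral_comp_sub_left (a := 0) (b := x)
    (fun t => f (x - t) * g t) x
  simp only [sub_sub_cancel, sub_self, sub_zero] at h
  rw [cv, ← h, cv]
  simp only [mul_comm]

theorem cv_zero (f g : ℝ → ℂ) : cv f g 0 = 0 := intervalIntegral.integral_same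

theorem cv_one_left (f : ℝ → ℂ) (x : ℝ) : cv (fun _ => 1) f x = ∫ t in (0 : ℝ)..x, f t := by
  simp [cv]

theorem InL2.intervalIntegrable {F : Type*} [NormedAddCommGroup F] {f : ℝ → F} (hf : InL2 f)
    {x : ℝ} (hx : x ∈ Icc (0 : ℝ) π) : IntervalIntegrable f volume 0 x := by
  rw [intervalIntegrable_iff_integrableOn_Ioo_of_le hx.1]
  exact IntegrableOn.mono_set (hf.integrable (by norm_num)) (Ioo_subset_Ioo_right hx.2)

theorem ContinuousOn.inL2 {F : Type*} [NormedAddCommGroup F] {f : ℝ → F}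
    (hf : ContinuousOn f (Icc 0 π)) : InL2 f := by
  obtain ⟨C, hC⟩ := isCompact_Icc.exists_bound_of_continuousOn hf
  apply MemLp.of_bound
    ((hf.mono Ioo_subset_Icc_self).aestronglyMeasurable measurableSet_Ioo) C
  filter_upwards [ae_restrict_mem measurableSet_Ioo] with x hx
  exact hC x (Ioo_subset_Icc_self hx)

theorem ContinuousOn.norm_le_of_Icc {F : Type*} [NormedAddCommGroup F] {f : ℝ → F}
    (hf : ContinuousOn f (Icc 0 π)) : ∃ C, 0 ≤ C ∧ ∀ x ∈ Icc (0 : ℝ) π, ‖f x‖ ≤ C := by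
  obtain ⟨C, hC⟩ := isCompact_Icc.exists_bound_of_continuousOn hf
  exact ⟨max C 0, le_max_right _ _, fun x hx => (hC x hx).trans (le_max_left _ _)⟩

theorem InL2.comp_sub_left {F : Type*} [NormedAddCommGroup F] {f : ℝ → F} (hf : InL2 f)
    {x : ℝ} (hx : x ∈ Icc (0 : ℝ) π) :
    MemLp (fun t => f (x - t)) 2 (volume.restrict (Ioo (0 : ℝ) x)) := by
  have h1 : MemLp f 2 (volume.restrict (Ioo (0 : ℝ) x)) :=
    hf.mono_measure (Measure.restrict_mono (Ioo_subset_Ioo_right hx.2) le_rfl)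
  have h2 := (Measure.measurePreserving_sub_left (volume : Measure ℝ) x).restrict_preimage
    (measurableSet_Ioo (a := (0 : ℝ)) (b := x))
  have h3 : (fun t => x - t) ⁻¹' Ioo 0 x = Ioo 0 x := by simp
  rw [h3] at h2
  exact h1.comp_measurePreserving h2

theorem aestronglyMeasurable_comp_sub_left {F : Type*} [NormedAddCommGroup F] {f : ℝ → F}
    (hf : AEStronglyMeasurable f (volume.restrict (Ioo (0 : ℝ) π)))
    {x : ℝ} (hx : x ≤ π) :
    AEStronglyMeasurable (fun t => f (x - t)) (volume.restrict (Ioo (0 : ℝ) x)) := by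
  have h1 : AEStronglyMeasurable f (volume.restrict (Ioo (0 : ℝ) x)) :=
    hf.mono_measure (Measure.restrict_mono (Ioo_subset_Ioo_right hx) le_rfl)
  have h2 := (Measure.measurePreserving_sub_left (volume : Measure ℝ) x).restrict_preimage
    (measurableSet_Ioo (a := (0 : ℝ)) (b := x))
  have h3 : (fun t => x - t) ⁻¹' Ioo 0 x = Ioo 0 x := by simp
  rw [h3] at h2
  exact h1.comp_measurePreserving h2

theorem InL2.intervalIntegrable_conv {F : Type*} [NormedRing F] {f g : ℝ → F} (hf : InL2 f)
    (hg : InL2 g) {x : ℝ} (hx : x ∈ Icc (0 : ℝ) π) :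
    IntervalIntegrable (fun t => f (x - t) * g t) volume 0 x := by
  rw [intervalIntegrable_iff_integrableOn_Ioo_of_le hx.1]
  exact (hf.comp_sub_left hx).integrable_mul
    (hg.mono_measure (Measure.restrict_mono (Ioo_subset_Ioo_right hx.2) le_rfl))

theorem cv_congr_right {f g g' : ℝ → ℂ} (h : g =ᵐ[volume.restrict (Ioo (0 : ℝ) π)] g')
    {x : ℝ} (hx : x ∈ Icc (0 : ℝ) π) : cv f g x = cv f g' x := by
  rw [cv, cv, intervalIntegral.integral_of_le hx.1, intervalIntegral.integral_of_le hx.1,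
    integral_Ioc_eq_integral_Ioo, integral_Ioc_eq_integral_Ioo]
  apply integral_congr_ae
  have h' : g =ᵐ[volume.restrict (Ioo (0 : ℝ) x)] g' :=
    ae_mono (Measure.restrict_mono (Ioo_subset_Ioo_right hx.2) le_rfl) h
  filter_upwards [h'] with t ht
  rw [ht]

theorem cv_congr_left {f f' g : ℝ → ℂ} (h : f =ᵐ[volume.restrict (Ioo (0 : ℝ) π)] f')
    {x : ℝ} (hx : x ∈ Icc (0 : ℝ) π) : cv f g x = cv f' g x := by
  rw [cv_comm, cv_congr_right h hx, cv_comm]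

theorem ae_eq_of_eqOn_Icc {F : Type*} {f g : ℝ → F} (h : EqOn f g (Icc 0 π)) :
    f =ᵐ[volume.restrict (Ioo (0 : ℝ) π)] g := by
  filter_upwards [ae_restrict_mem measurableSet_Ioo] with x hx
  exact h (Ioo_subset_Icc_self hx)

theorem cv_smul_right (c : ℂ) (f g : ℝ → ℂ) (x : ℝ) :
    cv f (fun t => c * g t) x = c * cv f g x := by
  rw [cv, cv, ← intervalIntegral.integral_const_mul]
  congr 1; funext t; ring

theorem cv_smul_left (c : ℂ) (f g : ℝ → ℂ) (x : ℝ) :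
    cv (fun t => c * f t) g x = c * cv f g x := by
  rw [cv_comm, cv_smul_right, cv_comm]

theorem cv_add_right {f g g' : ℝ → ℂ} {x : ℝ}
    (h : IntervalIntegrable (fun t => f (x - t) * g t) volume 0 x)
    (h' : IntervalIntegrable (fun t => f (x - t) * g' t) volume 0 x) :
    cv f (fun t => g t + g' t) x = cv f g x + cv f g' x := by
  rw [cv, cv, cv, ← intervalIntegral.integral_add h h']
  simp only [mul_add]

theorem InL2.cv_add_right {f g g' : ℝ → ℂ} (hf : InL2 f) (hg : InL2 g) (hg' : InL2 g') {x : ℝ}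
    (hx : x ∈ Icc (0 : ℝ) π) : cv f (fun t => g t + g' t) x = cv f g x + cv f g' x :=
  _root_.cv_add_right (hf.intervalIntegrable_conv hg hx) (hf.intervalIntegrable_conv hg' hx)

theorem InL2.cv_sub_right {f g g' : ℝ → ℂ} (hf : InL2 f) (hg : InL2 g) (hg' : InL2 g') {x : ℝ}
    (hx : x ∈ Icc (0 : ℝ) π) : cv f (fun t => g t - g' t) x = cv f g x - cv f g' x := by
  rw [cv, cv, cv, ← intervalIntegral.integral_sub (hf.intervalIntegrable_conv hg hx)
    (hf.intervalIntegrable_conv hg' hx)]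
  simp only [mul_sub]

theorem InL2.cv_sub_left {f g g' : ℝ → ℂ} (hf : InL2 f) (hg : InL2 g) (hg' : InL2 g') {x : ℝ}
    (hx : x ∈ Icc (0 : ℝ) π) : cv (fun t => g t - g' t) f x = cv g f x - cv g' f x := by
  rw [cv_comm, hf.cv_sub_right hg hg' hx, cv_comm f, cv_comm f]

theorem InL2.cv_add_left {f g g' : ℝ → ℂ} (hf : InL2 f) (hg : InL2 g) (hg' : InL2 g') {x : ℝ}
    (hx : x ∈ Icc (0 : ℝ) π) : cv (fun t => g t + g' t) f x = cv g f x + cv g' f x := by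
  rw [cv_comm, hf.cv_add_right hg hg' hx, cv_comm f, cv_comm f]

/-- Split `g = g(0) + G`. The part `G`, extended continuously by `0` to the negative axis, allows
the upper limit to be frozen at `X`, so dominated convergence applies; the constant contributes a
primitive of `f`. -/
theorem continuousOn_cv {f g : ℝ → ℂ} {X : ℝ} (hX : 0 ≤ X)
    (hf : IntervalIntegrable f volume 0 X) (hg : ContinuousOn g (Icc 0 X)) :
    ContinuousOn (cv g f) (Icc 0 X) := by
  set G : ℝ → ℂ := fun u => IccExtend hX ((Icc 0 X).domRestrict g) u - g 0 with hG
  have hGc : Continuous G :=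
    (continuous_IccExtend_iff.2 (continuousOn_iff_continuous_domRestrict.1 hg)).sub continuous_const
  have hG0 : ∀ u ≤ 0, G u = 0 := by
    intro u hu
    simp [hG, IccExtend_of_le_left hX _ hu, domRestrict_apply]
  have hGX : ∀ u ∈ Icc 0 X, G u = g u - g 0 := by
    intro u hu
    simp [hG, IccExtend_of_mem hX _ hu, domRestrict_apply]
  obtain ⟨C, hC⟩ := isCompact_Icc.exists_bound_of_continuousOn hg
  have hbound : ∀ u, ‖G u‖ ≤ C + C := by
    intro u
    refine (norm_sub_le _ _).trans (add_le_add ?_ (hC 0 (left_mem_Icc.2 hX)))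
    exact hC _ (projIcc 0 X hX u).2
  have h1 : Continuous fun x => ∫ t in (0 : ℝ)..X, G (x - t) * f t := by
    apply intervalIntegral.continuous_of_dominated_interval (bound := fun t => (C + C) * ‖f t‖)
    · intro x
      have := hf.1.aestronglyMeasurable
      rw [uIoc_of_le hX]
      exact (by fun_prop : Continuous fun t => G (x - t)).aestronglyMeasurable.mul this
    · intro x
      filter_upwards with t _
      rw [norm_mul]
      exact mul_le_mul_of_nonneg_right (hbound _) (norm_nonneg _)
    · exact hf.norm.const_mul _
    · filter_upwards with t _
      fun_prop
  have h2 : ContinuousOn (fun x => ∫ t in (0 : ℝ)..x, f t) (Icc 0 X) := by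
    have := intervalIntegral.continuousOn_primitive_interval' hf left_mem_uIcc
    rwa [uIcc_of_le hX] at this
  refine ((h1.continuousOn).add (h2.const_mul (g 0))).congr fun x hx => ?_
  have hfx : IntervalIntegrable f volume 0 x := hf.mono_set (by
    rw [uIcc_of_le hX, uIcc_of_le hx.1]; exact Icc_subset_Icc_right hx.2)
  have hfx' : IntervalIntegrable f volume x X := hf.mono_set (by
    rw [uIcc_of_le hX, uIcc_of_le hx.2]; exact Icc_subset_Icc_left hx.1)
  have hGi : ∀ a b, IntervalIntegrable f volume a b →
      IntervalIntegrable (fun t => G (x - t) * f t) volume a b := fun a b h =>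
    h.continuousOn_mul (by fun_prop)
  have h3 : ∫ t in x..X, G (x - t) * f t = 0 := by
    rw [intervalIntegral.integral_congr (g := fun _ => 0)]
    · simp
    · intro t ht
      rw [uIcc_of_le hx.2] at ht
      simp [hG0 (x - t) (by linarith [ht.1])]
  have h4 : ∫ t in (0 : ℝ)..x, G (x - t) * f t = cv g f x - g 0 * ∫ t in (0 : ℝ)..x, f t := by
    rw [← intervalIntegral.integral_const_mul, cv, ← intervalIntegral.integral_sub]
    · apply intervalIntegral.integral_congr
      intro t ht
      rw [uIcc_of_le hx.1] at ht
      simp only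
      rw [hGX (x - t) ⟨by linarith [ht.2], by linarith [ht.1, hx.2]⟩]
      ring
    · apply hfx.continuousOn_mul
      apply hg.comp (by fun_prop)
      intro t ht
      rw [uIcc_of_le hx.1] at ht
      exact ⟨by linarith [ht.2], by linarith [ht.1, hx.2]⟩
    · exact hfx.const_mul _
  change cv g f x = (∫ t in (0 : ℝ)..X, G (x - t) * f t) + g 0 * ∫ t in (0 : ℝ)..x, f t
  rw [← intervalIntegral.integral_add_adjacent_intervals (hGi 0 x hfx) (hGi x X hfx'), h3, h4]
  ring

theorem InL2.continuousOn_cv {f g : ℝ → ℂ} (hf : InL2 f) (hg : ContinuousOn g (Icc 0 π)) :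
    ContinuousOn (cv g f) (Icc 0 π) :=
  _root_.continuousOn_cv Real.pi_pos.le
    (hf.intervalIntegrable (right_mem_Icc.2 Real.pi_pos.le)) hg

/-- Associativity of the convolution, when `|f| * |g|` has a majorant `b` such that `b * |h|`
exists. -/
theorem cv_assoc {f g h : ℝ → ℂ} {b : ℝ → ℝ}
    (hf : AEStronglyMeasurable f (volume.restrict (Ioo (0 : ℝ) π)))
    (hg : AEStronglyMeasurable g (volume.restrict (Ioo (0 : ℝ) π)))
    (hh : AEStronglyMeasurable h (volume.restrict (Ioo (0 : ℝ) π)))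
    {x : ℝ} (hx : x ∈ Icc (0 : ℝ) π)
    (hfg : ∀ s ∈ Ioo (0 : ℝ) x, IntervalIntegrable (fun t => f (s - t) * g t) volume 0 s)
    (hb : ∀ s ∈ Ioo (0 : ℝ) x, ∫ t in (0 : ℝ)..s, ‖f (s - t) * g t‖ ≤ b s)
    (hbh : IntervalIntegrable (fun s => b (x - s) * ‖h s‖) volume 0 x) :
    cv (cv f g) h x = cv f (cv g h) x := by
  set μ := (volume : Measure ℝ).restrict (Ioo 0 x) with hμ
  -- Extending `g` by zero replaces the triangle `s < t` by a square, on which Fubini's theorem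
  -- applies.
  set g' := (Ioo (0 : ℝ) π).indicator g with hg'
  set F : ℝ → ℝ → ℂ := fun s t => f (x - t) * g' (t - s) * h s with hF
  have hle : μ ≤ (volume : Measure ℝ).restrict (Ioo 0 π) :=
    Measure.restrict_mono (Ioo_subset_Ioo_right hx.2) le_rfl
  have hg'm : AEStronglyMeasurable g' volume :=
    (aestronglyMeasurable_indicator_iff measurableSet_Ioo).2 hg
  -- inner integral in `t`
  have hFm : AEStronglyMeasurable (Function.uncurry F) (μ.prod μ) := by
    have h1 : AEStronglyMeasurable (fun p : ℝ × ℝ => f (x - p.2)) (μ.prod μ) :=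
      (aestronglyMeasurable_comp_sub_left hf hx.2).comp_snd
    have h2 : AEStronglyMeasurable (fun p : ℝ × ℝ => g' (p.2 - p.1)) (μ.prod μ) := by
      have h3 := hg'm.comp_quasiMeasurePreserving
        (quasiMeasurePreserving_sub (volume : Measure ℝ) (volume : Measure ℝ))
      have h4 : AEStronglyMeasurable (fun p : ℝ × ℝ => g' (p.2 - p.1))
        ((volume : Measure ℝ).prod volume) := h3.prod_swap
      rw [hμ, Measure.prod_restrict]
      exact h4.mono_measure Measure.restrict_le_self
    have h3 : AEStronglyMeasurable (fun p : ℝ × ℝ => h p.1) (μ.prod μ) :=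
      (hh.mono_measure hle).comp_fst
    exact (h1.mul h2).mul h3
  have hinner : ∀ s ∈ Ioo (0 : ℝ) x,
      Integrable (F s) μ ∧ ∫ t, F s t ∂μ = cv f g (x - s) * h s ∧
        ∫ t, ‖F s t‖ ∂μ = (∫ t in (0 : ℝ)..(x - s), ‖f (x - s - t) * g t‖) * ‖h s‖ := by
    intro s hs
    have hs' : x - s ∈ Ioo 0 x := ⟨by linarith [hs.2], by linarith [hs.1]⟩
    -- vanishing below `s`
    have hzero : ∀ t ∈ Ioo (0 : ℝ) x \ Ioo s x, F s t = 0 := by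
      intro t ht
      have : t ≤ s := by
        by_contra! hcon
        exact ht.2 ⟨hcon, ht.1.2⟩
      simp only [hF, hg']
      rw [indicator_of_notMem (fun hmem => by linarith [hmem.1])]
      ring
    have hEq : ∀ t ∈ Ioo s x, F s t = f (x - s - (t - s)) * g (t - s) * h s := by
      intro t ht
      simp only [hF, hg']
      rw [indicator_of_mem (show t - s ∈ Ioo 0 π from
        ⟨by linarith [ht.1], by linarith [ht.2, hx.2, hs.1]⟩)]
      congr 3
      ring
    have hsub : Ioo s x ⊆ Ioo 0 x := Ioo_subset_Ioo_left hs.1.le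
    have hii : IntervalIntegrable (fun t => f (x - s - (t - s)) * g (t - s)) volume s x := by
      have := (hfg (x - s) hs').comp_sub_right s
      simpa using this
    refine ⟨?_, ?_, ?_⟩
    · have h1 : IntegrableOn (F s) (Ioo s x) := by
        have h2 := hii.mul_const (h s)
        rw [intervalIntegrable_iff_integrableOn_Ioo_of_le hs.2.le] at h2
        exact h2.congr_fun (fun t ht => (hEq t ht).symm) measurableSet_Ioo
      exact h1.of_forall_sdiff_eq_zero measurableSet_Ioo hzero
    · rw [hμ, setIntegral_eq_of_subset_of_forall_sdiff_eq_zero measurableSet_Ioo hsub hzero,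
        setIntegral_congr_fun measurableSet_Ioo hEq, ← integral_Ioc_eq_integral_Ioo,
        ← intervalIntegral.integral_of_le hs.2.le, intervalIntegral.integral_mul_const,
        intervalIntegral.integral_comp_sub_right (fun t => f (x - s - t) * g t) s, sub_self]
      rfl
    · rw [hμ, setIntegral_eq_of_subset_of_forall_sdiff_eq_zero measurableSet_Ioo hsub
          (fun t ht => by rw [hzero t ht, norm_zero]),
        setIntegral_congr_fun (g := fun t => ‖f (x - s - (t - s)) * g (t - s)‖ * ‖h s‖)
          measurableSet_Ioo (fun t ht => by simp only [hEq t ht, norm_mul]),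
        ← integral_Ioc_eq_integral_Ioo,
        ← intervalIntegral.integral_of_le hs.2.le, intervalIntegral.integral_mul_const,
        intervalIntegral.integral_comp_sub_right (fun t => ‖f (x - s - t) * g t‖) s, sub_self]
  have hFint : Integrable (Function.uncurry F) (μ.prod μ) := by
    rw [integrable_prod_iff hFm]
    constructor
    · filter_upwards [ae_restrict_mem measurableSet_Ioo] with s hs
      exact (hinner s hs).1
    · rw [intervalIntegrable_iff_integrableOn_Ioo_of_le hx.1] at hbh
      refine Integrable.mono' hbh hFm.norm.integral_prod_right' ?_
      filter_upwards [ae_restrict_mem measurableSet_Ioo] with s hs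
      simp only [Function.uncurry_apply_pair]
      rw [(hinner s hs).2.2, Real.norm_of_nonneg]
      · exact mul_le_mul_of_nonneg_right
          (hb (x - s) ⟨by linarith [hs.2], by linarith [hs.1]⟩) (norm_nonneg _)
      · refine mul_nonneg (intervalIntegral.integral_nonneg (by linarith [hs.2]) ?_)
          (norm_nonneg _)
        exact fun t _ => norm_nonneg _
  have hswap := integral_integral_swap hFint
  have hL : cv (cv f g) h x = ∫ s, ∫ t, F s t ∂μ ∂μ := by
    rw [cv, intervalIntegral.integral_of_le hx.1, integral_Ioc_eq_integral_Ioo]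
    exact setIntegral_congr_fun measurableSet_Ioo fun s hs => (hinner s hs).2.1.symm
  have hR : cv f (cv g h) x = ∫ t, ∫ s, F s t ∂μ ∂μ := by
    rw [cv, intervalIntegral.integral_of_le hx.1, integral_Ioc_eq_integral_Ioo]
    refine setIntegral_congr_fun measurableSet_Ioo fun t ht => ?_
    have hzero : ∀ s ∈ Ioo (0 : ℝ) x \ Ioo 0 t, F s t = 0 := by
      intro s hs
      have : t ≤ s := by
        by_contra! hcon
        exact hs.2 ⟨hs.1.1, hcon⟩
      simp only [hF, hg']
      rw [indicator_of_notMem (fun hmem => by linarith [hmem.1])]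
      ring
    have hEq : ∀ s ∈ Ioo 0 t, F s t = f (x - t) * (g (t - s) * h s) := by
      intro s hs
      simp only [hF, hg']
      rw [indicator_of_mem (show t - s ∈ Ioo 0 π from
        ⟨by linarith [hs.2], by linarith [ht.2, hx.2, hs.1]⟩)]
      ring
    rw [hμ, setIntegral_eq_of_subset_of_forall_sdiff_eq_zero measurableSet_Ioo
        (Ioo_subset_Ioo_right ht.2.le) hzero,
      setIntegral_congr_fun measurableSet_Ioo hEq, ← integral_Ioc_eq_integral_Ioo,
      ← intervalIntegral.integral_of_le ht.1.le, intervalIntegral.integral_const_mul]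
    rfl
  rw [hL, hR, hswap]

theorem InL2.integral_norm_conv_le {f g : ℝ → ℂ} (hf : InL2 f) (hg : InL2 g) :
    ∃ C, ∀ x ∈ Icc (0 : ℝ) π, ∫ t in (0 : ℝ)..x, ‖f (x - t) * g t‖ ≤ C := by
  have hf2 : IntegrableOn (fun t => ‖f t‖ ^ 2) (Ioo 0 π) := hf.integrable_norm_pow (by norm_num)
  have hg2 : IntegrableOn (fun t => ‖g t‖ ^ 2) (Ioo 0 π) := hg.integrable_norm_pow (by norm_num)
  refine ⟨(∫ t in Ioo 0 π, ‖f t‖ ^ 2) + ∫ t in Ioo 0 π, ‖g t‖ ^ 2, fun x hx => ?_⟩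
  have hi : ∀ {u : ℝ → ℝ}, IntegrableOn u (Ioo 0 π) → IntervalIntegrable u volume 0 x := by
    intro u hu
    rw [intervalIntegrable_iff_integrableOn_Ioo_of_le hx.1]
    exact hu.mono_set (Ioo_subset_Ioo_right hx.2)
  have hle : ∀ {u : ℝ → ℝ}, IntegrableOn u (Ioo 0 π) → (∀ t, 0 ≤ u t) →
      ∫ t in (0 : ℝ)..x, u t ≤ ∫ t in Ioo 0 π, u t := by
    intro u hu hu0
    rw [intervalIntegral.integral_of_le hx.1, integral_Ioc_eq_integral_Ioo]
    exact setIntegral_mono_set hu (ae_of_all _ hu0)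
      (Ioo_subset_Ioo_right hx.2).eventuallyLE
  have h1 : ∫ t in (0 : ℝ)..x, ‖f (x - t)‖ ^ 2 = ∫ t in (0 : ℝ)..x, ‖f t‖ ^ 2 := by
    simpa using intervalIntegral.integral_comp_sub_left (a := 0) (b := x) (fun t => ‖f t‖ ^ 2) x
  have h2 : IntervalIntegrable (fun t => ‖f (x - t)‖ ^ 2) volume 0 x := by
    simpa using ((hi hf2).comp_sub_left x).symm
  calc ∫ t in (0 : ℝ)..x, ‖f (x - t) * g t‖
      ≤ ∫ t in (0 : ℝ)..x, (‖f (x - t)‖ ^ 2 + ‖g t‖ ^ 2) := by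
        apply intervalIntegral.integral_mono_on hx.1
          (hf.intervalIntegrable_conv hg hx).norm (h2.add (hi hg2))
        intro t _
        rw [norm_mul]
        nlinarith [sq_nonneg (‖f (x - t)‖ - ‖g t‖), sq_nonneg ‖f (x - t)‖, sq_nonneg ‖g t‖]
    _ = (∫ t in (0 : ℝ)..x, ‖f t‖ ^ 2) + ∫ t in (0 : ℝ)..x, ‖g t‖ ^ 2 := by
        rw [intervalIntegral.integral_add h2 (hi hg2), h1]
    _ ≤ _ := add_le_add (hle hf2 fun t => by positivity) (hle hg2 fun t => by positivity)

theorem InL2.cv_assoc {f g h : ℝ → ℂ} (hf : InL2 f) (hg : InL2 g) (hh : InL2 h) {x : ℝ}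
    (hx : x ∈ Icc (0 : ℝ) π) : cv (cv f g) h x = cv f (cv g h) x := by
  obtain ⟨C, hC⟩ := hf.integral_norm_conv_le hg
  have hsub : ∀ s ∈ Ioo 0 x, s ∈ Icc (0 : ℝ) π := fun s hs => ⟨hs.1.le, hs.2.le.trans hx.2⟩
  exact _root_.cv_assoc (b := fun _ => C) hf.1 hg.1 hh.1 hx
    (fun s hs => hf.intervalIntegrable_conv hg (hsub s hs)) (fun s hs => hC s (hsub s hs))
    ((hh.intervalIntegrable hx).norm.const_mul C)

/-- The Cauchy–Schwarz inequality. -/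
theorem sq_integral_mul_le {α : Type*} [MeasurableSpace α] {μ : Measure α} {f g : α → ℝ}
    (hf : MemLp f 2 μ) (hg : MemLp g 2 μ) :
    (∫ x, f x * g x ∂μ) ^ 2 ≤ (∫ x, f x ^ 2 ∂μ) * ∫ x, g x ^ 2 ∂μ := by
  have hf2 := hf.integrable_sq
  have hg2 := hg.integrable_sq
  have hfg : Integrable (fun x => f x * g x) μ := hf.integrable_mul hg
  have h : ∀ c : ℝ, 0 ≤ (∫ x, g x ^ 2 ∂μ) * (c * c) + (-2 * ∫ x, f x * g x ∂μ) * c +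
      ∫ x, f x ^ 2 ∂μ := by
    intro c
    have h1 : 0 ≤ ∫ x, (f x - c * g x) ^ 2 ∂μ := integral_nonneg fun x => sq_nonneg _
    have h2 : ∫ x, (f x - c * g x) ^ 2 ∂μ =
        ∫ x, (f x ^ 2 - 2 * c * (f x * g x) + c * c * g x ^ 2) ∂μ := by
      congr 1; funext x; ring
    have h3 : Integrable (fun x => f x ^ 2 - 2 * c * (f x * g x)) μ := hf2.sub (hfg.const_mul _)
    rw [h2, integral_add h3 (hg2.const_mul _),
      integral_sub hf2 (hfg.const_mul _), integral_const_mul, integral_const_mul] at h1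
    linarith
  have := discrim_le_zero h
  rw [discrim] at this
  linarith

end Convolution

/-! ### Exponential weights and Volterra equations of the second kind -/

section Volterra

/-- Cauchy–Schwarz against the exponential. The gain `1 / (2σ)` makes a weighted square integrable
kernel small, both for the contraction argument and for the estimates off the real axis. -/
theorem sq_integral_norm_mul_exp_le {F : Type*} [NormedAddCommGroup F] {k : ℝ → F} {x : ℝ}
    (hk : MemLp k 2 (volume.restrict (Ioo (0 : ℝ) x))) {σ : ℝ} (hσ : 0 < σ) :
    (∫ t in Ioo 0 x, ‖k t‖ * Real.exp (-σ * t)) ^ 2 ≤ (∫ t in Ioo 0 x, ‖k t‖ ^ 2) / (2 * σ) := by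
  have hE : MemLp (fun t : ℝ => Real.exp (-σ * t)) 2 (volume.restrict (Ioo (0 : ℝ) x)) := by
    apply MemLp.of_bound (by fun_prop : Continuous _).aestronglyMeasurable 1
    filter_upwards [ae_restrict_mem measurableSet_Ioo] with t ht
    rw [Real.norm_of_nonneg (Real.exp_pos _).le, Real.exp_le_one_iff]
    nlinarith [ht.1]
  refine (sq_integral_mul_le hk.norm hE).trans ?_
  rw [div_eq_mul_inv]
  apply mul_le_mul_of_nonneg_left _ (integral_nonneg fun t => by positivity)
  have h1 : ∀ t : ℝ, Real.exp (-σ * t) ^ 2 = Real.exp (-(2 * σ) * t) := by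
    intro t
    rw [← Real.exp_nat_mul]
    congr 1
    push_cast; ring
  have h2 : ∫ t in Ioo 0 x, Real.exp (-(2 * σ) * t) ≤
      ∫ t in Ioi (0 : ℝ), Real.exp (-(2 * σ) * t) := by
    apply setIntegral_mono_set (integrableOn_exp_mul_Ioi (by linarith) 0)
      (ae_of_all _ fun t => (Real.exp_pos _).le)
    exact (Ioo_subset_Ioi_self).eventuallyLE
  simp only [h1]
  refine h2.trans (le_of_eq ?_)
  rw [integral_exp_mul_Ioi (by linarith)]
  simp [neg_div_neg_eq]

theorem exists_integral_norm_mul_exp_le {F : Type*} [NormedAddCommGroup F] {k : ℝ → F}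
    (hk : InL2 k) {ε : ℝ} (hε : 0 < ε) :
    ∃ σ : ℝ, 0 < σ ∧ ∫ t in Ioo 0 π, ‖k t‖ * Real.exp (-σ * t) ≤ ε := by
  set A := ∫ t in Ioo 0 π, ‖k t‖ ^ 2 with hA
  have hA0 : 0 ≤ A := integral_nonneg fun t => by positivity
  -- With this `σ` the bound `A / (2σ)` equals `ε² A / (A + 1)`; the summand `1` keeps `σ` positive
  -- when `A = 0`.
  refine ⟨(A + 1) / (2 * ε ^ 2), by positivity, ?_⟩
  apply le_of_sq_le_sq _ hε.le
  refine (sq_integral_norm_mul_exp_le hk (by positivity)).trans ?_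
  rw [← hA]
  rw [div_le_iff₀ (by positivity)]
  field_simp
  linarith

theorem InL2.setIntegral_norm_sq_comp_sub_left_le {F : Type*} [NormedAddCommGroup F] {k : ℝ → F}
    (hk : InL2 k) {x : ℝ} (hx : x ∈ Icc (0 : ℝ) π) :
    ∫ t in Ioo 0 x, ‖k (x - t)‖ ^ 2 ≤ ∫ t in Ioo 0 π, ‖k t‖ ^ 2 := by
  have h1 : ∫ t in Ioo 0 x, ‖k (x - t)‖ ^ 2 = ∫ t in Ioo 0 x, ‖k t‖ ^ 2 := by
    rw [← integral_Ioc_eq_integral_Ioo, ← integral_Ioc_eq_integral_Ioo,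
      ← intervalIntegral.integral_of_le hx.1, ← intervalIntegral.integral_of_le hx.1]
    simpa using intervalIntegral.integral_comp_sub_left (a := 0) (b := x) (fun t => ‖k t‖ ^ 2) x
  rw [h1]
  exact setIntegral_mono_set (hk.integrable_norm_pow (by norm_num))
    (ae_of_all _ fun t => by positivity) (Ioo_subset_Ioo_right hx.2).eventuallyLE

theorem exists_integral_norm_comp_sub_left_mul_exp_le {F : Type*} [NormedAddCommGroup F]
    {k : ℝ → F} (hk : InL2 k) {ε : ℝ} (hε : 0 < ε) :
    ∃ σ : ℝ, 0 < σ ∧ ∀ x ∈ Icc (0 : ℝ) π,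
      ∫ t in Ioo 0 x, ‖k (x - t)‖ * Real.exp (-σ * t) ≤ ε := by
  set A := ∫ t in Ioo 0 π, ‖k t‖ ^ 2 with hA
  have hA0 : 0 ≤ A := integral_nonneg fun t => by positivity
  refine ⟨(A + 1) / (2 * ε ^ 2), by positivity, fun x hx => ?_⟩
  apply le_of_sq_le_sq _ hε.le
  refine (sq_integral_norm_mul_exp_le (hk.comp_sub_left hx) (by positivity)).trans ?_
  rw [div_le_iff₀ (by positivity)]
  refine (hk.setIntegral_norm_sq_comp_sub_left_le hx).trans ?_
  rw [← hA]
  field_simp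
  linarith

/-- Volterra convolution equations of the second kind are solvable. -/
theorem exists_volterra_solution {k g : ℝ → ℂ} (hk : InL2 k) (hg : ContinuousOn g (Icc 0 π)) :
    ∃ y : ℝ → ℂ, ContinuousOn y (Icc 0 π) ∧ ∀ x ∈ Icc 0 π, y x = g x + cv k y x := by
  -- Conjugation by `exp(-σx)` turns `k(t)` into `exp(-σt) k(t)`, of `L₁` norm at most `1 / 2`; the
  -- equation becomes a contraction in the sup norm on the whole interval.
  obtain ⟨σ, -, hσ⟩ := exists_integral_norm_mul_exp_le hk (ε := 1 / 2) (by norm_num)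
  have hpi := Real.pi_pos.le
  set e : ℝ → ℂ := fun t => ((Real.exp (-σ * t) : ℝ) : ℂ) with he
  have hec : Continuous e := by fun_prop
  set kσ : ℝ → ℂ := fun t => e t * k t with hkσ
  have hnorm : ∀ t, ‖kσ t‖ = ‖k t‖ * Real.exp (-σ * t) := by
    intro t
    rw [hkσ, norm_mul, he, Complex.norm_real, Real.norm_of_nonneg (Real.exp_pos _).le, mul_comm]
  obtain ⟨Ce, hCe0, hCe⟩ := ContinuousOn.norm_le_of_Icc (hec.continuousOn)
  have hkσ2 : InL2 kσ := by
    refine hk.of_le_mul (c := Ce) ?_ ?_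
    · exact hec.aestronglyMeasurable.mul hk.1
    · filter_upwards [ae_restrict_mem measurableSet_Ioo] with t ht
      rw [hkσ, norm_mul]
      exact mul_le_mul_of_nonneg_right (hCe t (Ioo_subset_Icc_self ht)) (norm_nonneg _)
  let ext : C(Icc 0 π, ℂ) → ℝ → ℂ := fun w => IccExtend hpi w
  have hext : ∀ w : C(Icc 0 π, ℂ), Continuous (ext w) := fun w =>
    w.continuous.Icc_extend'
  have hextL : ∀ w : C(Icc 0 π, ℂ), InL2 (ext w) := fun w => (hext w).continuousOn.inL2
  let Φ : C(Icc 0 π, ℂ) → C(Icc 0 π, ℂ) := fun w =>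
    ⟨(Icc 0 π).domRestrict fun x => e x * g x + cv (ext w) kσ x, by
      rw [← continuousOn_iff_continuous_domRestrict]
      exact (hec.continuousOn.mul hg).add (hkσ2.continuousOn_cv (hext w).continuousOn)⟩
  have hΦ : ContractingWith (1 / 2) Φ := by
    refine ⟨by rw [← NNReal.coe_lt_coe]; norm_num, LipschitzWith.of_dist_le_mul fun w v => ?_⟩
    rw [ContinuousMap.dist_le (by positivity)]
    rintro ⟨x, hx⟩
    have h1 : dist (Φ w ⟨x, hx⟩) (Φ v ⟨x, hx⟩) =
        ‖cv kσ (fun t => ext w t - ext v t) x‖ := by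
      rw [dist_eq_norm, hkσ2.cv_sub_right (hextL w) (hextL v) hx, cv_comm kσ, cv_comm kσ]
      change ‖(e x * g x + cv (ext w) kσ x) - (e x * g x + cv (ext v) kσ x)‖ = _
      congr 1; ring
    rw [h1, cv_comm, cv]
    have h2 : ∀ t ∈ Ioc 0 x, ‖(ext w (x - t) - ext v (x - t)) * kσ t‖ ≤ dist w v * ‖kσ t‖ := by
      intro t _
      rw [norm_mul]
      refine mul_le_mul_of_nonneg_right ?_ (norm_nonneg _)
      rw [← dist_eq_norm]
      exact ContinuousMap.dist_apply_le_dist _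
    refine (intervalIntegral.norm_integral_le_of_norm_le hx.1 (ae_of_all _ h2)
      ((hkσ2.intervalIntegrable hx).norm.const_mul _)).trans ?_
    rw [intervalIntegral.integral_const_mul, mul_comm]
    refine mul_le_mul_of_nonneg_right ?_ dist_nonneg
    rw [intervalIntegral.integral_of_le hx.1, integral_Ioc_eq_integral_Ioo]
    refine (setIntegral_mono_set (hkσ2.integrable (by norm_num)).norm
      (ae_of_all _ fun t => norm_nonneg _) (Ioo_subset_Ioo_right hx.2).eventuallyLE).trans ?_
    simp only [hnorm]
    refine hσ.trans (by norm_num)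
  obtain ⟨w, hw⟩ : ∃ w, Φ w = w := ⟨_, hΦ.fixedPoint_isFixedPt⟩
  have he0 : ∀ t, e t ≠ 0 := fun t => by
    simp only [he]
    exact_mod_cast (Real.exp_pos _).ne'
  refine ⟨fun x => (e x)⁻¹ * ext w x,
    ((hec.inv₀ he0).mul (hext w)).continuousOn, fun x hx => ?_⟩
  have h1 : ext w x = e x * g x + cv (ext w) kσ x := by
    have h2 := congrArg (fun v : C(Icc 0 π, ℂ) => v ⟨x, hx⟩) hw
    change e x * g x + cv (ext w) kσ x = w ⟨x, hx⟩ at h2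
    rw [h2]
    exact IccExtend_of_mem hpi _ hx
  have h3 : cv k (fun x => (e x)⁻¹ * ext w x) x = (e x)⁻¹ * cv (ext w) kσ x := by
    rw [cv_comm (ext w), cv, cv, ← intervalIntegral.integral_const_mul]
    congr 1; funext t
    have h4 : e (x - t) * e t = e x := by
      simp only [he]
      rw [← Complex.ofReal_mul, ← Real.exp_add]
      congr 2; ring
    have := he0 x
    have := he0 t
    simp only [hkσ]
    field_simp
    rw [← h4]
    ring
  rw [h3]
  change (e x)⁻¹ * ext w x = _
  nth_rw 1 [h1]
  have := he0 x
  field_simp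

end Volterra

/-! ### Hardy's inequality for the singular kernel -/

section Kernel

variable {M : ℝ → ℂ}

/-- The integral `∫₀ˣ |M|`. -/
def kerInt (M : ℝ → ℂ) (x : ℝ) : ℝ := ∫ t in (0 : ℝ)..x, ‖M t‖

/-- The primitive `∫₀ˣ M`. -/
def kerPrim (M : ℝ → ℂ) (x : ℝ) : ℂ := ∫ t in (0 : ℝ)..x, M t

theorem kerInt_nonneg (M : ℝ → ℂ) {x : ℝ} (hx : 0 ≤ x) : 0 ≤ kerInt M x :=
  intervalIntegral.integral_nonneg hx fun _ _ => norm_nonneg _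

theorem IsKernel.aestronglyMeasurable (hM : IsKernel M) :
    AEStronglyMeasurable M (volume.restrict (Ioo (0 : ℝ) π)) := by
  have h1 : AEStronglyMeasurable (fun x : ℝ => (((π - x : ℝ) : ℂ))⁻¹)
      (volume.restrict (Ioo (0 : ℝ) π)) := by
    apply Measurable.aestronglyMeasurable
    fun_prop
  refine (h1.mul hM.1).congr ?_
  filter_upwards [ae_restrict_mem measurableSet_Ioo] with x hx
  have : ((π - x : ℝ) : ℂ) ≠ 0 := by exact_mod_cast (sub_pos.2 hx.2).ne'
  simp only [Pi.mul_apply]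
  rw [inv_mul_cancel_left₀ this]

theorem IsKernel.continuousOn_kerInt (hM : IsKernel M) : ContinuousOn (kerInt M) (Ioo 0 π) := by
  intro x hx
  obtain ⟨X, hX1, hX2⟩ := exists_between hx.2
  have h := intervalIntegral.continuousOn_primitive_interval'
    (hM.intervalIntegrable (x := X) ⟨hx.1.trans hX1, hX2⟩).norm left_mem_uIcc
  rw [uIcc_of_le (hx.1.trans hX1).le] at h
  exact (h.continuousAt (Icc_mem_nhds hx.1 hX1)).continuousWithinAt

/-- Cauchy–Schwarz for the splitting `|M| = (π - r)^(-3/4) · (π - r)^(-1/4) |(π - r) M|`. The square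
of the first factor integrates to at most `2 (π - x)^(-1/2)`. -/
theorem sq_kerInt_le (hM : IsKernel M) {x : ℝ} (hx : x ∈ Ioo 0 π) :
    kerInt M x ^ 2 ≤ 2 * ((π - x) ^ (-(1 / 2) : ℝ) *
      ∫ r in Ioo 0 x, (π - r) ^ (-(1 / 2) : ℝ) * ‖((π - r : ℝ) : ℂ) * M r‖ ^ 2) := by
  have hsub : ∀ r ∈ Ioo 0 x, 0 < π - r := fun r hr => by linarith [hr.2, hx.2]
  have hle := Measure.restrict_mono (Ioo_subset_Ioo_right hx.2.le : Ioo 0 x ⊆ Ioo 0 π)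
    (le_refl (volume : Measure ℝ))
  have hpow : ∀ a : ℝ, ContinuousOn (fun r : ℝ => (π - r) ^ a) (Icc 0 x) := fun a =>
    ContinuousOn.rpow_const (by fun_prop) fun r hr => Or.inl (by linarith [hr.2, hx.2])
  have hbdd : ∀ a : ℝ, ∃ C, ∀ r ∈ Icc 0 x, ‖(π - r) ^ a‖ ≤ C := fun a =>
    isCompact_Icc.exists_bound_of_continuousOn (hpow a)
  have hm : ∀ a : ℝ, AEStronglyMeasurable (fun r : ℝ => (π - r) ^ a)
      (volume.restrict (Ioo 0 x)) := fun a =>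
    ((hpow a).mono Ioo_subset_Icc_self).aestronglyMeasurable measurableSet_Ioo
  have hf : MemLp (fun r : ℝ => (π - r) ^ (-(3 / 4) : ℝ)) 2 (volume.restrict (Ioo 0 x)) := by
    obtain ⟨C, hC⟩ := hbdd (-(3 / 4))
    apply MemLp.of_bound (hm _) C
    filter_upwards [ae_restrict_mem measurableSet_Ioo] with r hr
    exact hC r (Ioo_subset_Icc_self hr)
  have hg : MemLp (fun r : ℝ => (π - r) ^ (-(1 / 4) : ℝ) * ‖((π - r : ℝ) : ℂ) * M r‖) 2
      (volume.restrict (Ioo 0 x)) := by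
    obtain ⟨C, hC⟩ := hbdd (-(1 / 4))
    have hM' : MemLp (fun r : ℝ => ((π - r : ℝ) : ℂ) * M r) 2 (volume.restrict (Ioo 0 x)) :=
      MemLp.mono_measure hle hM
    refine hM'.of_le_mul (c := C) ((hm _).mul hM'.1.norm) ?_
    filter_upwards [ae_restrict_mem measurableSet_Ioo] with r hr
    rw [norm_mul, norm_norm]
    exact mul_le_mul_of_nonneg_right (hC r (Ioo_subset_Icc_self hr)) (norm_nonneg _)
  have h1 := sq_integral_mul_le hf hg
  have h2 : ∫ r in Ioo 0 x, (π - r) ^ (-(3 / 4) : ℝ) *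
      ((π - r) ^ (-(1 / 4) : ℝ) * ‖((π - r : ℝ) : ℂ) * M r‖) = kerInt M x := by
    rw [kerInt, intervalIntegral.integral_of_le hx.1.le, integral_Ioc_eq_integral_Ioo]
    refine setIntegral_congr_fun measurableSet_Ioo fun r hr => ?_
    have h3 := hsub r hr
    rw [norm_mul, Complex.norm_real, Real.norm_of_nonneg h3.le, ← mul_assoc, ← mul_assoc,
      ← Real.rpow_add h3]
    norm_num
    rw [Real.rpow_neg_one, inv_mul_cancel₀ h3.ne', one_mul]
  have h3 : ∫ r in Ioo 0 x, ((π - r) ^ (-(3 / 4) : ℝ)) ^ 2 ≤ 2 * (π - x) ^ (-(1 / 2) : ℝ) := by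
    have h4 : ∫ r in Ioo 0 x, ((π - r) ^ (-(3 / 4) : ℝ)) ^ 2 =
        ∫ r in (0 : ℝ)..x, (π - r) ^ (-(3 / 2) : ℝ) := by
      rw [intervalIntegral.integral_of_le hx.1.le, integral_Ioc_eq_integral_Ioo]
      refine setIntegral_congr_fun measurableSet_Ioo fun r hr => ?_
      rw [← Real.rpow_natCast, ← Real.rpow_mul (hsub r hr).le]
      norm_num
    have hx' : 0 < π - x := by linarith [hx.2]
    rw [h4, intervalIntegral.integral_comp_sub_left (fun u => u ^ (-(3 / 2) : ℝ)) π, sub_zero,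
      integral_rpow (Or.inr ⟨by norm_num, by
        rw [uIcc_of_le (by linarith [hx.1])]
        exact fun h => by linarith [h.1]⟩)]
    have h5 : (0 : ℝ) ≤ π ^ (-(1 / 2) : ℝ) := Real.rpow_nonneg Real.pi_pos.le _
    norm_num at h5 ⊢
    linarith
  rw [h2] at h1
  refine h1.trans ?_
  have h6 : ∀ r ∈ Ioo 0 x, ((π - r) ^ (-(1 / 4) : ℝ) * ‖((π - r : ℝ) : ℂ) * M r‖) ^ 2 =
      (π - r) ^ (-(1 / 2) : ℝ) * ‖((π - r : ℝ) : ℂ) * M r‖ ^ 2 := by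
    intro r hr
    rw [mul_pow, ← Real.rpow_natCast ((π - r) ^ (-(1 / 4) : ℝ)), ← Real.rpow_mul (hsub r hr).le]
    norm_num
  rw [setIntegral_congr_fun measurableSet_Ioo h6, ← mul_assoc]
  refine mul_le_mul_of_nonneg_right h3 (setIntegral_nonneg measurableSet_Ioo fun r hr => ?_)
  have := hsub r hr
  positivity

/-- Hardy's inequality for the kernel. -/
theorem IsKernel.inL2_kerInt (hM : IsKernel M) : InL2 (kerInt M) := by
  set μ := (volume : Measure ℝ).restrict (Ioo 0 π) with hμ
  have hmeas : AEStronglyMeasurable (kerInt M) μ :=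
    hM.continuousOn_kerInt.aestronglyMeasurable measurableSet_Ioo
  set m : ℝ → ℝ := fun r => ‖((π - r : ℝ) : ℂ) * M r‖ ^ 2 with hm
  have hmint : Integrable m μ := hM.integrable_norm_pow (by norm_num)
  set p : ℝ → ℝ := fun r => (π - r) ^ (-(1 / 2) : ℝ) with hp
  have hpm : Measurable p := by fun_prop
  have hp0 : ∀ r ∈ Ioo 0 π, 0 ≤ p r := fun r hr => Real.rpow_nonneg (by linarith [hr.2]) _
  have hpint : ∀ r ∈ Ioo 0 π, IntegrableOn p (Ioo r π) ∧
      ∫ x in Ioo r π, p x = 2 * (π - r) ^ (1 / 2 : ℝ) := by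
    intro r hr
    constructor
    · rw [← intervalIntegrable_iff_integrableOn_Ioo_of_le hr.2.le]
      have := (intervalIntegral.intervalIntegrable_rpow' (a := 0) (b := π - r)
        (r := (-(1 / 2) : ℝ)) (by norm_num)).comp_sub_left π
      simp only [sub_zero, sub_sub_cancel] at this
      exact this.symm
    · rw [← integral_Ioc_eq_integral_Ioo, ← intervalIntegral.integral_of_le hr.2.le, hp,
        intervalIntegral.integral_comp_sub_left (fun u => u ^ (-(1 / 2) : ℝ)) π, sub_self,
        integral_rpow (Or.inl (by norm_num))]
      norm_num
      ring
  set S : Set (ℝ × ℝ) := {q | q.2 < q.1} with hS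
  have hSm : MeasurableSet S := measurableSet_lt measurable_snd measurable_fst
  -- The majorant of `sq_kerInt_le` as a double integral. Integrated in `x` first, it gives `∫ᵣ^π (π
  -- - x)^(-1/2) dx = 2 (π - r)^(1/2)`, which cancels `p r` and leaves `2 m`, an integrable
  -- function.
  set F : ℝ × ℝ → ℝ := S.indicator fun q => p q.1 * (p q.2 * m q.2) with hF
  have hFm : AEStronglyMeasurable F (μ.prod μ) := by
    apply AEStronglyMeasurable.indicator _ hSm
    exact (hpm.aestronglyMeasurable.comp_fst).mul
      ((hpm.aestronglyMeasurable.mul hmint.1).comp_snd)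
  have hF1 : ∀ r x, F (x, r) = (Ioi r).indicator (fun x => p x * (p r * m r)) x := by
    intro r x
    simp only [hF, hS, indicator_apply]
    rfl
  have hF2 : ∀ x r, F (x, r) = (Iio x).indicator (fun r => p x * (p r * m r)) r := by
    intro r x
    simp only [hF, hS, indicator_apply]
    rfl
  have hFint : Integrable F (μ.prod μ) := by
    rw [integrable_prod_iff' hFm]
    constructor
    · filter_upwards [ae_restrict_mem measurableSet_Ioo] with r hr
      simp only [hF1]
      rw [integrable_indicator_iff measurableSet_Ioi, IntegrableOn, hμ,
        Measure.restrict_restrict measurableSet_Ioi]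
      have h1 : Ioi r ∩ Ioo 0 π = Ioo r π := by
        ext t; simp only [mem_inter_iff, mem_Ioi, mem_Ioo]
        exact ⟨fun h => ⟨h.1, h.2.2⟩, fun h => ⟨h.1, hr.1.trans h.1, h.2⟩⟩
      rw [h1]
      exact (hpint r hr).1.mul_const _
    · refine (hmint.const_mul 2).congr ?_
      filter_upwards [ae_restrict_mem measurableSet_Ioo] with r hr
      have h1 : Ioi r ∩ Ioo 0 π = Ioo r π := by
        ext t; simp only [mem_inter_iff, mem_Ioi, mem_Ioo]
        exact ⟨fun h => ⟨h.1, h.2.2⟩, fun h => ⟨h.1, hr.1.trans h.1, h.2⟩⟩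
      have hr' : 0 < π - r := by linarith [hr.2]
      simp only [hF1, norm_indicator_eq_indicator_norm]
      rw [integral_indicator measurableSet_Ioi, hμ, Measure.restrict_restrict measurableSet_Ioi,
        h1, setIntegral_congr_fun (g := fun x => p x * (p r * m r)) measurableSet_Ioo,
        integral_mul_const, (hpint r hr).2]
      · have : (π - r) ^ (1 / 2 : ℝ) * p r = 1 := by
          rw [hp]
          simp only
          rw [← Real.rpow_add hr']
          norm_num
        linear_combination -2 * m r * this
      · intro x hx
        simp only
        rw [Real.norm_of_nonneg]
        have h3 := hp0 x ⟨hr.1.trans hx.1, hx.2⟩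
        have h4 := hp0 r hr
        have h5 : 0 ≤ m r := by positivity
        positivity
  have hmaj := hFint.integral_prod_left.const_mul 2
  rw [InL2, memLp_two_iff_integrable_sq hmeas]
  refine hmaj.mono' (hmeas.pow 2) ?_
  filter_upwards [ae_restrict_mem measurableSet_Ioo] with x hx
  rw [Real.norm_of_nonneg (sq_nonneg _)]
  refine (sq_kerInt_le hM hx).trans (le_of_eq ?_)
  congr 1
  have h1 : Iio x ∩ Ioo 0 π = Ioo 0 x := by
    ext t; simp only [mem_inter_iff, mem_Iio, mem_Ioo]
    exact ⟨fun h => ⟨h.2.1, h.1⟩, fun h => ⟨h.2, h.1, h.2.trans hx.2⟩⟩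
  simp only [hF2]
  rw [integral_indicator measurableSet_Iio, hμ, Measure.restrict_restrict measurableSet_Iio, h1,
    integral_const_mul]

end Kernel

/-! ### Convolutions with the singular kernel -/

section KernelConvolution

variable {M : ℝ → ℂ}

theorem IsKernel.intervalIntegrable_mul (hM : IsKernel M) {g : ℝ → ℂ}
    (hg : ContinuousOn g (Icc 0 π)) {x : ℝ} (hx : x ∈ Ioo (0 : ℝ) π) :
    IntervalIntegrable (fun t => M (x - t) * g t) volume 0 x := by
  have h1 := ((hM.intervalIntegrable hx).comp_sub_left x).symm
  simp only [sub_self, sub_zero] at h1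
  refine h1.mul_continuousOn (hg.mono ?_)
  rw [uIcc_of_le hx.1.le]
  exact Icc_subset_Icc_right hx.2.le

theorem IsKernel.integral_norm_mul_le (hM : IsKernel M) {g : ℝ → ℂ}
    (hg : ContinuousOn g (Icc 0 π)) {x : ℝ} (hx : x ∈ Ioo (0 : ℝ) π) {C : ℝ}
    (hC : ∀ t ∈ Icc (0 : ℝ) x, ‖g t‖ ≤ C) :
    ∫ t in (0 : ℝ)..x, ‖M (x - t) * g t‖ ≤ C * kerInt M x := by
  have h1 : ∫ t in (0 : ℝ)..x, ‖M (x - t)‖ = kerInt M x := by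
    rw [kerInt]
    simpa using intervalIntegral.integral_comp_sub_left (a := 0) (b := x) (fun t => ‖M t‖) x
  have h2 : IntervalIntegrable (fun t => ‖M (x - t)‖) volume 0 x := by
    have := ((hM.intervalIntegrable hx).comp_sub_left x).symm.norm
    simpa using this
  rw [← h1, ← intervalIntegral.integral_const_mul]
  apply intervalIntegral.integral_mono_on hx.1.le (hM.intervalIntegrable_mul hg hx).norm
    (h2.const_mul C)
  intro t ht
  rw [norm_mul, mul_comm]
  exact mul_le_mul_of_nonneg_right (hC t ht) (norm_nonneg _)

theorem IsKernel.norm_cv_le (hM : IsKernel M) {g : ℝ → ℂ}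
    (hg : ContinuousOn g (Icc 0 π)) {x : ℝ} (hx : x ∈ Ioo (0 : ℝ) π) {C : ℝ}
    (hC : ∀ t ∈ Icc (0 : ℝ) x, ‖g t‖ ≤ C) : ‖cv M g x‖ ≤ C * kerInt M x :=
  (intervalIntegral.norm_integral_le_integral_norm hx.1.le).trans
    (hM.integral_norm_mul_le hg hx hC)

theorem IsKernel.continuousOn_cv (hM : IsKernel M) {g : ℝ → ℂ}
    (hg : ContinuousOn g (Icc 0 π)) : ContinuousOn (cv M g) (Ioo 0 π) := by
  intro x hx
  obtain ⟨X, hX1, hX2⟩ := exists_between hx.2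
  have h := _root_.continuousOn_cv (hx.1.trans hX1).le
    (hM.intervalIntegrable (x := X) ⟨hx.1.trans hX1, hX2⟩)
    (hg.mono (Icc_subset_Icc_right hX2.le))
  rw [funext (cv_comm M g)]
  exact (h.continuousAt (Icc_mem_nhds hx.1 hX1)).continuousWithinAt

theorem IsKernel.inL2_cv (hM : IsKernel M) {g : ℝ → ℂ} (hg : ContinuousOn g (Icc 0 π)) :
    InL2 (cv M g) := by
  obtain ⟨C, -, hC⟩ := hg.norm_le_of_Icc
  refine hM.inL2_kerInt.of_le_mul (c := C)
    ((hM.continuousOn_cv hg).aestronglyMeasurable measurableSet_Ioo) ?_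
  filter_upwards [ae_restrict_mem measurableSet_Ioo] with x hx
  rw [Real.norm_of_nonneg (kerInt_nonneg M hx.1.le)]
  exact hM.norm_cv_le hg hx fun t ht => hC t ⟨ht.1, ht.2.trans hx.2.le⟩

/-- Although `M` need not be integrable up to `π`, `|M| * |g|` is majorised by a multiple of `kerInt
M`, which is square integrable by Hardy's inequality and can be convolved with `|f|`. -/
theorem IsKernel.cv_assoc (hM : IsKernel M) {g f : ℝ → ℂ} (hg : ContinuousOn g (Icc 0 π))
    (hf : InL2 f) {x : ℝ} (hx : x ∈ Icc (0 : ℝ) π) : cv (cv M g) f x = cv M (cv g f) x := by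
  obtain ⟨C, -, hC⟩ := hg.norm_le_of_Icc
  have hsub : ∀ s ∈ Ioo 0 x, s ∈ Ioo (0 : ℝ) π := fun s hs => ⟨hs.1, hs.2.trans_le hx.2⟩
  exact _root_.cv_assoc (b := fun s => C * kerInt M s) hM.aestronglyMeasurable hg.inL2.1 hf.1 hx
    (fun s hs => hM.intervalIntegrable_mul hg (hsub s hs))
    (fun s hs => hM.integral_norm_mul_le hg (hsub s hs) fun t ht =>
      hC t ⟨ht.1, ht.2.trans (hsub s hs).2.le⟩)
    (InL2.intervalIntegrable_conv (hM.inL2_kerInt.const_mul C) hf.norm hx)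

theorem continuousOn_one_Icc : ContinuousOn (fun _ : ℝ => (1 : ℂ)) (Icc 0 π) := continuousOn_const

theorem inL2_one : InL2 (fun _ : ℝ => (1 : ℂ)) := continuousOn_one_Icc.inL2

theorem kerPrim_eq_cv (M : ℝ → ℂ) : kerPrim M = cv M fun _ => 1 := by
  funext x
  rw [cv_comm, cv_one_left, kerPrim]

theorem IsKernel.inL2_kerPrim (hM : IsKernel M) : InL2 (kerPrim M) := by
  rw [kerPrim_eq_cv]; exact hM.inL2_cv continuousOn_one_Icc

theorem IsKernel.kerPrim_cv (hM : IsKernel M) {g : ℝ → ℂ} (hg : ContinuousOn g (Icc 0 π)) {x : ℝ}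
    (hx : x ∈ Icc (0 : ℝ) π) : cv (kerPrim M) g x = cv (fun _ => 1) (cv M g) x := by
  rw [kerPrim_eq_cv, hM.cv_assoc continuousOn_one_Icc hg.inL2 hx, cv_comm (fun _ => 1),
    hM.cv_assoc hg inL2_one hx, funext (cv_comm (fun _ => 1) g)]

/-- Allows an identity of continuous functions to be verified after one integration, where
associativity and commutativity of the convolution replace differentiation. -/
theorem eqOn_of_cv_one_eq {u v : ℝ → ℂ} (hu : ContinuousOn u (Icc 0 π))
    (hv : ContinuousOn v (Icc 0 π))
    (h : ∀ x ∈ Icc (0 : ℝ) π, cv (fun _ => 1) u x = cv (fun _ => 1) v x) :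
    ∀ x ∈ Icc (0 : ℝ) π, u x = v x := by
  have h1 : (fun x => u x - v x) =ᵐ[volume.restrict (Ioo (0 : ℝ) π)] 0 := by
    apply eq_zero_of_primitive_eq_zero
    · exact (hu.sub hv).inL2.intervalIntegrable (right_mem_Icc.2 Real.pi_pos.le)
    · intro x hx
      rw [← cv_one_left, inL2_one.cv_sub_right hu.inL2 hv.inL2 hx, h x hx, sub_self]
  refine Measure.eqOn_Icc_of_ae_eq volume Real.pi_pos.ne ?_ hu hv
  rw [← restrict_Ioo_eq_restrict_Icc]
  filter_upwards [h1] with x hx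
  exact sub_eq_zero.1 hx

end KernelConvolution

/-! ### Fundamental solutions and variation of constants -/

section Fundamental

variable {M : ℝ → ℂ}

/-- The derivative of the solution `S₀` of `ℓ y = 0`, `y(0) = 0`, `y'(0) = 1`. -/
def fundDer (hM : IsKernel M) : ℝ → ℂ :=
  (exists_volterra_solution hM.inL2_kerPrim continuousOn_one_Icc).choose

theorem continuousOn_fundDer (hM : IsKernel M) : ContinuousOn (fundDer hM) (Icc 0 π) :=
  (exists_volterra_solution hM.inL2_kerPrim continuousOn_one_Icc).choose_spec.1

theorem fundDer_eq (hM : IsKernel M) {x : ℝ} (hx : x ∈ Icc (0 : ℝ) π) :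
    fundDer hM x = 1 + cv (kerPrim M) (fundDer hM) x :=
  (exists_volterra_solution hM.inL2_kerPrim continuousOn_one_Icc).choose_spec.2 x hx

/-- The solution `S₀` of `ℓ y = 0`, `y(0) = 0`, `y'(0) = 1`. -/
def fundSol (hM : IsKernel M) : ℝ → ℂ := cv (fun _ => 1) (fundDer hM)

theorem continuousOn_fundSol (hM : IsKernel M) : ContinuousOn (fundSol hM) (Icc 0 π) :=
  (continuousOn_fundDer hM).inL2.continuousOn_cv continuousOn_one_Icc

/-- Treats `z y` as a forcing term for `ℓ`, with `S₀` as the Green kernel. -/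
theorem exists_eigenSol (hM : IsKernel M) (z : ℂ) :
    ∃ y : ℝ → ℂ, ContinuousOn y (Icc 0 π) ∧
      ∀ x ∈ Icc 0 π, y x = fundSol hM x - z * cv (fundSol hM) y x := by
  obtain ⟨y, hy, h⟩ := exists_volterra_solution (k := fun t => -z * fundSol hM t)
    ((continuousOn_fundSol hM).inL2.const_mul (-z)) (continuousOn_fundSol hM)
  refine ⟨y, hy, fun x hx => ?_⟩
  rw [h x hx, cv_smul_left]
  ring

/-- The solution `S(·, z)` of `ℓ y = z y`, `y(0) = 0`, `y'(0) = 1`. -/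
def eigenSol (hM : IsKernel M) (z : ℂ) : ℝ → ℂ := (exists_eigenSol hM z).choose

theorem continuousOn_eigenSol (hM : IsKernel M) (z : ℂ) :
    ContinuousOn (eigenSol hM z) (Icc 0 π) := (exists_eigenSol hM z).choose_spec.1

theorem eigenSol_eq (hM : IsKernel M) (z : ℂ) {x : ℝ} (hx : x ∈ Icc (0 : ℝ) π) :
    eigenSol hM z x = fundSol hM x - z * cv (fundSol hM) (eigenSol hM z) x :=
  (exists_eigenSol hM z).choose_spec.2 x hx

/-- The derivative of `eigenSol`. -/
def eigenDer (hM : IsKernel M) (z : ℂ) (x : ℝ) : ℂ :=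
  fundDer hM x - z * cv (fundDer hM) (eigenSol hM z) x

theorem continuousOn_eigenDer (hM : IsKernel M) (z : ℂ) :
    ContinuousOn (eigenDer hM z) (Icc 0 π) :=
  (continuousOn_fundDer hM).sub
    (continuousOn_const.mul ((continuousOn_eigenSol hM z).inL2.continuousOn_cv
      (continuousOn_fundDer hM)))

theorem eigenSol_eq_cv_one (hM : IsKernel M) (z : ℂ) {x : ℝ} (hx : x ∈ Icc (0 : ℝ) π) :
    eigenSol hM z x = cv (fun _ => 1) (eigenDer hM z) x := by
  have hZ := continuousOn_fundDer hM
  have hS := continuousOn_eigenSol hM z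
  have h1 : cv (fun _ => 1) (eigenDer hM z) x = cv (fun _ => 1) (fundDer hM) x -
      cv (fun _ => 1) (fun t => z * cv (fundDer hM) (eigenSol hM z) t) x :=
    inL2_one.cv_sub_right hZ.inL2 ((hS.inL2.continuousOn_cv hZ).inL2.const_mul z) hx
  rw [h1, cv_smul_right, ← inL2_one.cv_assoc hZ.inL2 hS.inL2 hx, eigenSol_eq hM z hx]
  rfl

/-- The integrated equation `S' = 1 + ∫ M * S' - z ∫ S`. -/
theorem eigenDer_eq (hM : IsKernel M) (z : ℂ) {x : ℝ} (hx : x ∈ Icc (0 : ℝ) π) :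
    eigenDer hM z x = 1 + cv (fun _ => 1) (cv M (eigenDer hM z)) x
      - z * cv (fun _ => 1) (eigenSol hM z) x := by
  have hZ := continuousOn_fundDer hM
  have hS := continuousOn_eigenSol hM z
  have hN := hM.inL2_kerPrim
  have hNZ : InL2 (cv (kerPrim M) (fundDer hM)) := by
    rw [funext (cv_comm (kerPrim M) _)]
    exact (hN.continuousOn_cv hZ).inL2
  have h1 : cv (kerPrim M) (eigenDer hM z) x = cv (kerPrim M) (fundDer hM) x -
      cv (kerPrim M) (fun t => z * cv (fundDer hM) (eigenSol hM z) t) x :=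
    hN.cv_sub_right hZ.inL2 ((hS.inL2.continuousOn_cv hZ).inL2.const_mul z) hx
  have h2 : cv (fundDer hM) (eigenSol hM z) x = cv (fun _ => 1) (eigenSol hM z) x +
      cv (cv (kerPrim M) (fundDer hM)) (eigenSol hM z) x := by
    rw [← hS.inL2.cv_add_left inL2_one hNZ hx]
    exact cv_congr_left (ae_eq_of_eqOn_Icc fun t ht => fundDer_eq hM ht) hx
  rw [← hM.kerPrim_cv (continuousOn_eigenDer hM z) hx, h1, cv_smul_right,
    ← hN.cv_assoc hZ.inL2 hS.inL2 hx]
  have h3 := fundDer_eq hM hx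
  rw [eigenDer]
  linear_combination h3 - z * h2

theorem fundDer_zero (hM : IsKernel M) : fundDer hM 0 = 1 := by
  rw [fundDer_eq hM (left_mem_Icc.2 Real.pi_pos.le), cv_zero, add_zero]

theorem fundDer_cv_eq (hM : IsKernel M) {f : ℝ → ℂ} (hf : InL2 f) {x : ℝ}
    (hx : x ∈ Icc (0 : ℝ) π) :
    cv (fundDer hM) f x = cv (fun _ => 1) f x + cv (kerPrim M) (cv (fundDer hM) f) x := by
  have hZ := continuousOn_fundDer hM
  have hN := hM.inL2_kerPrim
  have hNZ : InL2 (cv (kerPrim M) (fundDer hM)) := by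
    rw [funext (cv_comm (kerPrim M) _)]
    exact (hN.continuousOn_cv hZ).inL2
  rw [← hN.cv_assoc hZ.inL2 hf hx, ← hf.cv_add_left inL2_one hNZ hx]
  exact cv_congr_left (ae_eq_of_eqOn_Icc fun t ht => fundDer_eq hM ht) hx

/-- Variation of constants for `w' = M * w - f`, `w(0) = a`. -/
theorem eq_of_volterra (hM : IsKernel M) {w f : ℝ → ℂ} {a : ℂ} (hw : ContinuousOn w (Icc 0 π))
    (hf : InL2 f) (h : ∀ x ∈ Icc (0 : ℝ) π, w x = a + cv (kerPrim M) w x - cv (fun _ => 1) f x) :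
    ∀ x ∈ Icc (0 : ℝ) π, w x = a * fundDer hM x - cv (fundDer hM) f x := by
  have hZ := continuousOn_fundDer hM
  have hN := hM.inL2_kerPrim
  have hNw : InL2 (cv (kerPrim M) w) := by
    rw [funext (cv_comm (kerPrim M) _)]
    exact (hN.continuousOn_cv hw).inL2
  have h1f : InL2 (cv (fun _ => 1) f) := (hf.continuousOn_cv continuousOn_one_Icc).inL2
  have hZf : ContinuousOn (cv (fundDer hM) f) (Icc 0 π) := hf.continuousOn_cv hZ
  apply eqOn_of_cv_one_eq (v := fun t => a * fundDer hM t - cv (fundDer hM) f t) hw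
    ((continuousOn_const.mul hZ).sub hZf)
  intro x hx
  -- With `Z = fundDer hM` and `N = kerPrim M`, the equation for `w` is convolved with `Z`. Since `Z
  -- = 1 + N * Z`, the terms `N * Z * w` cancel and `1 * w` is left alone.
  have h1 : cv (fundDer hM) w x = cv (fundDer hM) (fun t => a * (fun _ => (1 : ℂ)) t) x +
      cv (fundDer hM) (cv (kerPrim M) w) x - cv (fundDer hM) (cv (fun _ => 1) f) x := by
    rw [← hZ.inL2.cv_add_right (inL2_one.const_mul a) hNw hx,
      ← hZ.inL2.cv_sub_right (g := fun t => a * 1 + cv (kerPrim M) w t)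
        ((inL2_one.const_mul a).add hNw) h1f hx]
    refine cv_congr_right (ae_eq_of_eqOn_Icc fun t ht => ?_) hx
    rw [h t ht]
    simp
  rw [cv_smul_right] at h1
  have h2 := fundDer_cv_eq hM hw.inL2 hx
  have h3 : cv (fundDer hM) (cv (kerPrim M) w) x = cv (kerPrim M) (cv (fundDer hM) w) x := by
    rw [← hZ.inL2.cv_assoc hN hw.inL2 hx, funext (cv_comm (fundDer hM) (kerPrim M)),
      hN.cv_assoc hZ.inL2 hw.inL2 hx]
  have h4 : cv (fundDer hM) (cv (fun _ => 1) f) x = cv (fun _ => 1) (cv (fundDer hM) f) x := by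
    rw [← hZ.inL2.cv_assoc inL2_one hf hx, funext (cv_comm (fundDer hM) (fun _ => 1)),
      inL2_one.cv_assoc hZ.inL2 hf hx]
  have h5 : cv (fun _ => 1) (fun t => a * fundDer hM t - cv (fundDer hM) f t) x =
      a * cv (fun _ => 1) (fundDer hM) x - cv (fun _ => 1) (cv (fundDer hM) f) x := by
    rw [inL2_one.cv_sub_right (hZ.inL2.const_mul a) hZf.inL2 hx, cv_smul_right]
  rw [h5, cv_comm _ (fundDer hM)]
  linear_combination h1 - h2 + h3 - h4

end Fundamental

/-! ### Convolution operators on `L₂(0, π)` -/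

section Operators

theorem integral_norm_le_L2Pi (f : L2Pi) :
    ∫ t in Ioo 0 π, ‖f t‖ ≤ √π * ‖f‖ := by
  have h1 : ∫ t in Ioo 0 π, ‖f t‖ ^ 2 = ‖f‖ ^ 2 := by
    have h2 := L2.inner_def (𝕜 := ℂ) f f
    rw [inner_self_eq_norm_sq_to_K] at h2
    have h3 : ∀ t, inner ℂ (f t) (f t) = ((‖f t‖ ^ 2 : ℝ) : ℂ) := by
      intro t
      rw [inner_self_eq_norm_sq_to_K]
      simp
    simp only [h3] at h2
    rw [integral_complex_ofReal] at h2
    apply Complex.ofReal_injective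
    rw [← h2]
    simp
  have h2 := sq_integral_mul_le (Lp.memLp f).norm
    (memLp_const (1 : ℝ) : MemLp (fun _ : ℝ => (1 : ℝ)) 2 (volume.restrict (Ioo (0 : ℝ) π)))
  simp only [mul_one, one_pow, h1] at h2
  apply le_of_sq_le_sq _ (by positivity)
  refine h2.trans (le_of_eq ?_)
  rw [mul_pow, Real.sq_sqrt Real.pi_pos.le, mul_comm]
  simp [Real.pi_pos.le]

theorem norm_cv_le_L2Pi {k : ℝ → ℂ} {C : ℝ} (hC0 : 0 ≤ C)
    (hC : ∀ x ∈ Icc (0 : ℝ) π, ‖k x‖ ≤ C) (f : L2Pi) {x : ℝ} (hx : x ∈ Icc (0 : ℝ) π) :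
    ‖cv k f x‖ ≤ C * √π * ‖f‖ := by
  have hfi := ((Lp.memLp f).integrable (by norm_num : (1 : ENNReal) ≤ 2)).norm
  rw [cv, mul_assoc]
  have h1 : ∀ t ∈ Ioc 0 x, ‖k (x - t) * f t‖ ≤ C * ‖f t‖ := by
    intro t ht
    rw [norm_mul]
    exact mul_le_mul_of_nonneg_right (hC _ ⟨by linarith [ht.2], by linarith [ht.1, hx.2]⟩)
      (norm_nonneg _)
  refine (intervalIntegral.norm_integral_le_of_norm_le hx.1 (ae_of_all _ h1)
    ((InL2.intervalIntegrable (Lp.memLp f) hx).norm.const_mul _)).trans ?_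
  rw [intervalIntegral.integral_const_mul]
  refine mul_le_mul_of_nonneg_left ?_ hC0
  rw [intervalIntegral.integral_of_le hx.1, integral_Ioc_eq_integral_Ioo]
  exact (setIntegral_mono_set hfi (ae_of_all _ fun t => norm_nonneg _)
    (Ioo_subset_Ioo_right hx.2).eventuallyLE).trans (integral_norm_le_L2Pi f)

theorem cv_add_L2Pi {k : ℝ → ℂ} (hk : ContinuousOn k (Icc 0 π)) (f g : L2Pi) {x : ℝ}
    (hx : x ∈ Icc (0 : ℝ) π) : cv k (f + g : L2Pi) x = cv k f x + cv k g x := by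
  rw [← hk.inL2.cv_add_right (Lp.memLp f) (Lp.memLp g) hx]
  exact cv_congr_right (Lp.coeFn_add f g) hx

theorem cv_smul_L2Pi (k : ℝ → ℂ) (c : ℂ) (f : L2Pi) {x : ℝ}
    (hx : x ∈ Icc (0 : ℝ) π) : cv k (c • f : L2Pi) x = c * cv k f x := by
  rw [← cv_smul_right]
  exact cv_congr_right (Lp.coeFn_smul c f) hx

/-- The functional `f ↦ (k * f)(π)` on `L₂(0, π)`. -/
def convEval (k : ℝ → ℂ) (hk : ContinuousOn k (Icc 0 π)) : L2Pi →L[ℂ] ℂ :=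
  LinearMap.mkContinuous
    { toFun := fun f => cv k f π
      map_add' := fun f g => cv_add_L2Pi hk f g (right_mem_Icc.2 Real.pi_pos.le)
      map_smul' := fun c f => cv_smul_L2Pi k c f (right_mem_Icc.2 Real.pi_pos.le) }
    (hk.norm_le_of_Icc.choose * √π)
    fun f => norm_cv_le_L2Pi hk.norm_le_of_Icc.choose_spec.1 hk.norm_le_of_Icc.choose_spec.2 f
      (right_mem_Icc.2 Real.pi_pos.le)

theorem inL2_cv_L2Pi {k : ℝ → ℂ} (hk : ContinuousOn k (Icc 0 π)) (f : L2Pi) : InL2 (cv k f) :=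
  (InL2.continuousOn_cv (Lp.memLp f) hk).inL2

/-- The convolution operator `f ↦ k * f` on `L₂(0, π)`. -/
def convOp (k : ℝ → ℂ) (hk : ContinuousOn k (Icc 0 π)) : L2Pi →L[ℂ] L2Pi :=
  LinearMap.mkContinuous
    { toFun := fun f => (inL2_cv_L2Pi hk f).toLp
      map_add' := fun f g => by
        rw [← MemLp.toLp_add]
        exact (MemLp.toLp_eq_toLp_iff _ _).2
          (ae_eq_of_eqOn_Icc fun x hx => cv_add_L2Pi hk f g hx)
      map_smul' := fun c f => by
        rw [RingHom.id_apply, ← MemLp.toLp_const_smul]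
        exact (MemLp.toLp_eq_toLp_iff _ _).2
          (ae_eq_of_eqOn_Icc fun x hx => cv_smul_L2Pi k c f hx) }
    ((measureUnivNNReal (volume.restrict (Ioo (0 : ℝ) π)) : ℝ) ^ (2 : ENNReal).toReal⁻¹ *
      (hk.norm_le_of_Icc.choose * √π))
    fun f => by
      have hC := hk.norm_le_of_Icc.choose_spec
      rw [mul_assoc]
      refine Lp.norm_le_of_ae_bound (by have := hC.1; positivity) ?_
      filter_upwards [(inL2_cv_L2Pi hk f).coeFn_toLp, ae_restrict_mem measurableSet_Ioo]
        with x h1 h2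
      change ‖(inL2_cv_L2Pi hk f).toLp _ x‖ ≤ _
      rw [h1]
      exact norm_cv_le_L2Pi hC.1 hC.2 f (Ioo_subset_Icc_self h2)

theorem convOp_coeFn (k : ℝ → ℂ) (hk : ContinuousOn k (Icc 0 π)) (f : L2Pi) :
    convOp k hk f =ᵐ[volume.restrict (Ioo (0 : ℝ) π)] cv k f := (inL2_cv_L2Pi hk f).coeFn_toLp

theorem cv_convOp {k l : ℝ → ℂ} (hk : ContinuousOn k (Icc 0 π)) (hl : ContinuousOn l (Icc 0 π))
    (f : L2Pi) {x : ℝ} (hx : x ∈ Icc (0 : ℝ) π) : cv k (convOp l hl f) x = cv (cv k l) f x := by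
  rw [cv_congr_right (convOp_coeFn l hl f) hx, hk.inL2.cv_assoc hl.inL2 (Lp.memLp f) hx]

theorem convOp_comm {k l : ℝ → ℂ} (hk : ContinuousOn k (Icc 0 π))
    (hl : ContinuousOn l (Icc 0 π)) : convOp k hk * convOp l hl = convOp l hl * convOp k hk := by
  ext1 f
  refine Lp.ext ?_
  filter_upwards [convOp_coeFn k hk (convOp l hl f), convOp_coeFn l hl (convOp k hk f),
    ae_restrict_mem measurableSet_Ioo] with x h1 h2 hx
  have hx' := Ioo_subset_Icc_self hx
  rw [mul_apply_eq_comp, mul_apply_eq_comp, h1, h2, cv_convOp hk hl f hx', cv_convOp hl hk f hx',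
    funext (cv_comm k l)]

theorem convOp_sub_eq {a b c : ℝ → ℂ} (ha : ContinuousOn a (Icc 0 π))
    (hb : ContinuousOn b (Icc 0 π)) (hc : ContinuousOn c (Icc 0 π)) (z : ℂ)
    (h : ∀ x ∈ Icc (0 : ℝ) π, c x = a x - z * cv a b x) :
    convOp c hc = convOp a ha - z • (convOp a ha * convOp b hb) := by
  ext1 f
  refine Lp.ext ?_
  filter_upwards [convOp_coeFn c hc f, convOp_coeFn a ha f,
    convOp_coeFn a ha (convOp b hb f), ae_restrict_mem measurableSet_Ioo,
    Lp.coeFn_sub (convOp a ha f) (z • convOp a ha (convOp b hb f)),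
    Lp.coeFn_smul z (convOp a ha (convOp b hb f))] with x h1 h2 h3 hx h4 h5
  have hx' := Ioo_subset_Icc_self hx
  change convOp c hc f x = (convOp a ha f - z • convOp a ha (convOp b hb f) : L2Pi) x
  rw [h1, h4, Pi.sub_apply, h5, Pi.smul_apply, h2, h3, cv_convOp ha hb f hx', smul_eq_mul,
    ← cv_smul_left, ← InL2.cv_sub_left (Lp.memLp f) ha.inL2
      ((hb.inL2.continuousOn_cv ha).inL2.const_mul z) hx']
  exact cv_congr_left (ae_eq_of_eqOn_Icc h) hx'

end Operators

/-! ### The Robin operator as a Volterra model and its characteristic function -/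

section RobinModel

variable {M : ℝ → ℂ}

theorem continuousOn_robinSol (hM : IsKernel M) (h : ℂ) :
    ContinuousOn (fun x => 1 + h * fundSol hM x) (Icc 0 π) :=
  continuousOn_const.add (continuousOn_const.mul (continuousOn_fundSol hM))

/-- The solution of `ℓ y = 0`, `y(0) = 1`, `y'(0) = h` as an element of `L₂(0, π)`. -/
def robinSol (hM : IsKernel M) (h : ℂ) : L2Pi := (continuousOn_robinSol hM h).inL2.toLp

/-- The right inverse of `ℓ` with zero Cauchy data at `0`. -/
def robinInv (hM : IsKernel M) : L2Pi →L[ℂ] L2Pi := -convOp (fundSol hM) (continuousOn_fundSol hM)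

/-- The value `y'(π) + H y(π)` for `y = V f`. -/
def robinFunctional (hM : IsKernel M) (H : ℂ) : L2Pi →L[ℂ] ℂ :=
  -convEval (fundDer hM) (continuousOn_fundDer hM)
    - H • convEval (fundSol hM) (continuousOn_fundSol hM)

/-- The value `y'(π) + H y(π)` for `y = 1 + h S₀`. -/
def robinValue (hM : IsKernel M) (h H : ℂ) : ℂ :=
  h * fundDer hM π + H * (1 + h * fundSol hM π)

theorem robinFunctional_apply (hM : IsKernel M) (H : ℂ) (f : L2Pi) :
    robinFunctional hM H f = -cv (fundDer hM) f π - H * cv (fundSol hM) f π := rfl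

theorem robinInv_add_smul_coeFn (hM : IsKernel M) (h : ℂ) (f : L2Pi) (a : ℂ) :
    (robinInv hM f + a • robinSol hM h : L2Pi) =ᵐ[volume.restrict (Ioo (0 : ℝ) π)]
      fun x => a * (1 + h * fundSol hM x) - cv (fundSol hM) f x := by
  filter_upwards [convOp_coeFn _ (continuousOn_fundSol hM) f,
    (continuousOn_robinSol hM h).inL2.coeFn_toLp, Lp.coeFn_add (robinInv hM f) (a • robinSol hM h),
    Lp.coeFn_smul a (robinSol hM h),
    Lp.coeFn_neg (convOp (fundSol hM) (continuousOn_fundSol hM) f)] with x h1 h2 h3 h4 h5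
  have h6 : robinInv hM f x = -(convOp (fundSol hM) (continuousOn_fundSol hM) f x) := h5
  have h7 : robinSol hM h x = 1 + h * fundSol hM x := h2
  rw [h3, Pi.add_apply, h4, Pi.smul_apply, h6, h7, h1, smul_eq_mul]
  ring

theorem cv_fundSol_eq (hM : IsKernel M) {f : ℝ → ℂ} (hf : InL2 f) {x : ℝ}
    (hx : x ∈ Icc (0 : ℝ) π) : cv (fundSol hM) f x = cv (fun _ => 1) (cv (fundDer hM) f) x :=
  inL2_one.cv_assoc (continuousOn_fundDer hM).inL2 hf hx

/-- The inverse of `1 + z S₀ *` is `1 - z S *`: the equation `S = S₀ - z S₀ * S` is exactly the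
resolvent equation. -/
theorem isUnit_robinInv (hM : IsKernel M) (z : ℂ) : IsUnit (1 - z • robinInv hM) := by
  have hS0 := continuousOn_fundSol hM
  have hS := continuousOn_eigenSol hM z
  set A := convOp (fundSol hM) hS0
  set B := convOp (eigenSol hM z) hS
  have h1 : B = A - z • (A * B) := convOp_sub_eq hS0 hS hS z fun x hx => eigenSol_eq hM z hx
  have h2 : A * B = B * A := convOp_comm hS0 hS
  have h3 : 1 - z • robinInv hM = 1 + z • A := by
    rw [robinInv, smul_neg, sub_neg_eq_add]
  have h4 : (1 + z • A) * (1 - z • B) = 1 + z • (A - z • (A * B) - B) := by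
    simp only [mul_sub, add_mul, one_mul, mul_one, smul_mul_assoc, mul_smul_comm, smul_sub,
      smul_add]
    abel
  have h5 : (1 - z • B) * (1 + z • A) = 1 + z • (A - z • (B * A) - B) := by
    simp only [sub_mul, mul_add, one_mul, mul_one, smul_mul_assoc, mul_smul_comm, smul_sub]
    abel
  rw [← h1, sub_self, smul_zero, add_zero] at h4
  rw [← h2, ← h1, sub_self, smul_zero, add_zero] at h5
  rw [h3]
  exact ⟨⟨_, _, h4, h5⟩, rfl⟩

/-- The value at `0` gives `a = 0`. Then `S₀ * f = 1 * (Z * f)`, with `Z = S₀'`, so stripping one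
integration gives `Z * f = 0`; the equation of `Z` turns this into `1 * f = 0`, whence `f = 0`. -/
theorem robinInv_eq_zero (hM : IsKernel M) (h : ℂ) (f : L2Pi) (a : ℂ)
    (hfa : robinInv hM f + a • robinSol hM h = 0) : f = 0 ∧ a = 0 := by
  have hpi := Real.pi_pos
  have hZ := continuousOn_fundDer hM
  have hf : InL2 f := Lp.memLp f
  have hZf := hf.continuousOn_cv hZ
  have h0 := robinInv_add_smul_coeFn hM h f a
  rw [hfa] at h0
  have h1 : EqOn (fun x => a * (1 + h * fundSol hM x) - cv (fundSol hM) f x) 0 (Icc 0 π) := by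
    refine Measure.eqOn_Icc_of_ae_eq volume hpi.ne ?_
      ((continuousOn_const.mul (continuousOn_robinSol hM h)).sub
        (hf.continuousOn_cv (continuousOn_fundSol hM))) continuousOn_const
    rw [← restrict_Ioo_eq_restrict_Icc]
    exact h0.symm.trans (Lp.coeFn_zero _ _ _)
  have ha : a = 0 := by
    have := h1 (left_mem_Icc.2 hpi.le)
    simpa [cv_zero, fundSol] using this
  refine ⟨?_, ha⟩
  have h2 : ∀ x ∈ Icc (0 : ℝ) π, cv (fundDer hM) f x = 0 := by
    apply eqOn_of_cv_one_eq hZf (v := fun _ => 0) continuousOn_const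
    intro x hx
    have h3 := h1 hx
    simp only [ha, zero_mul, zero_sub, Pi.zero_apply, neg_eq_zero] at h3
    rw [← cv_fundSol_eq hM hf hx, h3]
    simp [cv]
  have h4 : f =ᵐ[volume.restrict (Ioo (0 : ℝ) π)] (0 : ℝ → ℂ) := by
    apply eq_zero_of_primitive_eq_zero (hf.intervalIntegrable (right_mem_Icc.2 hpi.le))
    intro x hx
    have h5 := fundDer_cv_eq hM hf hx
    rw [h2 x hx, cv_congr_right (g' := fun _ => 0) (ae_eq_of_eqOn_Icc h2) hx] at h5
    rw [← cv_one_left]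
    simpa [cv] using h5.symm
  exact Lp.ext (h4.trans (Lp.coeFn_zero _ _ _).symm)

/-- Integrated once, `ℓ y = f` is a Volterra equation for `y'`, solved by variation of constants.
The condition at `0` leaves the single parameter `a = y(0)`, and the condition at `π` is the scalar
equation. Conversely the formulas for `y` and `y'` are taken as definitions, with `y'' = M * y' -
f`. -/
theorem mem_robinGraph_iff (hM : IsKernel M) (h H : ℂ) (u f : L2Pi) :
    (u, f) ∈ robinGraph M hM h H ↔ ∃ a : ℂ, u = robinInv hM f + a • robinSol hM h ∧
      robinFunctional hM H f + a * robinValue hM h H = 0 := by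
  have hpi := Real.pi_pos
  have hZ := continuousOn_fundDer hM
  have hf : InL2 f := Lp.memLp f
  have hZf := hf.continuousOn_cv hZ
  have hN := hM.inL2_kerPrim
  constructor
  · rintro ⟨y, dy, ddy, hy, h0, hπ, hu, hfe⟩
    simp only at hu hfe
    have hB := hM.inL2_cv hy.continuousOn_dy
    have h1 : ∀ x ∈ Icc (0 : ℝ) π, dy x = dy 0 + cv (kerPrim M) dy x - cv (fun _ => 1) f x := by
      intro x hx
      rw [hM.kerPrim_cv hy.continuousOn_dy hx, add_sub_assoc,
        ← inL2_one.cv_sub_right hB hf hx, hy.dy_eq x hx, ← cv_one_left]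
      congr 1
      apply cv_congr_right _ hx
      filter_upwards [hfe] with t ht
      rw [ht, ell, cv]
      ring
    have h2 := eq_of_volterra hM hy.continuousOn_dy hf h1
    have h3 : ∀ x ∈ Icc (0 : ℝ) π,
        y x = y 0 * (1 + h * fundSol hM x) - cv (fundSol hM) f x := by
      intro x hx
      have h4 : cv (fun _ => 1) dy x = dy 0 * fundSol hM x - cv (fundSol hM) f x := by
        rw [cv_fundSol_eq hM hf hx, cv_congr_right (ae_eq_of_eqOn_Icc h2) hx,
          inL2_one.cv_sub_right (hZ.inL2.const_mul _) hZf.inL2 hx, cv_smul_right]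
        rfl
      rw [hy.y_eq x hx, ← cv_one_left, h4]
      linear_combination fundSol hM x * h0
    refine ⟨y 0, ?_, ?_⟩
    · apply Lp.ext
      exact hu.trans ((ae_eq_of_eqOn_Icc h3).trans (robinInv_add_smul_coeFn hM h f (y 0)).symm)
    · have h4 := h2 π (right_mem_Icc.2 hpi.le)
      have h5 := h3 π (right_mem_Icc.2 hpi.le)
      rw [robinFunctional_apply, robinValue, ← hπ, h4, h5]
      linear_combination -fundDer hM π * h0
  · rintro ⟨a, rfl, h0⟩
    set y : ℝ → ℂ := fun x => a * (1 + h * fundSol hM x) - cv (fundSol hM) f x with hy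
    set dy : ℝ → ℂ := fun x => a * h * fundDer hM x - cv (fundDer hM) f x with hdy
    have hdyc : ContinuousOn dy (Icc 0 π) := (continuousOn_const.mul hZ).sub hZf
    have hB := hM.inL2_cv hdyc
    have hy0 : y 0 = a := by simp [hy, fundSol, cv_zero]
    have hdy0 : dy 0 = a * h := by simp [hdy, cv_zero, fundDer_zero]
    refine ⟨y, dy, fun x => cv M dy x - f x, ⟨hB.sub hf, ?_, ?_⟩, ?_, ?_,
      robinInv_add_smul_coeFn hM h f a, ?_⟩
    · intro x hx
      have h1 : cv (kerPrim M) dy x = a * h * cv (kerPrim M) (fundDer hM) x -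
          cv (kerPrim M) (cv (fundDer hM) f) x := by
        rw [hdy, hN.cv_sub_right (hZ.inL2.const_mul _) hZf.inL2 hx, cv_smul_right]
      rw [← cv_one_left, inL2_one.cv_sub_right hB hf hx, ← hM.kerPrim_cv hdyc hx, h1, hdy0]
      have h2 := fundDer_eq hM hx
      have h3 := fundDer_cv_eq hM hf hx
      rw [hdy]
      linear_combination a * h * h2 - h3
    · intro x hx
      have h1 : cv (fun _ => 1) dy x = a * h * fundSol hM x - cv (fundSol hM) f x := by
        rw [hdy, inL2_one.cv_sub_right (hZ.inL2.const_mul _) hZf.inL2 hx, cv_smul_right,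
          ← cv_fundSol_eq hM hf hx]
        rfl
      rw [← cv_one_left, h1, hy0, hy]
      ring
    · rw [hy0, hdy0]; ring
    · rw [robinFunctional_apply, robinValue] at h0
      rw [hy, hdy]
      linear_combination h0
    · refine Filter.Eventually.of_forall fun x => ?_
      simp only [ell, cv]
      ring

theorem isVolterraModel_robinOperator (hM : IsKernel M) (h H : ℂ) :
    IsVolterraModel (robinOperator M hM h H) (robinInv hM) (robinSol hM h)
      (robinFunctional hM H) (robinValue hM h H) where
  mem_graph u f := by rw [robinOperator_graph, mem_robinGraph_iff]
  isUnit := isUnit_robinInv hM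
  eq_zero f a := robinInv_eq_zero hM h f a

/-- The characteristic function of `L(M, h, H)`. -/
def robinDet (hM : IsKernel M) (h H : ℂ) : ℂ → ℂ :=
  charDet (robinInv hM) (robinSol hM h) (robinFunctional hM H) (robinValue hM h H)

/-- The vector `(1 - z V)⁻¹ φ` is the solution `1 - z ∫ S + h S` of `ℓ y = z y` with `y(0) = 1`,
`y'(0) = h`; the characteristic function is the value of `y'(π) + H y(π)` on it. -/
theorem robinDet_eq (hM : IsKernel M) (h H z : ℂ) :
    robinDet hM h H z = -z * eigenSol hM z π + H * (1 - z * cv (fun _ => 1) (eigenSol hM z) π)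
      + h * eigenDer hM z π + h * H * eigenSol hM z π := by
  have hmodel := isVolterraModel_robinOperator hM h H
  have hZ := continuousOn_fundDer hM
  have hS := continuousOn_eigenSol hM z
  have hS0 := continuousOn_fundSol hM
  have h1S := hS.inL2.continuousOn_cv continuousOn_one_Icc
  set φ : ℝ → ℂ := fun x => 1 - z * cv (fun _ => 1) (eigenSol hM z) x + h * eigenSol hM z x with hφ
  have hφc : ContinuousOn φ (Icc 0 π) :=
    (continuousOn_const.sub (continuousOn_const.mul h1S)).add (continuousOn_const.mul hS)
  -- `Z * φ` and `S₀ * φ`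
  have hZφ : ∀ x ∈ Icc (0 : ℝ) π, cv (fundDer hM) φ x =
      eigenSol hM z x + h * cv (fundDer hM) (eigenSol hM z) x := by
    intro x hx
    have h1 : cv (fundDer hM) φ x = cv (fundDer hM) (fun _ => 1) x -
        z * cv (fundDer hM) (cv (fun _ => 1) (eigenSol hM z)) x +
        h * cv (fundDer hM) (eigenSol hM z) x := by
      rw [hφ, hZ.inL2.cv_add_right (g := fun x => 1 - z * cv (fun _ => 1) (eigenSol hM z) x)
        (inL2_one.sub (h1S.inL2.const_mul z)) (hS.inL2.const_mul h) hx,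
        hZ.inL2.cv_sub_right inL2_one (h1S.inL2.const_mul z) hx, cv_smul_right, cv_smul_right]
    have h2 := eigenSol_eq hM z hx
    have h3 : cv (fundDer hM) (fun _ => 1) x = fundSol hM x := cv_comm _ _ _
    have h4 : cv (fundDer hM) (cv (fun _ => 1) (eigenSol hM z)) x =
        cv (fundSol hM) (eigenSol hM z) x := by
      rw [← hZ.inL2.cv_assoc inL2_one hS.inL2 hx, funext (cv_comm (fundDer hM) fun _ => 1)]
      rfl
    rw [h1, h3, h4]
    linear_combination -h2
  have hSφ : ∀ x ∈ Icc (0 : ℝ) π, cv (fundSol hM) φ x =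
      cv (fun _ => 1) (eigenSol hM z) x + h * cv (fundSol hM) (eigenSol hM z) x := by
    intro x hx
    rw [cv_fundSol_eq hM hφc.inL2 hx, cv_congr_right (ae_eq_of_eqOn_Icc hZφ) hx,
      inL2_one.cv_add_right hS.inL2 ((hS.inL2.continuousOn_cv hZ).inL2.const_mul h) hx,
      cv_smul_right, ← cv_fundSol_eq hM hS.inL2 hx]
  have hinv : volterraInv (robinInv hM) z (robinSol hM h) = hφc.inL2.toLp := by
    have h1 : (1 - z • robinInv hM) hφc.inL2.toLp = robinSol hM h := by
      apply Lp.ext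
      have h2 : (1 - z • robinInv hM) hφc.inL2.toLp =
          hφc.inL2.toLp + z • convOp (fundSol hM) hS0 hφc.inL2.toLp := by
        simp [robinInv]
      rw [h2]
      filter_upwards [Lp.coeFn_add hφc.inL2.toLp (z • convOp (fundSol hM) hS0 hφc.inL2.toLp),
        Lp.coeFn_smul z (convOp (fundSol hM) hS0 hφc.inL2.toLp), hφc.inL2.coeFn_toLp,
        convOp_coeFn (fundSol hM) hS0 hφc.inL2.toLp, ae_restrict_mem measurableSet_Ioo,
        (continuousOn_robinSol hM h).inL2.coeFn_toLp] with x h3 h4 h5 h6 hx h7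
      have hx' := Ioo_subset_Icc_self hx
      have h8 : robinSol hM h x = 1 + h * fundSol hM x := h7
      rw [h3, Pi.add_apply, h4, Pi.smul_apply, h5, h6, h8,
        cv_congr_right hφc.inL2.coeFn_toLp hx', hSφ x hx', smul_eq_mul, hφ]
      linear_combination h * eigenSol_eq hM z hx'
    rw [← h1]
    have := congrArg (fun T : L2Pi →L[ℂ] L2Pi => T hφc.inL2.toLp) (hmodel.inv_mul z)
    simpa only [mul_apply_eq_comp, one_apply_eq_self] using this
  have hπ := right_mem_Icc.2 Real.pi_pos.le
  rw [robinDet, charDet, hinv, robinFunctional_apply, robinValue,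
    cv_congr_right hφc.inL2.coeFn_toLp hπ, cv_congr_right hφc.inL2.coeFn_toLp hπ,
    hZφ π hπ, hSφ π hπ, eigenDer]
  linear_combination -H * h * eigenSol_eq hM z hπ

end RobinModel

/-! ### Duhamel's formula and the main term of the remainder -/

section Duhamel

variable {M : ℝ → ℂ}

/-- The function `t ↦ sin ρt`. -/
def sinFun (ρ : ℂ) (t : ℝ) : ℂ := Complex.sin (ρ * t)

/-- The function `t ↦ cos ρt`. -/
def cosFun (ρ : ℂ) (t : ℝ) : ℂ := Complex.cos (ρ * t)

theorem continuous_sinFun (ρ : ℂ) : Continuous (sinFun ρ) := by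
  unfold sinFun; fun_prop

theorem continuous_cosFun (ρ : ℂ) : Continuous (cosFun ρ) := by
  unfold cosFun; fun_prop

theorem continuousOn_sinFun (ρ : ℂ) : ContinuousOn (sinFun ρ) (Icc 0 π) :=
  (continuous_sinFun ρ).continuousOn

theorem continuousOn_cosFun (ρ : ℂ) : ContinuousOn (cosFun ρ) (Icc 0 π) :=
  (continuous_cosFun ρ).continuousOn

theorem mul_cv_one_cosFun {ρ : ℂ} (hρ : ρ ≠ 0) (x : ℝ) :
    ρ * cv (fun _ => 1) (cosFun ρ) x = sinFun ρ x := by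
  rw [cv_one_left]
  unfold cosFun sinFun
  rw [integral_cos_mul_complex hρ]
  simp
  field_simp

theorem mul_cv_one_sinFun (ρ : ℂ) (x : ℝ) :
    ρ * cv (fun _ => 1) (sinFun ρ) x = 1 - cosFun ρ x := by
  rw [cv_one_left]
  unfold cosFun sinFun
  have h : ∀ t : ℝ, HasDerivAt (fun t : ℝ => -Complex.cos (ρ * t)) (ρ * Complex.sin (ρ * t)) t := by
    intro t
    have h1 : HasDerivAt (fun t : ℝ => ρ * (t : ℂ)) ρ t := by
      simpa using (Complex.ofRealCLM.hasDerivAt (x := t)).const_mul ρ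
    have h2 := ((Complex.hasDerivAt_cos (ρ * t)).comp t h1).neg
    exact h2.congr_deriv (by ring)
  rw [← intervalIntegral.integral_const_mul,
    intervalIntegral.integral_eq_sub_of_hasDerivAt (fun t _ => h t)
      (by apply Continuous.intervalIntegrable; fun_prop)]
  simp
  ring

/-- By the addition theorem the sum of `cos * sin` and `sin * cos` has an integrand constant in `t`.
The resulting factor `x` is what later compensates the singularity of `M`. -/
theorem cv_cosFun_sinFun (ρ : ℂ) (x : ℝ) :
    cv (cosFun ρ) (sinFun ρ) x = x / 2 * sinFun ρ x := by
  have h1 : cv (cosFun ρ) (sinFun ρ) x + cv (sinFun ρ) (cosFun ρ) x = x * sinFun ρ x := by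
    have := continuous_sinFun ρ
    have := continuous_cosFun ρ
    rw [cv, cv, ← intervalIntegral.integral_add (by apply Continuous.intervalIntegrable; fun_prop)
      (by apply Continuous.intervalIntegrable; fun_prop)]
    have h2 : ∀ t : ℝ, cosFun ρ (x - t) * sinFun ρ t + sinFun ρ (x - t) * cosFun ρ t =
        sinFun ρ x := by
      intro t
      unfold cosFun sinFun
      rw [add_comm, ← Complex.sin_add]
      congr 1
      push_cast
      ring
    simp only [h2]
    simp
  rw [cv_comm (sinFun ρ)] at h1
  linear_combination h1 / 2

theorem norm_sin_le_exp (w : ℂ) : ‖Complex.sin w‖ ≤ Real.exp |w.im| := by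
  have h1 : ‖Complex.exp (-w * Complex.I)‖ ≤ Real.exp |w.im| := by
    rw [Complex.norm_exp]
    simpa using le_abs_self w.im
  have h2 : ‖Complex.exp (w * Complex.I)‖ ≤ Real.exp |w.im| := by
    rw [Complex.norm_exp]
    simpa using neg_le_abs w.im
  rw [Complex.sin]
  rw [norm_div, norm_mul, Complex.norm_I, mul_one]
  have h3 := norm_sub_le (Complex.exp (-w * Complex.I)) (Complex.exp (w * Complex.I))
  rw [Complex.norm_two, div_le_iff₀ two_pos]
  linarith

theorem norm_cos_le_exp (w : ℂ) : ‖Complex.cos w‖ ≤ Real.exp |w.im| := by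
  have h1 : ‖Complex.exp (-w * Complex.I)‖ ≤ Real.exp |w.im| := by
    rw [Complex.norm_exp]
    simpa using le_abs_self w.im
  have h2 : ‖Complex.exp (w * Complex.I)‖ ≤ Real.exp |w.im| := by
    rw [Complex.norm_exp]
    simpa using neg_le_abs w.im
  rw [Complex.cos, norm_div]
  have h3 := norm_add_le (Complex.exp (w * Complex.I)) (Complex.exp (-w * Complex.I))
  rw [Complex.norm_two, div_le_iff₀ two_pos]
  linarith

theorem abs_im_mul_ofReal (ρ : ℂ) {t : ℝ} (ht : 0 ≤ t) : |(ρ * t).im| = |ρ.im| * t := by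
  simp [abs_mul, abs_of_nonneg ht]

theorem norm_sinFun_le (ρ : ℂ) {t : ℝ} (ht : 0 ≤ t) : ‖sinFun ρ t‖ ≤ Real.exp (|ρ.im| * t) := by
  rw [← abs_im_mul_ofReal ρ ht]
  exact norm_sin_le_exp _

theorem norm_cosFun_le (ρ : ℂ) {t : ℝ} (ht : 0 ≤ t) : ‖cosFun ρ t‖ ≤ Real.exp (|ρ.im| * t) := by
  rw [← abs_im_mul_ofReal ρ ht]
  exact norm_cos_le_exp _

/-- The convolution `M * S'(·, ρ²)`. -/
def memTerm (hM : IsKernel M) (ρ : ℂ) : ℝ → ℂ := cv M (eigenDer hM (ρ ^ 2))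

/-- The remainder `ρ S(·, ρ²) - sin ρ·`. -/
def sinRem (hM : IsKernel M) (ρ : ℂ) : ℝ → ℂ := cv (sinFun ρ) (memTerm hM ρ)

/-- The first approximation of `sinRem`. -/
def sinRemMain (M : ℝ → ℂ) (ρ : ℂ) : ℝ → ℂ := cv M (cv (cosFun ρ) (sinFun ρ))

theorem inL2_memTerm (hM : IsKernel M) (ρ : ℂ) : InL2 (memTerm hM ρ) :=
  hM.inL2_cv (continuousOn_eigenDer hM _)

theorem continuousOn_sinRem (hM : IsKernel M) (ρ : ℂ) : ContinuousOn (sinRem hM ρ) (Icc 0 π) :=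
  (inL2_memTerm hM ρ).continuousOn_cv (continuousOn_sinFun ρ)

theorem continuousOn_cv_cosFun_memTerm (hM : IsKernel M) (ρ : ℂ) :
    ContinuousOn (cv (cosFun ρ) (memTerm hM ρ)) (Icc 0 π) :=
  (inL2_memTerm hM ρ).continuousOn_cv (continuousOn_cosFun ρ)

/-- Duhamel's formula for `S'' + ρ² S = M * S'`. To avoid differentiation, `cos * S'` is computed
twice, from `S = 1 * S'` and from the integrated equation for `S'`, and then eliminated. -/
theorem mul_eigenSol_eq (hM : IsKernel M) {ρ : ℂ} (hρ : ρ ≠ 0) {x : ℝ} (hx : x ∈ Icc (0 : ℝ) π) :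
    ρ * eigenSol hM (ρ ^ 2) x = sinFun ρ x + sinRem hM ρ x := by
  set S := eigenSol hM (ρ ^ 2) with hSdef
  set T := eigenDer hM (ρ ^ 2) with hTdef
  set B := memTerm hM ρ with hB
  have hS2 : InL2 S := (continuousOn_eigenSol hM _).inL2
  have hT2 : InL2 T := (continuousOn_eigenDer hM _).inL2
  have hB2 : InL2 B := inL2_memTerm hM ρ
  have hc2 : InL2 (cosFun ρ) := (continuousOn_cosFun ρ).inL2
  have hs2 : InL2 (sinFun ρ) := (continuousOn_sinFun ρ).inL2
  have h1 : cv (cosFun ρ) T x = S x - ρ * cv (sinFun ρ) S x := by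
    have h2 : cosFun ρ = fun t => 1 - ρ * cv (fun _ => 1) (sinFun ρ) t := by
      funext t; rw [mul_cv_one_sinFun]; ring
    have h3 : InL2 (cv (fun _ => 1) (sinFun ρ)) := (hs2.continuousOn_cv continuousOn_one_Icc).inL2
    have h4 : cv (sinFun ρ) S x = cv (sinFun ρ) (cv (fun _ => 1) T) x :=
      cv_congr_right (ae_eq_of_eqOn_Icc fun t ht => eigenSol_eq_cv_one hM _ ht) hx
    rw [h2, hT2.cv_sub_left inL2_one (h3.const_mul ρ) hx, cv_smul_left,
      ← eigenSol_eq_cv_one hM _ hx, funext (cv_comm (fun _ => 1) (sinFun ρ)),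
      hs2.cv_assoc inL2_one hT2 hx, h4]
  have h5 : ρ * cv (cosFun ρ) T x =
      sinFun ρ x + cv (sinFun ρ) B x - ρ ^ 2 * cv (sinFun ρ) S x := by
    have hi : InL2 (cv (fun _ => 1) B) := (hB2.continuousOn_cv continuousOn_one_Icc).inL2
    have hi' : InL2 (cv (fun _ => 1) S) := (hS2.continuousOn_cv continuousOn_one_Icc).inL2
    have h6 : cv (cosFun ρ) T x = cv (cosFun ρ) (fun t => 1 + cv (fun _ => 1) B t -
        ρ ^ 2 * cv (fun _ => 1) S t) x :=
      cv_congr_right (ae_eq_of_eqOn_Icc fun t ht => eigenDer_eq hM _ ht) hx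
    have h7 : ∀ {f : ℝ → ℂ}, InL2 f → ρ * cv (cosFun ρ) (cv (fun _ => 1) f) x =
        cv (sinFun ρ) f x := by
      intro f hf
      rw [← hc2.cv_assoc inL2_one hf hx, ← cv_smul_left]
      congr 1
      funext t
      rw [cv_comm, mul_cv_one_cosFun hρ]
    have hi1 : InL2 fun t => 1 + cv (fun _ => 1) B t := inL2_one.add hi
    rw [h6, hc2.cv_sub_right hi1 (hi'.const_mul _) hx,
      hc2.cv_add_right inL2_one hi hx, cv_smul_right, cv_comm (cosFun ρ) (fun _ => 1)]
    linear_combination mul_cv_one_cosFun hρ x + h7 hB2 - ρ ^ 2 * h7 hS2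
  rw [h1] at h5
  rw [sinRem]
  linear_combination h5

theorem eigenDer_eq_cosFun_add (hM : IsKernel M) {ρ : ℂ} (hρ : ρ ≠ 0) {x : ℝ}
    (hx : x ∈ Icc (0 : ℝ) π) :
    eigenDer hM (ρ ^ 2) x = cosFun ρ x + cv (cosFun ρ) (memTerm hM ρ) x := by
  have hB2 : InL2 (memTerm hM ρ) := inL2_memTerm hM ρ
  have hc2 : InL2 (cosFun ρ) := (continuousOn_cosFun ρ).inL2
  have hcB := continuousOn_cv_cosFun_memTerm hM ρ
  refine eqOn_of_cv_one_eq (continuousOn_eigenDer hM _) ((continuousOn_cosFun ρ).add hcB)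
    (fun y hy => ?_) x hx
  have h0 : cv (fun _ => 1) (fun t => cosFun ρ t + cv (cosFun ρ) (memTerm hM ρ) t) y =
      cv (fun _ => 1) (cosFun ρ) y + cv (fun _ => 1) (cv (cosFun ρ) (memTerm hM ρ)) y :=
    inL2_one.cv_add_right hc2 hcB.inL2 hy
  have h1 : sinRem hM ρ y = ρ * cv (fun _ => 1) (cv (cosFun ρ) (memTerm hM ρ)) y := by
    rw [← inL2_one.cv_assoc hc2 hB2 hy, ← cv_smul_left, sinRem]
    congr 1
    funext t
    rw [mul_cv_one_cosFun hρ]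
  apply mul_left_cancel₀ hρ
  change _ = ρ * cv (fun _ => 1) (fun t => cosFun ρ t + cv (cosFun ρ) (memTerm hM ρ) t) y
  rw [h0, mul_add, mul_cv_one_cosFun hρ, ← h1, ← eigenSol_eq_cv_one hM _ hy,
    mul_eigenSol_eq hM hρ hy]

theorem continuousOn_sinRemMain (hM : IsKernel M) (ρ : ℂ) :
    ContinuousOn (sinRemMain M ρ) (Icc 0 π) := by
  refine ((hM.inL2_cv (continuousOn_cosFun ρ)).continuousOn_cv
    (continuousOn_sinFun ρ)).congr fun x hx => ?_
  rw [cv_comm, hM.cv_assoc (continuousOn_cosFun ρ) (continuousOn_sinFun ρ).inL2 hx]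
  rfl

/-- Inserting `S' = cos + cos * B` into `B = M * S'` lets `M * cos * sin` appear both as the free
term and as the kernel acting on `B`. Estimates of this one function therefore control the whole
remainder. -/
theorem sinRem_eq (hM : IsKernel M) {ρ : ℂ} (hρ : ρ ≠ 0) {x : ℝ} (hx : x ∈ Icc (0 : ℝ) π) :
    sinRem hM ρ x = sinRemMain M ρ x + cv (sinRemMain M ρ) (memTerm hM ρ) x := by
  have hB2 : InL2 (memTerm hM ρ) := inL2_memTerm hM ρ
  have hc := continuousOn_cosFun ρ
  have hs := continuousOn_sinFun ρ
  have hcB := continuousOn_cv_cosFun_memTerm hM ρ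
  have hcs : ContinuousOn (cv (cosFun ρ) (sinFun ρ)) (Icc 0 π) := hs.inL2.continuousOn_cv hc
  have h1 : memTerm hM ρ =ᵐ[volume.restrict (Ioo (0 : ℝ) π)]
      fun t => cv M (cosFun ρ) t + cv M (cv (cosFun ρ) (memTerm hM ρ)) t := by
    filter_upwards [ae_restrict_mem measurableSet_Ioo] with t ht
    rw [← cv_add_right (hM.intervalIntegrable_mul hc ht) (hM.intervalIntegrable_mul hcB ht)]
    exact cv_congr_right (ae_eq_of_eqOn_Icc fun u hu => eigenDer_eq_cosFun_add hM hρ hu)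
      (Ioo_subset_Icc_self ht)
  have h2 : cv (cv M (cv (cosFun ρ) (memTerm hM ρ))) (sinFun ρ) x =
      cv (sinRemMain M ρ) (memTerm hM ρ) x := by
    rw [hM.cv_assoc hcB hs.inL2 hx, sinRemMain, hM.cv_assoc hcs hB2 hx]
    refine cv_congr_right (ae_eq_of_eqOn_Icc fun u hu => ?_) hx
    rw [funext (cv_comm (cosFun ρ) (memTerm hM ρ)), hB2.cv_assoc hc.inL2 hs.inL2 hu, cv_comm]
  rw [sinRem, cv_congr_right h1 hx, hs.inL2.cv_add_right (hM.inL2_cv hc) (hM.inL2_cv hcB) hx,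
    cv_comm, hM.cv_assoc hc hs.inL2 hx, cv_comm (sinFun ρ), h2]
  rfl

end Duhamel

/-! ### Exponential bounds and decay off the real axis -/

section Bounds

variable {M : ℝ → ℂ}

/-- Let `A` be the maximum of `|S'(x)| exp(-(τ + σ)x)` with `τ = |Im ρ|`. A weight `σ` independent
of `ρ` makes the term `cos * (M * S')` contribute at most `A / 2`, so `A ≤ 2`; the factor `exp(σx)`
is absorbed into `K`. -/
theorem exists_norm_eigenDer_le (hM : IsKernel M) : ∃ K : ℝ, 0 ≤ K ∧ ∀ ρ : ℂ, ρ ≠ 0 →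
    ∀ x ∈ Icc (0 : ℝ) π, ‖eigenDer hM (ρ ^ 2) x‖ ≤ K * Real.exp (|ρ.im| * x) := by
  obtain ⟨σ, hσ0, hσ⟩ := exists_integral_norm_comp_sub_left_mul_exp_le hM.inL2_kerInt
    (ε := 1 / 2) (by norm_num)
  refine ⟨2 * Real.exp (σ * π), by positivity, fun ρ hρ x hx => ?_⟩
  set τ := |ρ.im| with hτ
  set T := eigenDer hM (ρ ^ 2) with hT
  have hTc : ContinuousOn T (Icc 0 π) := continuousOn_eigenDer hM _
  obtain ⟨y, hy, hmax⟩ := isCompact_Icc.exists_isMaxOn (nonempty_Icc.2 Real.pi_pos.le)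
    (f := fun t => ‖T t‖ * Real.exp (-(τ + σ) * t)) (hTc.norm.mul (by fun_prop))
  set A := ‖T y‖ * Real.exp (-(τ + σ) * y) with hA
  have hTA : ∀ t ∈ Icc (0 : ℝ) π, ‖T t‖ ≤ A * Real.exp ((τ + σ) * t) := by
    intro t ht
    have h1 : ‖T t‖ * Real.exp (-(τ + σ) * t) ≤ A := hmax ht
    have h2 : Real.exp (-(τ + σ) * t) * Real.exp ((τ + σ) * t) = 1 := by
      rw [← Real.exp_add, ← add_mul]; simp
    calc ‖T t‖ = ‖T t‖ * Real.exp (-(τ + σ) * t) * Real.exp ((τ + σ) * t) := by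
          rw [mul_assoc, h2, mul_one]
      _ ≤ _ := mul_le_mul_of_nonneg_right h1 (Real.exp_pos _).le
  have hA0 : 0 ≤ A := by positivity
  have hτ0 : 0 ≤ τ := abs_nonneg _
  have hB : ∀ t ∈ Ioo (0 : ℝ) π, ‖memTerm hM ρ t‖ ≤ A * Real.exp ((τ + σ) * t) * kerInt M t := by
    intro t ht
    refine hM.norm_cv_le hTc ht fun s hs => (hTA s ⟨hs.1, hs.2.trans ht.2.le⟩).trans ?_
    gcongr
    exact hs.2
  have hA2 : A ≤ 1 + A * (1 / 2) := by
    have h1 : ‖T y‖ ≤ Real.exp (τ * y) + ‖cv (cosFun ρ) (memTerm hM ρ) y‖ := by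
      rw [hT, eigenDer_eq_cosFun_add hM hρ hy]
      exact (norm_add_le _ _).trans (add_le_add_left (norm_cosFun_le ρ hy.1) _)
    have h2 : ‖cv (cosFun ρ) (memTerm hM ρ) y‖ ≤
        A * Real.exp ((τ + σ) * y) * ∫ t in Ioo 0 y, ‖kerInt M (y - t)‖ * Real.exp (-σ * t) := by
      rw [cv_comm, cv, intervalIntegral.integral_of_le hy.1, integral_Ioc_eq_integral_Ioo,
        ← integral_const_mul]
      have h3 : Integrable (fun t => ‖kerInt M (y - t)‖ * Real.exp (-σ * t))
          (volume.restrict (Ioo 0 y)) := by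
        have := InL2.intervalIntegrable_conv hM.inL2_kerInt.norm
          (ContinuousOn.inL2 (by fun_prop) : InL2 fun t : ℝ => Real.exp (-σ * t)) hy
        rwa [intervalIntegrable_iff_integrableOn_Ioo_of_le hy.1] at this
      refine norm_integral_le_of_norm_le (h3.const_mul _) ?_
      filter_upwards [ae_restrict_mem measurableSet_Ioo] with t ht
      have ht' : y - t ∈ Ioo 0 π := ⟨by linarith [ht.2], by linarith [ht.1, hy.2]⟩
      have hk := kerInt_nonneg M ht'.1.le
      rw [norm_mul, Real.norm_of_nonneg hk]
      refine (mul_le_mul (hB _ ht') (norm_cosFun_le ρ ht.1.le) (norm_nonneg _)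
        (by positivity)).trans (le_of_eq ?_)
      have h4 : Real.exp ((τ + σ) * (y - t)) * Real.exp (τ * t) =
          Real.exp ((τ + σ) * y) * Real.exp (-σ * t) := by
        rw [← Real.exp_add, ← Real.exp_add]; congr 1; ring
      linear_combination A * kerInt M (y - t) * h4
    have h5 : Real.exp ((τ + σ) * y) * Real.exp (-(τ + σ) * y) = 1 := by
      rw [← Real.exp_add, ← add_mul]; simp
    have h6 : Real.exp (τ * y) * Real.exp (-(τ + σ) * y) ≤ 1 := by
      rw [← Real.exp_add, Real.exp_le_one_iff]
      nlinarith [hy.1]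
    have h7 := h2.trans (mul_le_mul_of_nonneg_left (hσ y hy) (by positivity))
    calc A ≤ (Real.exp (τ * y) + A * Real.exp ((τ + σ) * y) * (1 / 2)) *
          Real.exp (-(τ + σ) * y) := by
          rw [hA]
          exact mul_le_mul_of_nonneg_right (h1.trans (by linarith)) (Real.exp_pos _).le
      _ ≤ _ := by linear_combination h6 + A * (1 / 2) * h5
  have hA3 : A ≤ 2 := by linarith
  refine (hTA x hx).trans ?_
  rw [add_mul, Real.exp_add, mul_comm (Real.exp (τ * x)), ← mul_assoc]
  gcongr
  exact hx.2

theorem exists_norm_memTerm_le (hM : IsKernel M) : ∃ K : ℝ, 0 ≤ K ∧ ∀ ρ : ℂ, ρ ≠ 0 →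
    ∀ x ∈ Ioo (0 : ℝ) π, ‖memTerm hM ρ x‖ ≤ K * Real.exp (|ρ.im| * x) * kerInt M x := by
  obtain ⟨K, hK0, hK⟩ := exists_norm_eigenDer_le hM
  refine ⟨K, hK0, fun ρ hρ x hx => ?_⟩
  refine hM.norm_cv_le (continuousOn_eigenDer hM _) hx fun s hs =>
    (hK ρ hρ s ⟨hs.1, hs.2.trans hx.2.le⟩).trans ?_
  gcongr
  exact hs.2

/-- The kernel of the representation of `sinRemMain M ρ x` as a convolution with `sin ρ·`. -/
def truncKernel (M : ℝ → ℂ) (x : ℝ) : ℝ → ℂ :=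
  (Ioo (0 : ℝ) x).indicator fun r => ((x - r : ℝ) : ℂ) / 2 * M r

/-- The factor `x - r` is at most `π - r`, so the hypothesis on `M` bounds all truncations
simultaneously, uniformly in `x`. -/
theorem norm_truncKernel_le (M : ℝ → ℂ) {x : ℝ} (hx : x ∈ Icc (0 : ℝ) π) (r : ℝ) :
    ‖truncKernel M x r‖ ≤ ‖((π - r : ℝ) : ℂ) * M r‖ := by
  by_cases hr : r ∈ Ioo 0 x
  · rw [truncKernel, indicator_of_mem hr, norm_mul, norm_mul, norm_div, Complex.norm_real,
      Complex.norm_real, Real.norm_of_nonneg (by linarith [hr.2]),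
      Real.norm_of_nonneg (by linarith [hr.2, hx.2])]
    gcongr
    norm_num
    linarith [hr.2, hx.2]
  · rw [truncKernel, indicator_of_notMem hr, norm_zero]
    positivity

theorem IsKernel.inL2_truncKernel (hM : IsKernel M) {x : ℝ} (hx : x ∈ Icc (0 : ℝ) π) :
    InL2 (truncKernel M x) := by
  have h1 : AEStronglyMeasurable (truncKernel M x) (volume.restrict (Ioo (0 : ℝ) π)) := by
    apply AEStronglyMeasurable.indicator _ measurableSet_Ioo
    apply AEStronglyMeasurable.mul _ hM.aestronglyMeasurable
    exact Continuous.aestronglyMeasurable (by fun_prop)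
  exact MemLp.of_le hM h1 (ae_of_all _ fun r => norm_truncKernel_le M hx r)

theorem sinRemMain_eq (M : ℝ → ℂ) (ρ : ℂ) {x : ℝ} (hx : 0 ≤ x) :
    sinRemMain M ρ x = cv (truncKernel M x) (sinFun ρ) x := by
  rw [sinRemMain, cv, cv, intervalIntegral.integral_of_le hx, intervalIntegral.integral_of_le hx,
    integral_Ioc_eq_integral_Ioo, integral_Ioc_eq_integral_Ioo]
  refine setIntegral_congr_fun measurableSet_Ioo fun t ht => ?_
  rw [cv_cosFun_sinFun, truncKernel,
    indicator_of_mem (show x - t ∈ Ioo 0 x from ⟨by linarith [ht.2], by linarith [ht.1]⟩),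
    sub_sub_cancel]
  ring

theorem norm_sinRemMain_le (hM : IsKernel M) (ρ : ℂ) {x : ℝ} (hx : x ∈ Icc (0 : ℝ) π) :
    ‖sinRemMain M ρ x‖ ≤ Real.exp (|ρ.im| * x) *
      ∫ t in Ioo 0 π, ‖((π - t : ℝ) : ℂ) * M t‖ * Real.exp (-|ρ.im| * t) := by
  rw [sinRemMain_eq M ρ hx.1, cv_comm, cv, intervalIntegral.integral_of_le hx.1,
    integral_Ioc_eq_integral_Ioo, ← integral_const_mul]
  have hE : InL2 fun t : ℝ => Real.exp (-|ρ.im| * t) := ContinuousOn.inL2 (by fun_prop)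
  have hint : IntegrableOn (fun t => Real.exp (|ρ.im| * x) *
      (‖((π - t : ℝ) : ℂ) * M t‖ * Real.exp (-|ρ.im| * t))) (Ioo 0 π) :=
    (MemLp.integrable_mul (MemLp.norm hM) hE).const_mul _
  refine (norm_integral_le_of_norm_le (hint.mono_set (Ioo_subset_Ioo_right hx.2)) ?_).trans
    (setIntegral_mono_set hint (ae_of_all _ fun t => by positivity)
      (Ioo_subset_Ioo_right hx.2).eventuallyLE)
  filter_upwards [ae_restrict_mem measurableSet_Ioo] with t ht
  rw [norm_mul]
  refine (mul_le_mul (norm_sinFun_le ρ (by linarith [ht.2])) (norm_truncKernel_le M hx t)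
    (norm_nonneg _) (by positivity)).trans (le_of_eq ?_)
  have h4 : Real.exp (|ρ.im| * (x - t)) = Real.exp (|ρ.im| * x) * Real.exp (-|ρ.im| * t) := by
    rw [← Real.exp_add]; congr 1; ring
  rw [h4]
  ring

/-- For large `|Im ρ|` the exponential weight makes `sinRemMain` at most `δ exp(|Im ρ| x)`. Its
convolution with `memTerm` costs a further factor `K W`, which explains `δ = ε / (1 + K W)`. -/
theorem exists_norm_sinRem_le (hM : IsKernel M) {ε : ℝ} (hε : 0 < ε) : ∃ τ₀ : ℝ, 0 ≤ τ₀ ∧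
    ∀ ρ : ℂ, τ₀ < |ρ.im| → ∀ x ∈ Icc (0 : ℝ) π, ‖sinRem hM ρ x‖ ≤ ε * Real.exp (|ρ.im| * x) := by
  obtain ⟨K, hK0, hK⟩ := exists_norm_memTerm_le hM
  have hkint : IntegrableOn (kerInt M) (Ioo 0 π) := hM.inL2_kerInt.integrable (by norm_num)
  have hk0 : ∀ t ∈ Ioo (0 : ℝ) π, 0 ≤ kerInt M t := fun t ht => kerInt_nonneg M ht.1.le
  set W := ∫ t in Ioo 0 π, kerInt M t with hW
  have hW0 : 0 ≤ W := setIntegral_nonneg measurableSet_Ioo hk0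
  set δ := ε / (1 + K * W) with hδ
  have hδ0 : 0 < δ := by positivity
  obtain ⟨σ, hσ0, hσ⟩ := exists_integral_norm_mul_exp_le hM hδ0
  refine ⟨σ, hσ0.le, fun ρ hρσ x hx => ?_⟩
  set τ := |ρ.im| with hτ
  have hρ : ρ ≠ 0 := by
    rintro rfl
    simp [hτ] at hρσ
    linarith
  have hD : ∀ y ∈ Icc (0 : ℝ) π, ‖sinRemMain M ρ y‖ ≤ Real.exp (τ * y) * δ := by
    intro y hy
    refine (norm_sinRemMain_le hM ρ hy).trans (mul_le_mul_of_nonneg_left ?_ (Real.exp_pos _).le)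
    refine le_trans ?_ hσ
    refine setIntegral_mono_on
      (MemLp.integrable_mul (MemLp.norm hM) (ContinuousOn.inL2 (by fun_prop)))
      (MemLp.integrable_mul (MemLp.norm hM) (ContinuousOn.inL2 (by fun_prop)))
      measurableSet_Ioo fun t ht => ?_
    have := ht.1
    gcongr
  have h1 : ‖cv (sinRemMain M ρ) (memTerm hM ρ) x‖ ≤ Real.exp (τ * x) * δ * K * W := by
    rw [cv, intervalIntegral.integral_of_le hx.1, integral_Ioc_eq_integral_Ioo, hW,
      ← integral_const_mul]
    have hint : IntegrableOn (fun t => Real.exp (τ * x) * δ * K * kerInt M t) (Ioo 0 π) :=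
      hkint.const_mul _
    refine (norm_integral_le_of_norm_le (hint.mono_set (Ioo_subset_Ioo_right hx.2)) ?_).trans
      (setIntegral_mono_set hint ?_ (Ioo_subset_Ioo_right hx.2).eventuallyLE)
    · filter_upwards [ae_restrict_mem measurableSet_Ioo] with t ht
      rw [norm_mul]
      refine (mul_le_mul (hD (x - t) ⟨by linarith [ht.2], by linarith [ht.1, hx.2]⟩)
        (hK ρ hρ t ⟨ht.1, ht.2.trans_le hx.2⟩) (norm_nonneg _) (by positivity)).trans
        (le_of_eq ?_)
      have h4 : Real.exp (τ * (x - t)) * Real.exp (τ * t) = Real.exp (τ * x) := by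
        rw [← Real.exp_add]; congr 1; ring
      rw [← h4]
      ring
    · filter_upwards [ae_restrict_mem measurableSet_Ioo] with t ht
      have := hk0 t ht
      simp only [Pi.zero_apply]
      positivity
  rw [sinRem_eq hM hρ hx]
  refine (norm_add_le _ _).trans ((add_le_add (hD x hx) h1).trans (le_of_eq ?_))
  have h5 : δ * (1 + K * W) = ε := by rw [hδ]; field_simp
  linear_combination Real.exp (τ * x) * h5

end Bounds

/-! ### Square sums: Minkowski and Bessel inequalities at perturbed integers -/

section SquareSums

/-- Minkowski's inequality for square sums of weighted integrals. -/
theorem sum_sq_integral_mul_le {α ι : Type*} [MeasurableSpace α] {μ : Measure α} {s : Finset ι}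
    {φ : ι → α → ℝ} {w : α → ℝ} {C : ℝ} (hφm : ∀ k ∈ s, AEStronglyMeasurable (φ k) μ)
    (hφ : ∀ᵐ t ∂μ, ∑ k ∈ s, φ k t ^ 2 ≤ C) (hw : Integrable w μ) (hw0 : ∀ᵐ t ∂μ, 0 ≤ w t) :
    ∑ k ∈ s, (∫ t, φ k t * w t ∂μ) ^ 2 ≤ C * (∫ t, w t ∂μ) ^ 2 := by
  have hsw : AEStronglyMeasurable (fun t => √(w t)) μ :=
    Real.continuous_sqrt.comp_aestronglyMeasurable hw.1
  have hint : ∀ k ∈ s, Integrable (fun t => φ k t ^ 2 * w t) μ := by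
    intro k hk
    refine (hw.const_mul C).mono' (((hφm k hk).pow 2).mul hw.1) ?_
    filter_upwards [hφ, hw0] with t ht ht0
    rw [Real.norm_of_nonneg (by positivity)]
    refine mul_le_mul_of_nonneg_right (le_trans ?_ ht) ht0
    exact Finset.single_le_sum (f := fun k => φ k t ^ 2) (fun i _ => sq_nonneg _) hk
  have hw2 : MemLp (fun t => √(w t)) 2 μ := by
    rw [memLp_two_iff_integrable_sq hsw]
    refine hw.congr ?_
    filter_upwards [hw0] with t ht
    rw [Real.sq_sqrt ht]
  -- Cauchy–Schwarz for the measure `w dμ`, with `√w` given to each factor; the sum over `k` can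
  -- then be taken under the integral.
  have h1 : ∀ k ∈ s, (∫ t, φ k t * w t ∂μ) ^ 2 ≤ (∫ t, φ k t ^ 2 * w t ∂μ) * ∫ t, w t ∂μ := by
    intro k hk
    have hφ2 : MemLp (fun t => φ k t * √(w t)) 2 μ := by
      have hm : AEStronglyMeasurable (fun t => φ k t * √(w t)) μ := (hφm k hk).mul hsw
      rw [memLp_two_iff_integrable_sq hm]
      refine (hint k hk).congr ?_
      filter_upwards [hw0] with t ht
      rw [mul_pow, Real.sq_sqrt ht]
    have h2 := sq_integral_mul_le hφ2 hw2
    have e1 : ∫ t, φ k t * √(w t) * √(w t) ∂μ = ∫ t, φ k t * w t ∂μ := by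
      refine integral_congr_ae ?_
      filter_upwards [hw0] with t ht
      rw [mul_assoc, Real.mul_self_sqrt ht]
    have e2 : ∫ t, (φ k t * √(w t)) ^ 2 ∂μ = ∫ t, φ k t ^ 2 * w t ∂μ := by
      refine integral_congr_ae ?_
      filter_upwards [hw0] with t ht
      rw [mul_pow, Real.sq_sqrt ht]
    have e3 : ∫ t, √(w t) ^ 2 ∂μ = ∫ t, w t ∂μ := by
      refine integral_congr_ae ?_
      filter_upwards [hw0] with t ht
      rw [Real.sq_sqrt ht]
    rwa [e1, e2, e3] at h2
  refine (Finset.sum_le_sum h1).trans ?_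
  rw [← Finset.sum_mul, ← integral_finsetSum _ hint, sq, ← mul_assoc]
  refine mul_le_mul_of_nonneg_right ?_ (integral_nonneg_of_ae hw0)
  rw [← integral_const_mul]
  refine integral_mono_ae (integrable_finsetSum _ hint) (hw.const_mul C) ?_
  filter_upwards [hφ, hw0] with t ht ht0
  rw [← Finset.sum_mul]
  exact mul_le_mul_of_nonneg_right ht ht0

/-- Bessel's inequality for the exponentials of integer frequency. -/
theorem sum_sq_norm_integral_exp_le {ι : Type*} {n : ι → ℤ} (hn : Function.Injective n)
    (s : Finset ι) {f : ℝ → ℂ} (hf : InL2 f) {x : ℝ} (hx : x ∈ Icc (0 : ℝ) π) :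
    ∑ k ∈ s, ‖∫ t in (0 : ℝ)..x, f t * Complex.exp (-(Complex.I * n k * t))‖ ^ 2 ≤
      2 * π * ∫ t in Ioo 0 π, ‖f t‖ ^ 2 := by
  have hpi := Real.pi_pos
  have hab : (0 : ℝ) < 2 * π := by positivity
  -- Cut off at `x` and extended by zero to a full period, so that the integrals over `(0, x)`
  -- become Fourier coefficients and the bound is uniform in `x`.
  set F : ℝ → ℂ := (Ioo 0 x).indicator f with hF
  have hsub : Ioo 0 x ⊆ Ioo 0 π := Ioo_subset_Ioo_right hx.2
  have hsub2 : Ioo 0 x ⊆ Ioc 0 (2 * π) := fun t ht => ⟨ht.1, by linarith [ht.2, hx.2]⟩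
  have hFL : MemLp F 2 (volume.restrict (Ioc 0 (2 * π))) := by
    have h1 : MemLp f 2 (volume.restrict (Ioo 0 x)) :=
      hf.mono_measure (Measure.restrict_mono hsub le_rfl)
    exact ((memLp_indicator_iff_restrict measurableSet_Ioo).2 h1).mono_measure
      Measure.restrict_le_self
  have h2 := hasSum_sq_fourierCoeffOn hab hFL
  have hcoef : ∀ m : ℤ, ‖fourierCoeffOn hab F m‖ =
      (2 * π)⁻¹ * ‖∫ t in (0 : ℝ)..x, f t * Complex.exp (-(Complex.I * m * t))‖ := by
    intro m
    rw [fourierCoeffOn_eq_integral, norm_smul, intervalIntegral.integral_of_le hab.le,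
      setIntegral_eq_of_subset_of_forall_sdiff_eq_zero measurableSet_Ioc hsub2,
      intervalIntegral.integral_of_le hx.1, integral_Ioc_eq_integral_Ioo]
    · congr 1
      · rw [sub_zero, one_div, Real.norm_of_nonneg (by positivity)]
      · congr 1
        refine setIntegral_congr_fun measurableSet_Ioo fun t ht => ?_
        rw [hF]
        simp only [indicator_of_mem ht]
        rw [fourier_coe_apply, smul_eq_mul, mul_comm]
        congr 2
        have : (π : ℂ) ≠ 0 := by exact_mod_cast hpi.ne'
        push_cast
        field_simp
        ring
    · intro t ht
      simp [hF, indicator_of_notMem ht.2]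
  have h3 : ∑ k ∈ s, ‖fourierCoeffOn hab F (n k)‖ ^ 2 ≤
      (2 * π - 0)⁻¹ • ∫ t in (0 : ℝ)..(2 * π), ‖F t‖ ^ 2 := by
    have h := sum_le_hasSum (s.map ⟨n, hn⟩) (fun _ _ => by positivity) h2
    rwa [Finset.sum_map] at h
  have h4 : ∫ t in (0 : ℝ)..(2 * π), ‖F t‖ ^ 2 ≤ ∫ t in Ioo 0 π, ‖f t‖ ^ 2 := by
    rw [intervalIntegral.integral_of_le hab.le,
      setIntegral_eq_of_subset_of_forall_sdiff_eq_zero measurableSet_Ioc hsub2]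
    · rw [setIntegral_congr_fun (g := fun t => ‖f t‖ ^ 2) measurableSet_Ioo fun t ht => by
        simp only [hF, indicator_of_mem ht]]
      exact setIntegral_mono_set (hf.integrable_norm_pow (by norm_num))
        (ae_of_all _ fun t => by positivity) hsub.eventuallyLE
    · intro t ht
      simp [hF, indicator_of_notMem ht.2]
  simp only [hcoef, mul_pow, ← Finset.mul_sum, smul_eq_mul, sub_zero] at h3
  have h5 := h3.trans (mul_le_mul_of_nonneg_left h4 (by positivity))
  have h6 := mul_le_mul_of_nonneg_left h5 (by positivity : (0 : ℝ) ≤ (2 * π) ^ 2)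
  calc _ = (2 * π) ^ 2 * ((2 * π)⁻¹ ^ 2 *
        ∑ k ∈ s, ‖∫ t in (0 : ℝ)..x, f t * Complex.exp (-(Complex.I * n k * t))‖ ^ 2) := by
        field_simp
    _ ≤ _ := h6
    _ = _ := by field_simp

/-- The function `t ↦ exp(iζt)`. -/
def expFun (ζ : ℂ) (t : ℝ) : ℂ := Complex.exp (Complex.I * ζ * t)

theorem continuous_expFun (ζ : ℂ) : Continuous (expFun ζ) := by
  unfold expFun; fun_prop

theorem inL2_expFun (ζ : ℂ) : InL2 (expFun ζ) := (continuous_expFun ζ).continuousOn.inL2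

theorem norm_expFun_le {ζ : ℂ} {R : ℝ} (hζ : ‖ζ‖ ≤ R) {t : ℝ} (ht : t ∈ Icc (0 : ℝ) π) :
    ‖expFun ζ t‖ ≤ Real.exp (R * π) := by
  have hR : 0 ≤ R := (norm_nonneg _).trans hζ
  rw [expFun, Complex.norm_exp, Real.exp_le_exp]
  have h1 := (abs_le.1 ((Complex.abs_im_le_norm ζ).trans hζ)).1
  simp only [Complex.mul_re, Complex.I_re, Complex.I_im, zero_mul, one_mul, zero_sub,
    Complex.ofReal_re, Complex.ofReal_im, mul_zero, sub_zero]
  nlinarith [ht.1, ht.2]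

theorem expFun_eq (ζ : ℂ) (x : ℝ) :
    expFun ζ x = 1 + Complex.I * ζ * cv (fun _ => 1) (expFun ζ) x := by
  have h : ∀ t : ℝ, HasDerivAt (expFun ζ) (Complex.I * ζ * expFun ζ t) t := by
    intro t
    have h1 : HasDerivAt (fun t : ℝ => Complex.I * ζ * (t : ℂ)) (Complex.I * ζ) t := by
      simpa using (Complex.ofRealCLM.hasDerivAt (x := t)).const_mul (Complex.I * ζ)
    exact h1.cexp.congr_deriv (by rw [expFun]; ring)
  rw [cv_one_left, ← intervalIntegral.integral_const_mul,
    intervalIntegral.integral_eq_sub_of_hasDerivAt (fun t _ => h t)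
      ((continuous_const.mul (continuous_expFun ζ)).intervalIntegrable _ _)]
  simp [expFun]

/-- Bessel's inequality for exponentials with frequencies near the integers. -/
theorem exists_sum_sq_cv_expFun_le (R : ℝ) : ∃ C : ℝ, 0 ≤ C ∧
    ∀ {ι : Type} (n : ι → ℤ), Function.Injective n → ∀ (s : Finset ι) (ζ : ι → ℂ),
      (∀ k, ‖ζ k‖ ≤ R) → ∀ f : ℝ → ℂ, InL2 f → ∀ x ∈ Icc (0 : ℝ) π,
        ∑ k ∈ s, ‖cv f (expFun (n k + ζ k)) x‖ ^ 2 ≤ C * ∫ t in Ioo 0 π, ‖f t‖ ^ 2 := by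
  have hpi := Real.pi_pos
  set Q := R * Real.exp (R * π) with hQ
  refine ⟨2 * (2 * π) + 2 * (2 * π * (π * Q) ^ 2), by positivity,
    fun {ι} n hn s ζ hζ f hf x hx => ?_⟩
  set I := ∫ t in Ioo 0 π, ‖f t‖ ^ 2 with hI
  have hI0 : 0 ≤ I := integral_nonneg fun t => by positivity
  set g : ι → ℝ → ℂ := fun k t => f t * Complex.exp (-(Complex.I * n k * t)) with hg
  have hunit : ∀ (k : ι) (t : ℝ), ‖Complex.exp (Complex.I * n k * t)‖ = 1 := by
    intro k t
    rw [Complex.norm_exp]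
    simp
  have hunit' : ∀ (k : ι) (t : ℝ), ‖Complex.exp (-(Complex.I * n k * t))‖ = 1 := by
    intro k t
    rw [Complex.exp_neg, norm_inv, hunit, inv_one]
  have hg2 : ∀ k, InL2 (g k) := by
    intro k
    refine MemLp.of_le hf (hf.1.mul (Continuous.aestronglyMeasurable (by fun_prop)))
      (ae_of_all _ fun t => ?_)
    simp only [hg]
    rw [norm_mul, hunit', mul_one]
  set a : ι → ℝ → ℂ := fun k => cv (fun _ => 1) (g k) with ha
  have hac : ∀ k, ContinuousOn (a k) (Icc 0 π) := fun k =>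
    (hg2 k).continuousOn_cv continuousOn_one_Icc
  have hbessel : ∀ y ∈ Icc (0 : ℝ) π, ∑ k ∈ s, ‖a k y‖ ^ 2 ≤ 2 * π * I := by
    intro y hy
    have h := sum_sq_norm_integral_exp_le hn s hf hy
    simpa only [ha, cv_one_left] using h
  have heq : ∀ k, ‖cv f (expFun (n k + ζ k)) x‖ = ‖cv (g k) (expFun (ζ k)) x‖ := by
    intro k
    have h1 : cv f (expFun (n k + ζ k)) x =
        Complex.exp (Complex.I * n k * x) * cv (g k) (expFun (ζ k)) x := by
      rw [cv, cv, ← intervalIntegral.integral_const_mul]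
      congr 1
      funext t
      simp only [hg, expFun]
      have h2 : Complex.exp (Complex.I * (n k + ζ k) * t) = Complex.exp (Complex.I * n k * x) *
          (Complex.exp (-(Complex.I * n k * (x - t : ℝ))) * Complex.exp (Complex.I * ζ k * t)) := by
        rw [← Complex.exp_add, ← Complex.exp_add]
        congr 1
        push_cast
        ring
      rw [h2]
      ring
    rw [h1, norm_mul, hunit, one_mul]
  -- Writing `exp(iζt) = 1 + iζ ∫₀ᵗ exp(iζs) ds` moves the perturbation onto the primitives `a k`.
  -- These satisfy Bessel's inequality at every point, and Minkowski's inequality carries it through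
  -- the integral.
  have hdec : ∀ k, cv (g k) (expFun (ζ k)) x =
      a k x + Complex.I * ζ k * cv (a k) (expFun (ζ k)) x := by
    intro k
    have h1 : InL2 (cv (fun _ => 1) (expFun (ζ k))) :=
      ((inL2_expFun (ζ k)).continuousOn_cv continuousOn_one_Icc).inL2
    have h2 : cv (g k) (expFun (ζ k)) x =
        cv (g k) (fun t => 1 + Complex.I * ζ k * cv (fun _ => 1) (expFun (ζ k)) t) x := by
      congr 1
      funext t
      exact expFun_eq _ _
    rw [h2, (hg2 k).cv_add_right inL2_one (h1.const_mul _) hx, cv_smul_right,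
      ← (hg2 k).cv_assoc inL2_one (inL2_expFun _) hx, cv_comm (g k) (fun _ => 1),
      funext (cv_comm (g k) fun _ => 1)]
  have hbound : ∀ k, ‖Complex.I * ζ k * cv (a k) (expFun (ζ k)) x‖ ≤
      ∫ t in Ioo 0 x, ‖a k t‖ * Q := by
    intro k
    have hi : IntegrableOn (fun t => ‖a k t‖ * Real.exp (R * π)) (Ioo 0 x) :=
      (((hac k).inL2.integrable (by norm_num)).norm.mul_const _).mono_measure
        (Measure.restrict_mono (Ioo_subset_Ioo_right hx.2) le_rfl)
    have h1 : ‖cv (a k) (expFun (ζ k)) x‖ ≤ ∫ t in Ioo 0 x, ‖a k t‖ * Real.exp (R * π) := by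
      rw [cv_comm, cv, intervalIntegral.integral_of_le hx.1, integral_Ioc_eq_integral_Ioo]
      refine norm_integral_le_of_norm_le hi ?_
      filter_upwards [ae_restrict_mem measurableSet_Ioo] with t ht
      rw [norm_mul, mul_comm]
      refine mul_le_mul_of_nonneg_left (norm_expFun_le (hζ k) ?_) (norm_nonneg _)
      exact ⟨by linarith [ht.2], by linarith [ht.1, hx.2]⟩
    rw [norm_mul, norm_mul, Complex.norm_I, one_mul]
    refine (mul_le_mul (hζ k) h1 (norm_nonneg _) ((norm_nonneg _).trans (hζ k))).trans
      (le_of_eq ?_)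
    rw [← integral_const_mul]
    congr 1
    funext t
    rw [hQ]; ring
  have hmink : ∑ k ∈ s, (∫ t in Ioo 0 x, ‖a k t‖ * Q) ^ 2 ≤ 2 * π * I * (π * Q) ^ 2 := by
    by_cases hs : s.Nonempty
    · have hR : 0 ≤ R := (norm_nonneg _).trans (hζ hs.choose)
      have hQ0 : 0 ≤ Q := by positivity
      have h1 := sum_sq_integral_mul_le (μ := volume.restrict (Ioo 0 x)) (s := s)
        (φ := fun k t => ‖a k t‖) (w := fun _ => Q) (C := 2 * π * I)
        (fun k _ => ((((hac k).inL2).1.mono_measure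
          (Measure.restrict_mono (Ioo_subset_Ioo_right hx.2) le_rfl))).norm)
        (by
          filter_upwards [ae_restrict_mem measurableSet_Ioo] with t ht
          exact hbessel t ⟨ht.1.le, ht.2.le.trans hx.2⟩)
        (integrable_const _) (ae_of_all _ fun _ => hQ0)
      refine h1.trans ?_
      have h2 : ∫ _ in Ioo 0 x, Q = x * Q := by
        simp [hx.1]
      rw [h2]
      have := hx.1
      have := hx.2
      gcongr
    · rw [Finset.not_nonempty_iff_eq_empty.1 hs, Finset.sum_empty]
      positivity
  calc ∑ k ∈ s, ‖cv f (expFun (n k + ζ k)) x‖ ^ 2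
      ≤ ∑ k ∈ s, (2 * ‖a k x‖ ^ 2 + 2 * (∫ t in Ioo 0 x, ‖a k t‖ * Q) ^ 2) := by
        refine Finset.sum_le_sum fun k _ => ?_
        rw [heq, hdec]
        have h1 := (norm_add_le _ _).trans (add_le_add_right (hbound k) ‖a k x‖)
        refine (pow_le_pow_left₀ (norm_nonneg _) h1 2).trans ?_
        nlinarith [sq_nonneg (‖a k x‖ - ∫ t in Ioo 0 x, ‖a k t‖ * Q)]
    _ = 2 * ∑ k ∈ s, ‖a k x‖ ^ 2 + 2 * ∑ k ∈ s, (∫ t in Ioo 0 x, ‖a k t‖ * Q) ^ 2 := by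
        rw [Finset.sum_add_distrib, Finset.mul_sum, Finset.mul_sum]
    _ ≤ 2 * (2 * π * I) + 2 * (2 * π * I * (π * Q) ^ 2) := by
        have := hbessel x hx
        gcongr
    _ = _ := by ring

theorem exists_sum_sq_cv_sinFun_le (R : ℝ) : ∃ C : ℝ, 0 ≤ C ∧
    ∀ (s : Finset ℕ) (ζ : ℕ → ℂ), (∀ k, ‖ζ k‖ ≤ R) → ∀ f : ℝ → ℂ, InL2 f →
      ∀ x ∈ Icc (0 : ℝ) π,
        ∑ k ∈ s, ‖cv f (sinFun (k + ζ k)) x‖ ^ 2 ≤ C * ∫ t in Ioo 0 π, ‖f t‖ ^ 2 := by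
  obtain ⟨C, hC0, hC⟩ := exists_sum_sq_cv_expFun_le R
  refine ⟨C, hC0, fun s ζ hζ f hf x hx => ?_⟩
  have h1 := hC (fun k : ℕ => (k : ℤ)) Nat.cast_injective s ζ hζ f hf x hx
  have h2 := hC (fun k : ℕ => -(k : ℤ)) (neg_injective.comp Nat.cast_injective) s (fun k => -ζ k)
    (fun k => by rw [norm_neg]; exact hζ k) f hf x hx
  have h3 : ∀ ρ : ℂ, cv f (sinFun ρ) x =
      Complex.I / 2 * (cv f (expFun (-ρ)) x - cv f (expFun ρ) x) := by
    intro ρ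
    rw [← hf.cv_sub_right (inL2_expFun _) (inL2_expFun _) hx, ← cv_smul_right]
    congr 1
    funext t
    rw [sinFun, expFun, expFun, Complex.sin]
    have e1 : Complex.I * -ρ * t = -(ρ * t) * Complex.I := by ring
    have e2 : Complex.I * ρ * t = ρ * t * Complex.I := by ring
    rw [e1, e2]
    ring
  have h4 : ∀ k : ℕ, ‖cv f (sinFun (k + ζ k)) x‖ ^ 2 ≤
      (1 / 2) * ‖cv f (expFun (((-(k : ℤ) : ℤ) : ℂ) + -ζ k)) x‖ ^ 2 +
      (1 / 2) * ‖cv f (expFun (((k : ℤ) : ℂ) + ζ k)) x‖ ^ 2 := by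
    intro k
    have e1 : -((k : ℂ) + ζ k) = ((-(k : ℤ) : ℤ) : ℂ) + -ζ k := by push_cast; ring
    have e2 : ((k : ℤ) : ℂ) = k := by push_cast; rfl
    rw [h3, e1, e2, norm_mul, norm_div, Complex.norm_I, Complex.norm_two, mul_pow]
    have h5 := pow_le_pow_left₀ (norm_nonneg _) (norm_sub_le
      (cv f (expFun (((-(k : ℤ) : ℤ) : ℂ) + -ζ k)) x) (cv f (expFun ((k : ℂ) + ζ k)) x)) 2
    nlinarith [sq_nonneg (‖cv f (expFun (((-(k : ℤ) : ℤ) : ℂ) + -ζ k)) x‖ -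
      ‖cv f (expFun ((k : ℂ) + ζ k)) x‖)]
  refine (Finset.sum_le_sum fun k _ => h4 k).trans ?_
  rw [Finset.sum_add_distrib, ← Finset.mul_sum, ← Finset.mul_sum]
  linarith

end SquareSums

/-! ### Square summability of the remainder in Duhamel's formula -/

section RemainderSums

variable {M : ℝ → ℂ}

theorem exists_sum_sq_sinRemMain_le (hM : IsKernel M) (R : ℝ) : ∃ C : ℝ, 0 ≤ C ∧
    ∀ (s : Finset ℕ) (ζ : ℕ → ℂ), (∀ k, ‖ζ k‖ ≤ R) → ∀ x ∈ Icc (0 : ℝ) π,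
      ∑ k ∈ s, ‖sinRemMain M (k + ζ k) x‖ ^ 2 ≤ C := by
  obtain ⟨C, hC0, hC⟩ := exists_sum_sq_cv_sinFun_le R
  refine ⟨C * ∫ t in Ioo 0 π, ‖((π - t : ℝ) : ℂ) * M t‖ ^ 2,
    mul_nonneg hC0 (integral_nonneg fun t => by positivity), fun s ζ hζ x hx => ?_⟩
  have hf := hM.inL2_truncKernel hx
  have h1 := hC s ζ hζ _ hf x hx
  simp only [← sinRemMain_eq M _ hx.1] at h1
  refine h1.trans (mul_le_mul_of_nonneg_left ?_ hC0)
  refine integral_mono (hf.integrable_norm_pow (by norm_num))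
    (MemLp.integrable_norm_pow hM (by norm_num)) fun t => ?_
  exact pow_le_pow_left₀ (norm_nonneg _) (norm_truncKernel_le M hx t) 2

/-- On the frequencies `k + ζ k` the imaginary parts are at most `R`, so `memTerm` is dominated by
`Q * kerInt M` independently of `k`. Minkowski's inequality with this weight transfers the square
sums from the main term to its convolution with `memTerm`. -/
theorem exists_sum_sq_sinRem_le (hM : IsKernel M) (R : ℝ) : ∃ C : ℝ, 0 ≤ C ∧
    ∀ (s : Finset ℕ) (ζ : ℕ → ℂ), (∀ k, ‖ζ k‖ ≤ R) → (∀ k ∈ s, (k : ℂ) + ζ k ≠ 0) →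
      ∀ x ∈ Icc (0 : ℝ) π, ∑ k ∈ s, ‖sinRem hM (k + ζ k) x‖ ^ 2 ≤ C := by
  obtain ⟨C, hC0, hC⟩ := exists_sum_sq_sinRemMain_le hM R
  obtain ⟨K, hK0, hK⟩ := exists_norm_memTerm_le hM
  have hkint : IntegrableOn (kerInt M) (Ioo 0 π) := hM.inL2_kerInt.integrable (by norm_num)
  have hk0 : ∀ t ∈ Ioo (0 : ℝ) π, 0 ≤ kerInt M t := fun t ht => kerInt_nonneg M ht.1.le
  set W := ∫ t in Ioo 0 π, kerInt M t with hW
  set Q := K * Real.exp (R * π) with hQ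
  refine ⟨2 * C + 2 * (C * (Q * W) ^ 2), by positivity, fun s ζ hζ hs x hx => ?_⟩
  have hQ0 : 0 ≤ Q := by positivity
  have hmem : ∀ t ∈ Ioo 0 x, x - t ∈ Icc (0 : ℝ) π := fun t ht =>
    ⟨by linarith [ht.2], by linarith [ht.1, hx.2]⟩
  have hmeas : ∀ k : ℕ, AEStronglyMeasurable (fun t => ‖sinRemMain M (k + ζ k) (x - t)‖)
      (volume.restrict (Ioo 0 x)) := fun k =>
    ((continuousOn_sinRemMain hM _).inL2.comp_sub_left hx).1.norm
  have hbound : ∀ k ∈ s, ‖cv (sinRemMain M (k + ζ k)) (memTerm hM (k + ζ k)) x‖ ≤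
      ∫ t in Ioo 0 x, ‖sinRemMain M (k + ζ k) (x - t)‖ * (Q * kerInt M t) := by
    intro k hk
    rw [cv, intervalIntegral.integral_of_le hx.1, integral_Ioc_eq_integral_Ioo]
    refine norm_integral_le_of_norm_le ?_ ?_
    · have := InL2.intervalIntegrable_conv (continuousOn_sinRemMain hM (k + ζ k)).inL2.norm
        (hM.inL2_kerInt.const_mul Q) hx
      rwa [intervalIntegrable_iff_integrableOn_Ioo_of_le hx.1] at this
    · filter_upwards [ae_restrict_mem measurableSet_Ioo] with t ht
      have ht' : t ∈ Ioo (0 : ℝ) π := ⟨ht.1, ht.2.trans_le hx.2⟩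
      rw [norm_mul]
      refine mul_le_mul_of_nonneg_left ((hK _ (hs k hk) t ht').trans ?_) (norm_nonneg _)
      have h1 : |((k : ℂ) + ζ k).im| ≤ R := by
        simpa using (Complex.abs_im_le_norm (ζ k)).trans (hζ k)
      have := hk0 t ht'
      have hR : 0 ≤ R := (abs_nonneg _).trans h1
      have h2 : |((k : ℂ) + ζ k).im| * t ≤ R * π :=
        mul_le_mul h1 ht'.2.le ht'.1.le hR
      rw [hQ]
      gcongr
  have hmink : ∑ k ∈ s, (∫ t in Ioo 0 x, ‖sinRemMain M (k + ζ k) (x - t)‖ * (Q * kerInt M t)) ^ 2 ≤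
      C * (Q * W) ^ 2 := by
    refine (sum_sq_integral_mul_le (fun k _ => hmeas k) (C := C) ?_
      ((hkint.mono_set (Ioo_subset_Ioo_right hx.2)).const_mul Q) ?_).trans ?_
    · filter_upwards [ae_restrict_mem measurableSet_Ioo] with t ht
      exact hC s ζ hζ (x - t) (hmem t ht)
    · filter_upwards [ae_restrict_mem measurableSet_Ioo] with t ht
      exact mul_nonneg hQ0 (kerInt_nonneg M ht.1.le)
    · rw [integral_const_mul]
      have h1 : 0 ≤ ∫ t in Ioo 0 x, kerInt M t :=
        setIntegral_nonneg measurableSet_Ioo fun t ht => kerInt_nonneg M ht.1.le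
      have h2 : ∫ t in Ioo 0 x, kerInt M t ≤ W :=
        setIntegral_mono_set hkint ((ae_restrict_iff' measurableSet_Ioo).2 (ae_of_all _ hk0))
          (Ioo_subset_Ioo_right hx.2).eventuallyLE
      gcongr
  calc ∑ k ∈ s, ‖sinRem hM (k + ζ k) x‖ ^ 2
      ≤ ∑ k ∈ s, (2 * ‖sinRemMain M (k + ζ k) x‖ ^ 2 +
        2 * (∫ t in Ioo 0 x, ‖sinRemMain M (k + ζ k) (x - t)‖ * (Q * kerInt M t)) ^ 2) := by
        refine Finset.sum_le_sum fun k hk => ?_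
        rw [sinRem_eq hM (hs k hk) hx]
        have h1 := (norm_add_le _ _).trans
          (add_le_add_right (hbound k hk) ‖sinRemMain M (k + ζ k) x‖)
        refine (pow_le_pow_left₀ (norm_nonneg _) h1 2).trans ?_
        nlinarith [sq_nonneg (‖sinRemMain M (k + ζ k) x‖ -
          ∫ t in Ioo 0 x, ‖sinRemMain M (k + ζ k) (x - t)‖ * (Q * kerInt M t))]
    _ = 2 * ∑ k ∈ s, ‖sinRemMain M (k + ζ k) x‖ ^ 2 + 2 * ∑ k ∈ s,
        (∫ t in Ioo 0 x, ‖sinRemMain M (k + ζ k) (x - t)‖ * (Q * kerInt M t)) ^ 2 := by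
        rw [Finset.sum_add_distrib, Finset.mul_sum, Finset.mul_sum]
    _ ≤ _ := by
        have := hC s ζ hζ x hx
        gcongr

theorem exists_sum_sq_cv_one_sinRem_le (hM : IsKernel M) (R : ℝ) : ∃ C : ℝ, 0 ≤ C ∧
    ∀ (s : Finset ℕ) (ζ : ℕ → ℂ), (∀ k, ‖ζ k‖ ≤ R) → (∀ k ∈ s, (k : ℂ) + ζ k ≠ 0) →
      ∑ k ∈ s, ‖cv (fun _ => 1) (sinRem hM (k + ζ k)) π‖ ^ 2 ≤ C := by
  obtain ⟨C, hC0, hC⟩ := exists_sum_sq_sinRem_le hM R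
  refine ⟨C * π ^ 2, by positivity, fun s ζ hζ hs => ?_⟩
  have hpi := Real.pi_pos
  have h1 := sum_sq_integral_mul_le (μ := volume.restrict (Ioo 0 π)) (s := s)
    (φ := fun k t => ‖sinRem hM (k + ζ k) t‖) (w := fun _ => 1) (C := C)
    (fun k _ => (continuousOn_sinRem hM _).inL2.1.norm)
    (by
      filter_upwards [ae_restrict_mem measurableSet_Ioo] with t ht
      exact hC s ζ hζ hs t (Ioo_subset_Icc_self ht))
    (integrable_const _) (ae_of_all _ fun _ => zero_le_one)
  have h2 : ∫ _ in Ioo (0 : ℝ) π, (1 : ℝ) = π := by simp [hpi.le]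
  rw [h2] at h1
  refine le_trans (Finset.sum_le_sum fun k _ => ?_) h1
  refine pow_le_pow_left₀ (norm_nonneg _) ?_ 2
  rw [cv_one_left]
  refine (intervalIntegral.norm_integral_le_integral_norm hpi.le).trans (le_of_eq ?_)
  rw [intervalIntegral.integral_of_le hpi.le, integral_Ioc_eq_integral_Ioo]
  simp

end RemainderSums

/-! ### Asymptotics of the characteristic function -/

section RobinAsymptotics

variable {M : ℝ → ℂ}

/-- The remainder in `robinDet hM h H (ρ²) = -ρ (sin πρ + robinRem hM h H ρ)`. -/
def robinRem (hM : IsKernel M) (h H ρ : ℂ) : ℂ :=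
  -robinDet hM h H (ρ ^ 2) / ρ - Complex.sin (π * ρ)

theorem robinDet_sq_eq (hM : IsKernel M) (h H : ℂ) {ρ : ℂ} (hρ : ρ ≠ 0) :
    robinDet hM h H (ρ ^ 2) = -ρ * (Complex.sin (π * ρ) + robinRem hM h H ρ) := by
  rw [robinRem]
  field_simp
  ring

theorem robinRem_neg (hM : IsKernel M) (h H ρ : ℂ) :
    robinRem hM h H (-ρ) = -robinRem hM h H ρ := by
  rw [robinRem, robinRem, neg_sq, mul_neg, Complex.sin_neg]
  ring

/-- Everything except `sinRem` and its integral carries a factor `1 / ρ`, which is both decaying and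
square summable along the integers. -/
theorem robinRem_eq (hM : IsKernel M) (h H : ℂ) {ρ : ℂ} (hρ : ρ ≠ 0) :
    robinRem hM h H ρ = sinRem hM ρ π + H * cv (fun _ => 1) (sinRem hM ρ) π -
      (H * cosFun ρ π + h * eigenDer hM (ρ ^ 2) π + h * H * eigenSol hM (ρ ^ 2) π) / ρ := by
  have hpi : π ∈ Icc (0 : ℝ) π := right_mem_Icc.2 Real.pi_pos.le
  have h1 := mul_eigenSol_eq hM hρ hpi
  have h2 : ρ ^ 2 * cv (fun _ => 1) (eigenSol hM (ρ ^ 2)) π =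
      1 - cosFun ρ π + ρ * cv (fun _ => 1) (sinRem hM ρ) π := by
    have h3 : ρ * cv (fun _ => 1) (eigenSol hM (ρ ^ 2)) π =
        cv (fun _ => 1) (sinFun ρ) π + cv (fun _ => 1) (sinRem hM ρ) π := by
      rw [← cv_smul_right, ← inL2_one.cv_add_right (continuousOn_sinFun ρ).inL2
        (continuousOn_sinRem hM ρ).inL2 hpi]
      exact cv_congr_right (ae_eq_of_eqOn_Icc fun t ht => mul_eigenSol_eq hM hρ ht) hpi
    linear_combination ρ * h3 + mul_cv_one_sinFun ρ π
  have h4 : Complex.sin (π * ρ) = sinFun ρ π := by rw [sinFun, mul_comm]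
  rw [robinRem, robinDet_eq, h4]
  field_simp
  linear_combination ρ * h1 + H * h2

theorem exists_norm_robinRem_le (hM : IsKernel M) (h H : ℂ) : ∃ C : ℝ, 0 ≤ C ∧ ∀ ρ : ℂ, ρ ≠ 0 →
    ‖robinRem hM h H ρ‖ ≤ ‖sinRem hM ρ π‖ + ‖H‖ * ‖cv (fun _ => 1) (sinRem hM ρ) π‖ +
      C * Real.exp (π * |ρ.im|) / ‖ρ‖ := by
  obtain ⟨K, hK0, hK⟩ := exists_norm_eigenDer_le hM
  have hpi := Real.pi_pos
  have hmem : π ∈ Icc (0 : ℝ) π := right_mem_Icc.2 hpi.le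
  refine ⟨‖H‖ + ‖h‖ * K + ‖h‖ * ‖H‖ * (K * π), by positivity, fun ρ hρ => ?_⟩
  have hcos : ‖cosFun ρ π‖ ≤ Real.exp (π * |ρ.im|) := by
    rw [mul_comm]; exact norm_cosFun_le ρ hpi.le
  have hT : ‖eigenDer hM (ρ ^ 2) π‖ ≤ K * Real.exp (π * |ρ.im|) := by
    rw [mul_comm π]; exact hK ρ hρ π hmem
  have hS : ‖eigenSol hM (ρ ^ 2) π‖ ≤ K * π * Real.exp (π * |ρ.im|) := by
    rw [eigenSol_eq_cv_one hM _ hmem, cv_one_left]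
    have h1 := intervalIntegral.norm_integral_le_of_norm_le_const (a := 0) (b := π)
      (f := eigenDer hM (ρ ^ 2)) (C := K * Real.exp (π * |ρ.im|)) fun t ht => by
        rw [uIoc_of_le hpi.le] at ht
        refine (hK ρ hρ t (Ioc_subset_Icc_self ht)).trans ?_
        rw [mul_comm π]
        have := ht.2
        gcongr
    rw [sub_zero, abs_of_pos hpi] at h1
    linarith
  rw [robinRem_eq hM h H hρ]
  refine (norm_sub_le _ _).trans (add_le_add ((norm_add_le _ _).trans_eq ?_) ?_)
  · rw [norm_mul]
  · rw [norm_div]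
    refine div_le_div_of_nonneg_right ?_ (norm_nonneg _)
    refine (norm_add₃_le).trans ?_
    rw [norm_mul, norm_mul, norm_mul, norm_mul]
    calc _ ≤ ‖H‖ * Real.exp (π * |ρ.im|) + ‖h‖ * (K * Real.exp (π * |ρ.im|)) +
          ‖h‖ * ‖H‖ * (K * π * Real.exp (π * |ρ.im|)) := by gcongr
      _ = _ := by ring

theorem summable_sq_norm_robinRem (hM : IsKernel M) (h H : ℂ) {R : ℝ} {ζ : ℕ → ℂ}
    (hζ : ∀ k, ‖ζ k‖ ≤ R) : Summable fun k : ℕ => ‖robinRem hM h H (k + ζ k)‖ ^ 2 := by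
  obtain ⟨C₀, hC₀, hrem⟩ := exists_norm_robinRem_le hM h H
  obtain ⟨C₁, hC₁, hE⟩ := exists_sum_sq_sinRem_le hM R
  obtain ⟨C₂, hC₂, hF⟩ := exists_sum_sq_cv_one_sinRem_le hM R
  have hmem : π ∈ Icc (0 : ℝ) π := right_mem_Icc.2 Real.pi_pos.le
  have hR : 0 ≤ R := (norm_nonneg _).trans (hζ 0)
  obtain ⟨N, hN⟩ := exists_nat_ge R
  -- Past this shift `|k + ζ k| ≥ m + 1`, which supplies the nonvanishing needed by the square-sum
  -- bounds and compares `1 / |ρ|²` with `1 / (m + 1)²`.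
  set k₀ := N + 1 with hk₀
  have hlow : ∀ m : ℕ, ((m : ℝ) + 1) ≤ ‖((m + k₀ : ℕ) : ℂ) + ζ (m + k₀)‖ := by
    intro m
    have h1 := norm_sub_le (((m + k₀ : ℕ) : ℂ) + ζ (m + k₀)) (ζ (m + k₀))
    rw [add_sub_cancel_right, Complex.norm_natCast] at h1
    have h2 := hζ (m + k₀)
    rw [hk₀] at h1 h2 ⊢
    push_cast at h1 h2 ⊢
    linarith
  have hne : ∀ m : ℕ, ((m + k₀ : ℕ) : ℂ) + ζ (m + k₀) ≠ 0 := by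
    intro m h0
    have h1 := hlow m
    rw [h0, norm_zero] at h1
    linarith [(Nat.cast_nonneg m : (0 : ℝ) ≤ m)]
  have hmap : ∀ (u : Finset ℕ) (φ : ℕ → ℝ) (C : ℝ), (∑ k ∈ u.map (addRightEmbedding k₀), φ k ≤ C) →
      ∑ m ∈ u, φ (m + k₀) ≤ C := by
    intro u φ C hu
    rwa [Finset.sum_map] at hu
  have hne' : ∀ u : Finset ℕ, ∀ k ∈ u.map (addRightEmbedding k₀), (k : ℂ) + ζ k ≠ 0 := by
    intro u k hk
    obtain ⟨m, -, rfl⟩ := Finset.mem_map.1 hk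
    exact hne m
  have hsE : Summable fun m : ℕ => ‖sinRem hM ((m + k₀ : ℕ) + ζ (m + k₀)) π‖ ^ 2 :=
    summable_of_sum_le (c := C₁) (fun _ => by positivity) fun u =>
      hmap u (fun k => ‖sinRem hM (k + ζ k) π‖ ^ 2) C₁ (hE _ ζ hζ (hne' u) π hmem)
  have hsF : Summable fun m : ℕ =>
      ‖cv (fun _ => 1) (sinRem hM ((m + k₀ : ℕ) + ζ (m + k₀))) π‖ ^ 2 :=
    summable_of_sum_le (c := C₂) (fun _ => by positivity) fun u =>
      hmap u (fun k => ‖cv (fun _ => 1) (sinRem hM (k + ζ k)) π‖ ^ 2) C₂ (hF _ ζ hζ (hne' u))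
  have hsI : Summable fun m : ℕ => 1 / ((m : ℝ) + 1) ^ 2 := by
    have h1 := (summable_nat_add_iff 1).2 (Real.summable_one_div_nat_pow.2 one_lt_two)
    simpa using h1
  rw [← summable_nat_add_iff k₀]
  refine Summable.of_nonneg_of_le (fun m => by positivity) (fun m => ?_)
    (((hsE.mul_left 3).add (hsF.mul_left (3 * ‖H‖ ^ 2))).add
      (hsI.mul_left (3 * (C₀ * Real.exp (π * R)) ^ 2)))
  set ρ : ℂ := ((m + k₀ : ℕ) : ℂ) + ζ (m + k₀) with hρ
  have him : |ρ.im| ≤ R := by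
    rw [hρ]
    simpa using (Complex.abs_im_le_norm (ζ (m + k₀))).trans (hζ (m + k₀))
  have hm0 : (0 : ℝ) < (m : ℝ) + 1 := by positivity
  have h1 : C₀ * Real.exp (π * |ρ.im|) / ‖ρ‖ ≤ C₀ * Real.exp (π * R) / ((m : ℝ) + 1) := by
    have := hlow m
    gcongr
  have h2 := (hrem ρ (hne m)).trans (add_le_add_right h1 _)
  refine (pow_le_pow_left₀ (norm_nonneg _) h2 2).trans ?_
  have h3 : ∀ a b c : ℝ, (a + b + c) ^ 2 ≤ 3 * a ^ 2 + 3 * b ^ 2 + 3 * c ^ 2 := by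
    intro a b c
    nlinarith [sq_nonneg (a - b), sq_nonneg (b - c), sq_nonneg (a - c)]
  refine (h3 _ _ _).trans (le_of_eq ?_)
  rw [mul_pow, div_pow]
  ring

theorem exists_norm_robinRem_le_of_abs_im (hM : IsKernel M) (h H : ℂ) {ε : ℝ} (hε : 0 < ε) :
    ∃ τ₀ R : ℝ, ∀ ρ : ℂ, τ₀ < |ρ.im| → R ≤ ‖ρ‖ →
      ‖robinRem hM h H ρ‖ ≤ ε * Real.exp (π * |ρ.im|) := by
  obtain ⟨C, hC0, hC⟩ := exists_norm_robinRem_le hM h H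
  have hpi := Real.pi_pos
  have hmem : π ∈ Icc (0 : ℝ) π := right_mem_Icc.2 hpi.le
  set δ := ε / (2 * (1 + ‖H‖ * π)) with hδ
  have hδ0 : 0 < δ := by positivity
  obtain ⟨τ₀, hτ₀, hτ⟩ := exists_norm_sinRem_le hM hδ0
  refine ⟨τ₀, 2 * C / ε, fun ρ hρτ hρR => ?_⟩
  have hρ : ρ ≠ 0 := by
    rintro rfl
    simp at hρτ
    linarith
  have hρ0 : 0 < ‖ρ‖ := norm_pos_iff.2 hρ
  have h1 : ‖sinRem hM ρ π‖ ≤ δ * Real.exp (π * |ρ.im|) := by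
    rw [mul_comm π]; exact hτ ρ hρτ π hmem
  have h2 : ‖cv (fun _ => 1) (sinRem hM ρ) π‖ ≤ δ * Real.exp (π * |ρ.im|) * π := by
    rw [cv_one_left]
    have h3 := intervalIntegral.norm_integral_le_of_norm_le_const (a := 0) (b := π)
      (f := sinRem hM ρ) (C := δ * Real.exp (π * |ρ.im|)) fun t ht => by
        rw [uIoc_of_le hpi.le] at ht
        refine (hτ ρ hρτ t (Ioc_subset_Icc_self ht)).trans ?_
        rw [mul_comm π]
        have := ht.2
        gcongr
    rwa [sub_zero, abs_of_pos hpi] at h3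
  have h4 : C * Real.exp (π * |ρ.im|) / ‖ρ‖ ≤ ε / 2 * Real.exp (π * |ρ.im|) := by
    rw [div_le_iff₀ hρ0]
    have h5 : C ≤ ε / 2 * ‖ρ‖ := by
      rw [div_le_iff₀ hε] at hρR
      linarith
    nlinarith [Real.exp_pos (π * |ρ.im|)]
  have h6 : δ * (1 + ‖H‖ * π) = ε / 2 := by rw [hδ]; field_simp
  calc ‖robinRem hM h H ρ‖ ≤ _ := hC ρ hρ
    _ ≤ δ * Real.exp (π * |ρ.im|) + ‖H‖ * (δ * Real.exp (π * |ρ.im|) * π) +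
        ε / 2 * Real.exp (π * |ρ.im|) := by gcongr
    _ = _ := by linear_combination Real.exp (π * |ρ.im|) * h6

/-- Pointwise decay follows from square summability for all bounded `ζ`: points of the strip
arbitrarily far out with remainder above `ε` would form, for infinitely many `k`, a bounded
perturbation `k + ζ k` along which the terms do not tend to `0`. -/
theorem exists_norm_robinRem_le_of_strip (hM : IsKernel M) (h H : ℂ) (τ₀ : ℝ) {ε : ℝ}
    (hε : 0 < ε) : ∃ R : ℝ, ∀ ρ : ℂ, |ρ.im| ≤ τ₀ → 0 ≤ ρ.re → R ≤ ‖ρ‖ →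
      ‖robinRem hM h H ρ‖ ≤ ε := by
  classical
  set P : ℕ → ℂ → Prop := fun k z => ‖z‖ ≤ 1 + |τ₀| ∧ ε < ‖robinRem hM h H (k + z)‖ with hP
  -- A bad offset is selected wherever one exists. The radius `1 + |τ₀|` covers every point of the
  -- strip measured from the floor of its real part.
  set ζ : ℕ → ℂ := fun k => if hk : ∃ z, P k z then hk.choose else 0 with hζ
  have hζb : ∀ k, ‖ζ k‖ ≤ 1 + |τ₀| := by
    intro k
    simp only [hζ]
    split_ifs with hk
    · exact hk.choose_spec.1
    · rw [norm_zero]; positivity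
  have hlim := (summable_sq_norm_robinRem hM h H hζb).tendsto_atTop_zero
  have hev := hlim.eventually (gt_mem_nhds (by positivity : (0 : ℝ) < ε ^ 2))
  obtain ⟨N, hN⟩ := Filter.eventually_atTop.1 hev
  refine ⟨N + 1 + |τ₀|, fun ρ him hre hρ => ?_⟩
  by_contra! hcon
  set k := ⌊ρ.re⌋₊ with hk
  have h1 : (k : ℝ) ≤ ρ.re := Nat.floor_le hre
  have h2 : ρ.re < k + 1 := Nat.lt_floor_add_one _
  have h3 : ‖ρ‖ ≤ ρ.re + |τ₀| := by
    have h4 := Complex.norm_le_abs_re_add_abs_im ρ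
    rw [abs_of_nonneg hre] at h4
    linarith [le_abs_self τ₀]
  have hNk : N ≤ k := by
    have : (N : ℝ) < k + 1 := by linarith
    exact Nat.lt_succ_iff.1 (by exact_mod_cast this)
  have hex : ∃ z, P k z := by
    refine ⟨ρ - k, ?_, by simpa using hcon⟩
    refine (Complex.norm_le_abs_re_add_abs_im _).trans (add_le_add ?_ ?_)
    · rw [Complex.sub_re, Complex.natCast_re, abs_of_nonneg (by linarith)]
      linarith
    · rw [Complex.sub_im, Complex.natCast_im, sub_zero]
      exact him.trans (le_abs_self _)
  have h5 : ε < ‖robinRem hM h H (k + ζ k)‖ := by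
    simp only [hζ, dif_pos hex]
    exact hex.choose_spec.2
  have h6 := hN k hNk
  have h7 := pow_lt_pow_left₀ h5 hε.le two_ne_zero
  exact lt_asymm h6 h7

/-- The strip and its complement together cover the plane; the left half of the strip is reached by
oddness of the remainder. -/
theorem exists_norm_robinRem_le_mul_exp (hM : IsKernel M) (h H : ℂ) {ε : ℝ} (hε : 0 < ε) :
    ∃ R : ℝ, ∀ ρ : ℂ, R ≤ ‖ρ‖ → ‖robinRem hM h H ρ‖ ≤ ε * Real.exp (π * |ρ.im|) := by
  obtain ⟨τ₀, R₁, h1⟩ := exists_norm_robinRem_le_of_abs_im hM h H hε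
  obtain ⟨R₂, h2⟩ := exists_norm_robinRem_le_of_strip hM h H τ₀ hε
  refine ⟨max R₁ R₂, fun ρ hρ => ?_⟩
  rcases lt_or_ge τ₀ |ρ.im| with him | him
  · exact h1 ρ him ((le_max_left _ _).trans hρ)
  · have h3 : ‖robinRem hM h H ρ‖ ≤ ε := by
      rcases le_total 0 ρ.re with hre | hre
      · exact h2 ρ him hre ((le_max_right _ _).trans hρ)
      · have h4 := h2 (-ρ) (by simpa using him) (by simpa using hre)
          (by rw [norm_neg]; exact (le_max_right _ _).trans hρ)
        rwa [robinRem_neg, norm_neg] at h4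
    refine h3.trans (le_mul_of_one_le_right hε.le (Real.one_le_exp ?_))
    have := Real.pi_pos
    positivity

end RobinAsymptotics

/-! ### The unperturbed Neumann problem -/

section Comparison

theorem isKernel_zero : IsKernel 0 := by
  simp [IsKernel]

theorem sinRem_kernel_zero (ρ : ℂ) (x : ℝ) : sinRem isKernel_zero ρ x = 0 := by
  simp [sinRem, memTerm, cv]

/-- The comparison function for Rouché's theorem is the characteristic function of the case `M = 0`,
`h = H = 0`, so it is entire as a function of `ρ²` without a separate construction. -/
theorem robinDet_kernel_zero (ρ : ℂ) :
    robinDet isKernel_zero 0 0 (ρ ^ 2) = -ρ * Complex.sin (π * ρ) := by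
  rw [robinDet_eq]
  rcases eq_or_ne ρ 0 with rfl | hρ
  · simp
  · have h1 := mul_eigenSol_eq isKernel_zero hρ (right_mem_Icc.2 Real.pi_pos.le)
    rw [sinRem_kernel_zero, add_zero, sinFun, mul_comm ρ (π : ℂ)] at h1
    linear_combination -ρ * h1

end Comparison

end

/-! ### Spectrum and eigenvalue asymptotics of the Robin operator -/

theorem theorem1 (M : ℝ → ℂ) (hM : IsKernel M) (h H : ℂ) :
    ∃ lam κ : ℕ → ℂ,
      opSpectrum (robinOperator M hM h H) = Set.range lam ∧
      (∀ k : ℕ, IsOpEigenvalue (robinOperator M hM h H) (lam k)) ∧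
      (∀ z : ℂ, Module.rank ℂ (opRootSpace (robinOperator M hM h H) z) =
        Cardinal.mk {k : ℕ // lam k = z}) ∧
      (∀ k : ℕ, lam k = ((k : ℂ) + κ k) ^ 2) ∧
      Memℓp κ 2 := by
  have hA := isVolterraModel_robinOperator hM h H
  have hd : Differentiable ℂ (robinDet hM h H) := hA.differentiable_charDet
  obtain ⟨hord, lam, κ, hzero, hmult, hlam, hκ⟩ := exists_enumeration_zeros hd
    (isVolterraModel_robinOperator isKernel_zero 0 0).differentiable_charDet
    robinDet_kernel_zero (fun ρ hρ => robinDet_sq_eq hM h H hρ)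
    (fun ε hε => exists_norm_robinRem_le_mul_exp hM h H hε)
    (fun ζ hζ => summable_sq_norm_robinRem hM h H hζ)
  refine ⟨lam, κ, ?_, fun k => (hA.isOpEigenvalue_iff _).2 (hzero k), fun z => ?_, hlam, hκ⟩
  · rw [hA.opSpectrum_eq]
    ext z
    refine ⟨fun hz => ?_, ?_⟩
    · have h1 : analyticOrderNatAt (robinDet hM h H) z ≠ 0 := by
        intro h0
        have h2 := Nat.cast_analyticOrderNatAt (hord z)
        rw [h0, Nat.cast_zero] at h2
        exact ((hd.analyticAt z).analyticOrderAt_eq_zero.1 h2.symm) hz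
      have h3 : Cardinal.mk {k // lam k = z} ≠ 0 := by
        rw [hmult]
        exact_mod_cast h1
      obtain ⟨⟨k, hk⟩⟩ := Cardinal.mk_ne_zero_iff.1 h3
      exact ⟨k, hk⟩
    · rintro ⟨k, rfl⟩
      exact hzero k
  · rw [hmult]
    exact hA.rank_opRootSpace z (hord z)
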